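/- **Setting.** Let $n,m\ge 0$, $\mathcal U=\{1,\dots,n\}$, $\mathcal V=\{1,\dots,m\}$, and let the index $n+1$ (resp. $m+1$) stand for a null element $\epsilon$ added to $\mathcal U$ (resp. $\mathcal V$). Let $\mathbf C\in[0,+\infty)^{(n+1)\times(m+1)}$ with $c_{n+1,m+1}=0$. An *$\epsilon$-assignment* is a map $\varphi$ from $\mathcal U\cup\{\epsilon\}$ to the subsets of $\mathcal V\cup\{\epsilon\}$ such that $|\varphi(i)|=1$ for all $i\in\mathcal U$, every $j\in\mathcal V$ belongs to exactly one of the sets $\varphi(i)$, $i\in\mathcal U\cup\{\epsilon\}$, and $\epsilon\in\varphi(\epsilon)$; it is *partial* if "exactly one" is replaced by "at most one" in both places. A (partial) $\epsilon$-assignment is encoded by vectors $\rho\in\{0,\dots,m+1\}^n$ and $\varrho\in\{0,\dots,n+1\}^m$, where $\rho_i$ is the image of $i\in\mathcal U$, $\varrho_j$ is the preimage of $j\in\mathcal V$, and $0$ means "unassigned". The *LSAPE* is to minimise $\sum_{i=1}^{n+1}\sum_{j\in\varphi(i)}c_{i,j}$ over all $\epsilon$-assignments. Its *dual problem* is to maximise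 $\sum_{i=1}^{n+1}u_i+\sum_{j=1}^{m+1}v_j$ over all real $\mathbf u,\mathbf v$ with $u_{n+1}=v_{m+1}=0$ and $u_i+v_j\le c_{i,j}$ for all $i\le n+1$, $j\le m+1$. A partial $\epsilon$-assignment and dual feasible $(\mathbf u,\mathbf v)$ satisfy *complementary slackness* if $c_{i,j}=u_i+v_j$ whenever $j\in\varphi(i)$. **Algorithms.** *Pre-processing*: set $u_{n+1}=v_{m+1}=0$, $u_i=\min_{j\le m+1}c_{i,j}$ for $i\in\mathcal U$, $v_j=\min_{i\le n+1}(c_{i,j}-u_i)$ for $j\in\mathcal V$; start from $\rho=0$, $\varrho=0$ and, for $i=1,\dots,n$, assign $i$ to the first $j\in\mathcal V$ with $\varrho_j=0$ and $c_{i,j}=u_i+v_j$, or, if there is none and $c_{i,m+1}=u_i$, to $\epsilon$; then for each $j\in\mathcal V$ with $\varrho_j=0$ and $c_{n+1,j}=v_j$ set $\varrho_j=n+1$. *Modified Hungarian algorithm*, on input $(\mathbf C,\rho,\varrho,\mathbf u,\mathbf v)$: for each $k\in\mathcal V$ with $\varrho_k=0$, call Augment$(k)$ and exchange assigned and unassigned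 pairs along the path that it returns; afterwards do the same with $\mathcal U$ and $\mathcal V$, $\rho$ and $\varrho$, $\mathbf u$ and $\mathbf v$ exchanged and $\mathbf C$ transposed. Augment$(k)$ starts with $SV=SU=LU=\emptyset$, $\pi_i=+\infty$ for $i\in\mathcal U$ and $j=k$, and repeats the following steps until a sink is found. 1. Add $j$ to $SV$. If $\varrho_j\le n$ and $c_{n+1,j}=v_j$, the sink is $\epsilon$, reached from $j$. 2. For each $i\in\mathcal U\setminus LU$ with $c_{i,j}-u_i-v_j<\pi_i$, set $\pi_i$ to this value and $\mathrm{pred}_i=j$; if now $\pi_i=0$, then $i$ is the sink in case $\rho_i\in\{0,m+1\}$, and otherwise $i$ is added to $LU$. 3. If $LU=SU$, let $\delta_s=\min_{i\in\mathcal U\setminus LU}\pi_i$, $\delta_\epsilon=\min_{j\in SV}(c_{n+1,j}-v_j)$, attained at $l$, and $\delta=\min\{\delta_s,\delta_\epsilon\}$; add $\delta$ to $v_j$ for $j\in SV$ and subtract it from $u_i$ for $i\in LU$. If $\delta_\epsilon\le\delta_s$, the sink is $\epsilon$, reached from $l$. Otherwise subtract $\delta$ from $\pi_i$ for each $i\in\mathcal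 U\setminus LU$, and if this gives $\pi_i=0$, proceed with $i$ as in step 2. 4. Move an arbitrary $i\in LU\setminus SU$ into $SU$ and set $j=\rho_i$. The path is read off backwards from the sink through $\mathrm{pred}$ and the current assignment. These algorithms are implemented on a random access machine with exact real arithmetic, integer cells, a read-only input matrix and one-dimensional arrays. Every elementary operation takes one unit of time and allocating an array takes time proportional to its length. Space is the maximal number of cells in use, including the input matrix. The sets $SU\subseteq LU\subseteq\mathcal U$ are stored as consecutive segments of an array that holds a permutation of $\mathcal U$. **Proposition.** There is an absolute constant $K$ such that for all $n$, $m$, $\mathbf C$ as above and for every way of making the arbitrary choices in step 4: 1. for every input $(\mathbf C,\rho,\varrho,\mathbf u,\mathbf v)$ in which $(\rho,\varrho)$ encodes a partial $\epsilon$-assignment that satisfies complementary slackness with the dual feasible pair $(\mathbf u,\mathbf v)$, the modified Hungarian algorithm terminates and returns vectors $(\rho,\varrho)$ that encode an optimal solution of the LSAPE, together with an optimal solution $(\mathbf u,\mathbf v)$ of the dual problem; if $n,m\ge1$, it takes time at most $K\min\{n,m\}^2\max\{n,m\}$ and space at most $K\,nm$; 2. the same holds, on input $\mathbf C$, for the pre-processing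 followed by the modified Hungarian algorithm, the time and space of the pre-processing included. -/

import Mathlib

/-!
# The linear sum assignment problem with edition (LSAPE), its dual, and a Hungarian algorithm

Conventions: `U = {1, …, n}`, `V = {1, …, m}`, the null element `ε` is the index `n + 1` on the
side of `U` and the index `m + 1` on the side of `V`.  An edit cost matrix is given by its entries
`C i j` with `1 ≤ i ≤ n + 1` and `1 ≤ j ≤ m + 1`; entries outside this range are never used.
-/

namespace LSAPE

/-! ## The problem and its dual -/

/-- Edit cost matrices: non-negative real entries, and `C (n+1) (m+1) = 0` (for `ε → ε`). -/
def IsEditCost (n m : ℕ) (C : ℕ → ℕ → ℝ) : Prop :=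
  (∀ i ∈ Finset.Icc 1 (n + 1), ∀ j ∈ Finset.Icc 1 (m + 1), 0 ≤ C i j) ∧ C (n + 1) (m + 1) = 0

/-- Partial `ε`-assignments: maps `φ` from `U ∪ {ε}` to the subsets of `V ∪ {ε}` such that
every element of `U` has at most one image, every element of `V` at most one preimage, and
`ε ∈ φ ε`. -/
def IsPartialEpsAssignment (n m : ℕ) (φ : ℕ → Finset ℕ) : Prop :=
  (∀ i ∈ Finset.Icc 1 (n + 1), φ i ⊆ Finset.Icc 1 (m + 1)) ∧
  (∀ i ∈ Finset.Icc 1 n, (φ i).card ≤ 1) ∧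
  (∀ j ∈ Finset.Icc 1 m, ((Finset.Icc 1 (n + 1)).filter (fun i => j ∈ φ i)).card ≤ 1) ∧
  m + 1 ∈ φ (n + 1)

/-- `ε`-assignments: every element of `U` has exactly one image, every element of `V` exactly one
preimage, and `ε ∈ φ ε`. -/
def IsEpsAssignment (n m : ℕ) (φ : ℕ → Finset ℕ) : Prop :=
  (∀ i ∈ Finset.Icc 1 (n + 1), φ i ⊆ Finset.Icc 1 (m + 1)) ∧
  (∀ i ∈ Finset.Icc 1 n, (φ i).card = 1) ∧
  (∀ j ∈ Finset.Icc 1 m, ((Finset.Icc 1 (n + 1)).filter (fun i => j ∈ φ i)).card = 1) ∧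
  m + 1 ∈ φ (n + 1)

/-- The total cost of the edit operations selected by `φ`. -/
noncomputable def totalCost (n : ℕ) (C : ℕ → ℕ → ℝ) (φ : ℕ → Finset ℕ) : ℝ :=
  ∑ i ∈ Finset.Icc 1 (n + 1), ∑ j ∈ φ i, C i j

/-- Solutions of the LSAPE: `ε`-assignments of minimal total cost. -/
def IsOptimalAssignment (n m : ℕ) (C : ℕ → ℕ → ℝ) (φ : ℕ → Finset ℕ) : Prop :=
  IsEpsAssignment n m φ ∧
    ∀ ψ : ℕ → Finset ℕ, IsEpsAssignment n m ψ → totalCost n C φ ≤ totalCost n C ψ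

/-- Feasible dual variables: `u i + v j ≤ C i j` everywhere, with `u` and `v` zero at `ε`. -/
def IsDualFeasible (n m : ℕ) (C : ℕ → ℕ → ℝ) (u v : ℕ → ℝ) : Prop :=
  u (n + 1) = 0 ∧ v (m + 1) = 0 ∧
    ∀ i ∈ Finset.Icc 1 (n + 1), ∀ j ∈ Finset.Icc 1 (m + 1), u i + v j ≤ C i j

/-- The objective function of the dual problem. -/
noncomputable def dualValue (n m : ℕ) (u v : ℕ → ℝ) : ℝ :=
  ∑ i ∈ Finset.Icc 1 (n + 1), u i + ∑ j ∈ Finset.Icc 1 (m + 1), v j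

/-- Solutions of the dual problem: feasible dual variables of maximal value. -/
def IsOptimalDual (n m : ℕ) (C : ℕ → ℕ → ℝ) (u v : ℕ → ℝ) : Prop :=
  IsDualFeasible n m C u v ∧
    ∀ u' v' : ℕ → ℝ, IsDualFeasible n m C u' v' → dualValue n m u' v' ≤ dualValue n m u v

/-- Complementary slackness between a (partial) `ε`-assignment and feasible dual variables:
`C i j = u i + v j` on every selected pair. -/
def CompSlack (n m : ℕ) (C : ℕ → ℕ → ℝ) (φ : ℕ → Finset ℕ) (u v : ℕ → ℝ) : Prop :=
  IsDualFeasible n m C u v ∧ ∀ i ∈ Finset.Icc 1 (n + 1), ∀ j ∈ φ i, C i j = u i + v j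

/-- The pair of vectors `(ρ, ϱ)` encodes the (partial) `ε`-assignment `φ`: for `i ∈ U`, `ρ i` is
the image of `i`, or `0` if there is none; for `j ∈ V`, `ϱ j` is the preimage of `j`, or `0` if
there is none. -/
def Encodes (n m : ℕ) (ρ ϱ : ℕ → ℕ) (φ : ℕ → Finset ℕ) : Prop :=
  (∀ i ∈ Finset.Icc 1 n,
    (∀ j ∈ Finset.Icc 1 (m + 1), ρ i = j ↔ j ∈ φ i) ∧
    (ρ i = 0 ↔ ∀ j ∈ Finset.Icc 1 (m + 1), j ∉ φ i)) ∧
  (∀ j ∈ Finset.Icc 1 m,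
    (∀ i ∈ Finset.Icc 1 (n + 1), ϱ j = i ↔ j ∈ φ i) ∧
    (ϱ j = 0 ↔ ∀ i ∈ Finset.Icc 1 (n + 1), j ∉ φ i))

/-! ## The machine model

A random access machine with natural-number cells and (extended) real cells, a read-only input
matrix, one-dimensional arrays with bound checks (a program that leaves the bounds is stuck), and
structured control flow.  Every node of an expression, every assignment, every test and every
choice costs one unit of time; the allocation of an array costs its length in addition.  Space is
the number of cells: the input matrix, the scalar variables and the allocated arrays. -/

/-- Natural-number variables. -/
inductive NVar
  | n | m | i | j | k | l | p | q | r | si | sj | nSU | nLU | nSV | found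
  deriving DecidableEq

/-- Real variables. -/
inductive RVar
  | w | δs | δε | δ
  deriving DecidableEq

/-- Names of arrays of natural numbers. -/
inductive NArr
  | ρ | ϱ | pred | P | SV
  deriving DecidableEq

/-- Names of arrays of reals. -/
inductive RArr
  | u | v | π
  deriving DecidableEq

instance : Fintype NVar where
  elems := {.n, .m, .i, .j, .k, .l, .p, .q, .r, .si, .sj, .nSU, .nLU, .nSV, .found}
  complete := by intro a; cases a <;> decide

instance : Fintype RVar where
  elems := {.w, .δs, .δε, .δ}
  complete := by intro a; cases a <;> decide

instance : Fintype NArr where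
  elems := {.ρ, .ϱ, .pred, .P, .SV}
  complete := by intro a; cases a <;> decide

instance : Fintype RArr where
  elems := {.u, .v, .π}
  complete := by intro a; cases a <;> decide

/-- An array with indices `1, …, len`. -/
structure Arr (α : Type) where
  len : ℕ
  val : ℕ → α

/-- Read a cell; undefined out of bounds. -/
def Arr.read {α : Type} (a : Arr α) (i : ℕ) : Option α :=
  if 1 ≤ i ∧ i ≤ a.len then some (a.val i) else none

/-- Write a cell; undefined out of bounds. -/
def Arr.write {α : Type} (a : Arr α) (i : ℕ) (x : α) : Option (Arr α) :=
  if 1 ≤ i ∧ i ≤ a.len then some ⟨a.len, Function.update a.val i x⟩ else none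

/-- The read-only input matrix, with row indices `1, …, rows` and column indices `1, …, cols`. -/
structure Input where
  rows : ℕ
  cols : ℕ
  entry : ℕ → ℕ → ℝ

/-- The state of the machine, with the time elapsed and the largest number of cells used so far. -/
structure State where
  nv : NVar → ℕ
  rv : RVar → EReal
  na : NArr → Arr ℕ
  ra : RArr → Arr EReal
  time : ℕ
  peak : ℕ

/-- The number of cells in use: the input matrix, the scalar variables, and the arrays. -/
def space (inp : Input) (na : NArr → Arr ℕ) (ra : RArr → Arr EReal) : ℕ :=
  inp.rows * inp.cols + Fintype.card NVar + Fintype.card RVar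
    + ∑ a, (na a).len + ∑ a, (ra a).len

/-- Expressions with natural-number values. -/
inductive NExp
  | lit (k : ℕ)
  | var (x : NVar)
  | get (a : NArr) (e : NExp)
  | add (e f : NExp)

/-- Expressions with (extended) real values; `mat e f` reads an entry of the input matrix. -/
inductive RExp
  | zero
  | infty
  | var (x : RVar)
  | get (a : RArr) (e : NExp)
  | mat (e f : NExp)
  | add (e f : RExp)
  | sub (e f : RExp)

/-- Tests. -/
inductive BExp
  | eqN (e f : NExp)
  | leN (e f : NExp)
  | eqR (e f : RExp)
  | ltR (e f : RExp)
  | leR (e f : RExp)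
  | not (b : BExp)
  | and (b c : BExp)
  | or (b c : BExp)

/-- Statements. -/
inductive Stmt
  | skip
  | setN (x : NVar) (e : NExp)
  | setR (x : RVar) (e : RExp)
  | putN (a : NArr) (i : NExp) (e : NExp)
  | putR (a : RArr) (i : NExp) (e : RExp)
  | allocN (a : NArr) (l : NExp) (e : NExp)
  | allocR (a : RArr) (l : NExp) (e : RExp)
  | seq (s t : Stmt)
  | cond (b : BExp) (s t : Stmt)
  | loop (b : BExp) (s : Stmt)
  | choose (x : NVar) (lo hi : NExp)

/-- Time to evaluate an expression: its number of nodes. -/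
def NExp.cost : NExp → ℕ
  | lit _ => 1
  | var _ => 1
  | get _ e => e.cost + 1
  | add e f => e.cost + f.cost + 1

/-- Time to evaluate an expression: its number of nodes. -/
def RExp.cost : RExp → ℕ
  | zero => 1
  | infty => 1
  | var _ => 1
  | get _ e => e.cost + 1
  | mat e f => e.cost + f.cost + 1
  | add e f => e.cost + f.cost + 1
  | sub e f => e.cost + f.cost + 1

/-- Time to evaluate a test: its number of nodes. -/
def BExp.cost : BExp → ℕ
  | eqN e f => e.cost + f.cost + 1
  | leN e f => e.cost + f.cost + 1
  | eqR e f => e.cost + f.cost + 1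
  | ltR e f => e.cost + f.cost + 1
  | leR e f => e.cost + f.cost + 1
  | not b => b.cost + 1
  | and b c => b.cost + c.cost + 1
  | or b c => b.cost + c.cost + 1

/-- Value of an expression (undefined if some array is read out of bounds). -/
def NExp.eval (s : State) : NExp → Option ℕ
  | lit k => some k
  | var x => some (s.nv x)
  | get a e => do (s.na a).read (← e.eval s)
  | add e f => do return (← e.eval s) + (← f.eval s)

/-- Value of an expression (undefined if an array or the matrix is read out of bounds). -/
noncomputable def RExp.eval (inp : Input) (s : State) : RExp → Option EReal
  | zero => some 0
  | infty => some ⊤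
  | var x => some (s.rv x)
  | get a e => do (s.ra a).read (← e.eval s)
  | mat e f => do
      let i ← e.eval s
      let j ← f.eval s
      if 1 ≤ i ∧ i ≤ inp.rows ∧ 1 ≤ j ∧ j ≤ inp.cols then
        return ((inp.entry i j : ℝ) : EReal)
      else none
  | add e f => do return (← e.eval inp s) + (← f.eval inp s)
  | sub e f => do return (← e.eval inp s) - (← f.eval inp s)

open Classical in
/-- Value of a test. -/
noncomputable def BExp.eval (inp : Input) (s : State) : BExp → Option Bool
  | eqN e f => do return decide ((← e.eval s) = (← f.eval s))
  | leN e f => do return decide ((← e.eval s) ≤ (← f.eval s))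
  | eqR e f => do return decide ((← e.eval inp s) = (← f.eval inp s))
  | ltR e f => do return decide ((← e.eval inp s) < (← f.eval inp s))
  | leR e f => do return decide ((← e.eval inp s) ≤ (← f.eval inp s))
  | not b => do return !(← b.eval inp s)
  | and b c => do return (← b.eval inp s) && (← c.eval inp s)
  | or b c => do return (← b.eval inp s) || (← c.eval inp s)

/-- Let `t` units of time pass. -/
def State.tick (s : State) (t : ℕ) : State := { s with time := s.time + t }

/-- Assign a natural-number variable. -/
def State.setN (s : State) (x : NVar) (k : ℕ) : State :=
  { s with nv := Function.update s.nv x k }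

/-- Assign a real variable. -/
def State.setR (s : State) (x : RVar) (y : EReal) : State :=
  { s with rv := Function.update s.rv x y }

/-- Replace an array of natural numbers and update the space record. -/
def State.storeN (inp : Input) (s : State) (a : NArr) (A : Arr ℕ) : State :=
  { s with
    na := Function.update s.na a A
    peak := max s.peak (space inp (Function.update s.na a A) s.ra) }

/-- Replace an array of reals and update the space record. -/
def State.storeR (inp : Input) (s : State) (a : RArr) (A : Arr EReal) : State :=
  { s with
    ra := Function.update s.ra a A
    peak := max s.peak (space inp s.na (Function.update s.ra a A)) }

/-- `Exec ω inp c s s'`: started in the state `s`, the statement `c` terminates in the state `s'`.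
The statement `choose x lo hi` sets `x` to an arbitrary element of `{lo, …, hi}` (it is stuck if
this set is empty).  The choices are resolved by the stream `ω`, read at the current time; since
time increases strictly, every sequence of choices is produced by some `ω`. -/
inductive Exec (ω : ℕ → ℕ) (inp : Input) : Stmt → State → State → Prop
  | skip (s : State) : Exec ω inp .skip s s
  | setN {s : State} {x : NVar} {e : NExp} {k : ℕ} (he : e.eval s = some k) :
      Exec ω inp (.setN x e) s ((s.setN x k).tick (e.cost + 1))
  | setR {s : State} {x : RVar} {e : RExp} {y : EReal} (he : e.eval inp s = some y) :
      Exec ω inp (.setR x e) s ((s.setR x y).tick (e.cost + 1))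
  | putN {s : State} {a : NArr} {i e : NExp} {p k : ℕ} {A : Arr ℕ}
      (hi : i.eval s = some p) (he : e.eval s = some k) (hA : (s.na a).write p k = some A) :
      Exec ω inp (.putN a i e) s ((s.storeN inp a A).tick (i.cost + e.cost + 1))
  | putR {s : State} {a : RArr} {i : NExp} {e : RExp} {p : ℕ} {y : EReal} {A : Arr EReal}
      (hi : i.eval s = some p) (he : e.eval inp s = some y) (hA : (s.ra a).write p y = some A) :
      Exec ω inp (.putR a i e) s ((s.storeR inp a A).tick (i.cost + e.cost + 1))
  | allocN {s : State} {a : NArr} {l e : NExp} {p k : ℕ}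
      (hl : l.eval s = some p) (he : e.eval s = some k) :
      Exec ω inp (.allocN a l e) s
        ((s.storeN inp a ⟨p, fun _ => k⟩).tick (l.cost + e.cost + p + 1))
  | allocR {s : State} {a : RArr} {l : NExp} {e : RExp} {p : ℕ} {y : EReal}
      (hl : l.eval s = some p) (he : e.eval inp s = some y) :
      Exec ω inp (.allocR a l e) s
        ((s.storeR inp a ⟨p, fun _ => y⟩).tick (l.cost + e.cost + p + 1))
  | seq {c d : Stmt} {s s' s'' : State} (hc : Exec ω inp c s s') (hd : Exec ω inp d s' s'') :
      Exec ω inp (.seq c d) s s''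
  | condTrue {b : BExp} {c d : Stmt} {s s' : State} (hb : b.eval inp s = some true)
      (hc : Exec ω inp c (s.tick (b.cost + 1)) s') : Exec ω inp (.cond b c d) s s'
  | condFalse {b : BExp} {c d : Stmt} {s s' : State} (hb : b.eval inp s = some false)
      (hd : Exec ω inp d (s.tick (b.cost + 1)) s') : Exec ω inp (.cond b c d) s s'
  | loopTrue {b : BExp} {c : Stmt} {s s' s'' : State} (hb : b.eval inp s = some true)
      (hc : Exec ω inp c (s.tick (b.cost + 1)) s') (hl : Exec ω inp (.loop b c) s' s'') :
      Exec ω inp (.loop b c) s s''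
  | loopFalse {b : BExp} {c : Stmt} {s : State} (hb : b.eval inp s = some false) :
      Exec ω inp (.loop b c) s (s.tick (b.cost + 1))
  | choose {s : State} {x : NVar} {lo hi : NExp} {a b : ℕ}
      (hlo : lo.eval s = some a) (hhi : hi.eval s = some b) (hab : a ≤ b) :
      Exec ω inp (.choose x lo hi) s
        ((s.setN x (a + ω s.time % (b + 1 - a))).tick (lo.cost + hi.cost + 1))

/-- For a given resolution of the choices the final state is unique. -/
theorem Exec.unique {ω : ℕ → ℕ} {inp : Input} {c : Stmt} {s s₁ s₂ : State}
    (h₁ : Exec ω inp c s s₁) (h₂ : Exec ω inp c s s₂) : s₁ = s₂ := by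
  induction h₁ generalizing s₂ with
  | skip => cases h₂; rfl
  | setN he => cases h₂; simp_all
  | setR he => cases h₂; simp_all
  | putN hi he hA => cases h₂; simp_all
  | putR hi he hA => cases h₂; simp_all
  | allocN hl he => cases h₂; simp_all
  | allocR hl he => cases h₂; simp_all
  | seq _ _ ih₁ ih₂ =>
    cases h₂ with
    | seq hc hd => cases ih₁ hc; exact ih₂ hd
  | condTrue hb _ ih =>
    cases h₂ with
    | condTrue hb' hc => exact ih hc
    | condFalse hb' hc => simp_all
  | condFalse hb _ ih =>
    cases h₂ with
    | condTrue hb' hc => simp_all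
    | condFalse hb' hc => exact ih hc
  | loopTrue hb _ _ ih₁ ih₂ =>
    cases h₂ with
    | loopTrue hb' hc hl => cases ih₁ hc; exact ih₂ hl
    | loopFalse hb' => simp_all
  | loopFalse hb =>
    cases h₂ with
    | loopTrue hb' hc hl => simp_all
    | loopFalse hb' => rfl
  | choose hlo hhi hab => cases h₂; simp_all

/-! ## The algorithms -/

instance (k : ℕ) : OfNat NExp k := ⟨.lit k⟩
instance : Add NExp := ⟨.add⟩
instance : Add RExp := ⟨.add⟩
instance : Sub RExp := ⟨.sub⟩

/-- The value of a natural-number variable. -/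
abbrev N (x : NVar) : NExp := .var x

/-- The value of a real variable. -/
abbrev X (x : RVar) : RExp := .var x

/-- The entry of an array of natural numbers. -/
abbrev NArr.at (a : NArr) (e : NExp) : NExp := .get a e

/-- The entry of an array of reals. -/
abbrev RArr.at (a : RArr) (e : NExp) : RExp := .get a e

infixr:30 " ;; " => Stmt.seq

/-- `for x = a, …, b do c`. -/
def forLoop (x : NVar) (a b : NExp) (c : Stmt) : Stmt :=
  .setN x a ;; .loop (.leN (N x) b) (c ;; .setN x (N x + 1))

/-- `if b then c`. -/
def ifThen (b : BExp) (c : Stmt) : Stmt := .cond b c .skip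

/-- Exchange two entries of the permutation `P` (`NVar.r` is used as scratch). -/
def swapP (e f : NExp) : Stmt :=
  .setN .r (NArr.P.at e) ;; .putN .P e (NArr.P.at f) ;; .putN .P f (N .r)

section Programs

open NVar RVar

/-- Computation of initial dual variables and of an initial partial `ε`-assignment. -/
def preproc : Stmt :=
  .allocR .u (N n + 1) .zero ;;
  .allocR .v (N m + 1) .zero ;;
  .allocN .ρ (N n) 0 ;;
  .allocN .ϱ (N m) 0 ;;
  forLoop i 1 (N n) (
    .setR w .infty ;;
    forLoop j 1 (N m + 1) (
      ifThen (.ltR (.mat (N i) (N j)) (X w)) (.setR w (.mat (N i) (N j)))) ;;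
    .putR .u (N i) (X w)) ;;
  forLoop j 1 (N m) (
    .setR w .infty ;;
    forLoop i 1 (N n + 1) (
      ifThen (.ltR (.mat (N i) (N j) - RArr.u.at (N i)) (X w))
        (.setR w (.mat (N i) (N j) - RArr.u.at (N i)))) ;;
    .putR .v (N j) (X w)) ;;
  forLoop i 1 (N n) (
    .setN j 1 ;;
    .setN found 0 ;;
    .loop (.and (.leN (N j) (N m)) (.eqN (N found) 0)) (
      ifThen (.and (.eqN (NArr.ϱ.at (N j)) 0)
          (.eqR (.mat (N i) (N j)) (RArr.u.at (N i) + RArr.v.at (N j)))) (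
        .putN .ρ (N i) (N j) ;;
        .putN .ϱ (N j) (N i) ;;
        .setN found 1) ;;
      .setN j (N j + 1)) ;;
    ifThen (.and (.eqN (NArr.ρ.at (N i)) 0) (.eqR (.mat (N i) (N m + 1)) (RArr.u.at (N i))))
      (.putN .ρ (N i) (N m + 1))) ;;
  forLoop j 1 (N m) (
    ifThen (.and (.eqN (NArr.ϱ.at (N j)) 0) (.eqR (.mat (N n + 1) (N j)) (RArr.v.at (N j))))
      (.putN .ϱ (N j) (N n + 1)))

/-- The names under which `augment` and `assignCols` access their arguments; the two sides of the
assignment can be exchanged (then the input matrix is read transposed). -/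
structure Roles where
  n : NVar
  m : NVar
  ρ : NArr
  ϱ : NArr
  u : RArr
  v : RArr
  c : NExp → NExp → RExp

/-- Growth of a tree of minimal alternating paths rooted in `k`, until a sink is found.  The sets
are encoded by the permutation `P` of `{1, …, n}` and the vector `SV`: `SU` is
`P 1, …, P nSU`, `LU` is `P 1, …, P nLU`, and `SV` is `SV 1, …, SV nSV`.  The sink is returned
in the variables `(si, sj)`. -/
def augment (R : Roles) : Stmt :=
  forLoop p 1 (N R.n) (.putR .π (N p) .infty ;; .putN .P (N p) (N p)) ;;
  .setN nSU 0 ;; .setN nLU 0 ;; .setN nSV 0 ;; .setN found 0 ;;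
  .setN j (N k) ;;
  .loop (.eqN (N found) 0) (
    .setN nSV (N nSV + 1) ;;
    .putN .SV (N nSV) (N j) ;;
    .cond (.and (.leN (R.ϱ.at (N j)) (N R.n))
        (.eqR (R.c (N R.n + 1) (N j) - R.v.at (N j)) .zero))
      (.setN si (N R.n + 1) ;; .setN sj (N j) ;; .setN found 1)
      ( -- find candidate nodes and update the tree
       .setN p (N nLU + 1) ;;
       .loop (.and (.leN (N p) (N R.n)) (.eqN (N found) 0)) (
          .setN i (NArr.P.at (N p)) ;;
          .setR w (R.c (N i) (N j) - R.u.at (N i) - R.v.at (N j)) ;;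
          ifThen (.ltR (X w) (RArr.π.at (N i))) (
            .putN .pred (N i) (N j) ;;
            .putR .π (N i) (X w) ;;
            ifThen (.eqR (RArr.π.at (N i)) .zero) (
              .cond (.or (.eqN (R.ρ.at (N i)) 0) (.eqN (R.ρ.at (N i)) (N R.m + 1)))
                (.setN si (N i) ;; .setN sj 0 ;; .setN found 1)
                (.setN nLU (N nLU + 1) ;; swapP (N p) (N nLU)))) ;;
          .setN p (N p + 1)) ;;
       -- update dual variables and find candidate nodes
       ifThen (.and (.eqN (N found) 0) (.eqN (N nLU) (N nSU))) (
          .setR δs .infty ;;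
          forLoop p (N nLU + 1) (N R.n) (
            ifThen (.ltR (RArr.π.at (NArr.P.at (N p))) (X δs))
              (.setR δs (RArr.π.at (NArr.P.at (N p))))) ;;
          .setR δε .infty ;;
          forLoop p 1 (N nSV) (
            .setN q (NArr.SV.at (N p)) ;;
            ifThen (.ltR (R.c (N R.n + 1) (N q) - R.v.at (N q)) (X δε))
              (.setN l (N q) ;; .setR δε (R.c (N R.n + 1) (N q) - R.v.at (N q)))) ;;
          .cond (.leR (X δs) (X δε)) (.setR δ (X δs)) (.setR δ (X δε)) ;;
          forLoop p 1 (N nSV) (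
            .setN q (NArr.SV.at (N p)) ;; .putR R.v (N q) (R.v.at (N q) + X δ)) ;;
          forLoop p 1 (N nLU) (
            .setN q (NArr.P.at (N p)) ;; .putR R.u (N q) (R.u.at (N q) - X δ)) ;;
          .cond (.leR (X δε) (X δs))
            (.setN si (N R.n + 1) ;; .setN sj (N l) ;; .setN found 1)
            (.setN p (N nLU + 1) ;;
             .loop (.and (.leN (N p) (N R.n)) (.eqN (N found) 0)) (
                .setN i (NArr.P.at (N p)) ;;
                .putR .π (N i) (RArr.π.at (N i) - X δ) ;;
                ifThen (.eqR (RArr.π.at (N i)) .zero) (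
                  .cond (.or (.eqN (R.ρ.at (N i)) 0) (.eqN (R.ρ.at (N i)) (N R.m + 1)))
                    (.setN si (N i) ;; .setN sj 0 ;; .setN found 1)
                    (.setN nLU (N nLU + 1) ;; swapP (N p) (N nLU))) ;;
                .setN p (N p + 1)))) ;;
       -- extend the tree by an arbitrary element of `LU \ SU`
       ifThen (.eqN (N found) 0) (
          .choose q (N nSU + 1) (N nLU) ;;
          .setN nSU (N nSU + 1) ;;
          swapP (N q) (N nSU) ;;
          .setN i (NArr.P.at (N nSU)) ;;
          .setN j (R.ρ.at (N i)))))

/-- Assign all the unassigned elements of `{1, …, m}`, one after the other. -/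
def assignCols (R : Roles) : Stmt :=
  .allocR .π (N R.n) .infty ;;
  .allocN .pred (N R.n) 0 ;;
  .allocN .P (N R.n) 0 ;;
  .allocN .SV (N R.m) 0 ;;
  forLoop k 1 (N R.m) (
    ifThen (.eqN (R.ϱ.at (N k)) 0) (
      augment R ;;
      .setN i (N si) ;;
      .setN j (N sj) ;;
      .cond (.eqN (N i) (N R.n + 1))
        (.setN r (R.ϱ.at (N j)) ;; .putN R.ϱ (N j) (N i) ;; .setN i (N r))
        (.setN j 0) ;;
      .loop (.not (.eqN (N j) (N k))) (
        .setN j (NArr.pred.at (N i)) ;;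
        .putN R.ρ (N i) (N j) ;;
        .setN r (R.ϱ.at (N j)) ;;
        .putN R.ϱ (N j) (N i) ;;
        .setN i (N r))))

/-- The modified Hungarian algorithm: first the elements of `V`, then those of `U` are assigned. -/
def hungarian : Stmt :=
  assignCols ⟨n, m, .ρ, .ϱ, .u, .v, fun e f => .mat e f⟩ ;;
  assignCols ⟨m, n, .ϱ, .ρ, .v, .u, fun e f => .mat f e⟩

end Programs

/-! ## Inputs and outputs -/

/-- The input of the machine: the `(n+1) × (m+1)` matrix `C`. -/
def costInput (n m : ℕ) (C : ℕ → ℕ → ℝ) : Input := ⟨n + 1, m + 1, C⟩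

/-- The initial values of the variables: only the dimensions `n` and `m` are known. -/
def initVars (n m : ℕ) : NVar → ℕ
  | .n => n
  | .m => m
  | _ => 0

/-- The initial state when only the matrix `C` is given: no array is allocated yet. -/
noncomputable def startState (n m : ℕ) (C : ℕ → ℕ → ℝ) : State where
  nv := initVars n m
  rv := fun _ => 0
  na := fun _ => ⟨0, fun _ => 0⟩
  ra := fun _ => ⟨0, fun _ => 0⟩
  time := 0
  peak := space (costInput n m C) (fun _ => ⟨0, fun _ => 0⟩) (fun _ => ⟨0, fun _ => 0⟩)

/-- The initial arrays of natural numbers when `(ρ, ϱ)` is given. -/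
def loadN (n m : ℕ) (ρ ϱ : ℕ → ℕ) : NArr → Arr ℕ
  | .ρ => ⟨n, ρ⟩
  | .ϱ => ⟨m, ϱ⟩
  | _ => ⟨0, fun _ => 0⟩

/-- The initial arrays of reals when `(u, v)` is given. -/
noncomputable def loadR (n m : ℕ) (u v : ℕ → ℝ) : RArr → Arr EReal
  | .u => ⟨n + 1, fun i => ((u i : ℝ) : EReal)⟩
  | .v => ⟨m + 1, fun j => ((v j : ℝ) : EReal)⟩
  | .π => ⟨0, fun _ => 0⟩

/-- The initial state when the matrix `C`, vectors `(ρ, ϱ)` and dual variables `(u, v)` are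
given. -/
noncomputable def loadState (n m : ℕ) (C : ℕ → ℕ → ℝ) (ρ ϱ : ℕ → ℕ) (u v : ℕ → ℝ) : State where
  nv := initVars n m
  rv := fun _ => 0
  na := loadN n m ρ ϱ
  ra := loadR n m u v
  time := 0
  peak := space (costInput n m C) (loadN n m ρ ϱ) (loadR n m u v)

/-- The arrays `ρ` and `ϱ` of the state encode a solution of the LSAPE. -/
def ReturnsAssignment (n m : ℕ) (C : ℕ → ℕ → ℝ) (s : State) : Prop :=
  (s.na .ρ).len = n ∧ (s.na .ϱ).len = m ∧
    ∃ φ : ℕ → Finset ℕ, Encodes n m (s.na .ρ).val (s.na .ϱ).val φ ∧ IsOptimalAssignment n m C φ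

/-- The arrays `u` and `v` of the state hold a solution of the dual problem. -/
def ReturnsDual (n m : ℕ) (C : ℕ → ℕ → ℝ) (s : State) : Prop :=
  (s.ra .u).len = n + 1 ∧ (s.ra .v).len = m + 1 ∧
    ∃ u v : ℕ → ℝ, IsOptimalDual n m C u v ∧
      (∀ i ∈ Finset.Icc 1 (n + 1), (s.ra .u).val i = ((u i : ℝ) : EReal)) ∧
      (∀ j ∈ Finset.Icc 1 (m + 1), (s.ra .v).val j = ((v j : ℝ) : EReal))

end LSAPE

/-!
The correctness of the algorithm is that of the Hungarian method.  An `ε`-assignment and feasible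
dual variables that satisfy complementary slackness are both optimal by weak duality
(`CompSlack.optimal`), and complementary slackness is maintained throughout.  The invariant
`Slack` expresses it through the two vectors `ρ` and `ϱ`, symmetrically in both sides.

A search grows a tree (`Tree`) of tight alternating paths from an unassigned column `k`.  When all
its rows are expanded, the dual variables move by the least reduced cost `δ` of an edge that leaves
the tree, the edges to the null row included.  This keeps them feasible and the tree tight
(`Slack.dual_update`), and makes a new edge tight.  Each round of the search therefore ends with a
sink or with a row that can be expanded; as the expanded rows and the columns of the tree are in
bijection up to the root, there are at most `min (n + 1) m` rounds.  A round takes time `O(n)`,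
because the least reduced costs of the rows outside of the tree are kept in `π` and only compared
with the newest column (`vc_round`).  From the sink, the exchange along the path (`vc_flipPath`)
visits older and older columns of the tree, so it terminates, assigns `k`, and leaves no element
unassigned that was assigned before.  All columns thus take time
`O(n * min (n + 1) m * m)`, and the rows the same with `n` and `m` exchanged; for `n, m ≥ 1` both
are `O((min n m) ^ 2 * max n m)`.

The programs are verified by weakest preconditions: `vc` turns loop-free code into a proposition
by simplification, `vc_loop` and `vc_loop_up` deal with loops from an invariant, and `vc_sound`
yields an execution.  Time is a component of the store, so invariants bound it like any other
quantity; the peak of the space changes only when an array is allocated.  The phase that assigns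
the rows needs no second proof: the exchange of the two sides maps executions to executions
(`Exec.swap`) and maps the first phase to the second one (`swap_assignCols`).
-/

namespace LSAPE

/-! ### Weakest preconditions -/

/-- The part of a machine state that stays fixed between two allocations: the dimensions, the
input matrix, the lengths of the arrays, and the space record. -/
structure Ctx where
  n : ℕ
  m : ℕ
  inp : Input
  lenN : NArr → ℕ
  lenR : RArr → ℕ
  peak : ℕ

/-- The part of a machine state that changes between two allocations, as a record with one field
for each variable and each array. -/
structure Store where
  i : ℕ
  j : ℕ
  k : ℕ
  l : ℕ
  p : ℕ
  q : ℕ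
  r : ℕ
  si : ℕ
  sj : ℕ
  nSU : ℕ
  nLU : ℕ
  nSV : ℕ
  found : ℕ
  w : EReal
  δs : EReal
  δε : EReal
  δ : EReal
  ρ : ℕ → ℕ
  ϱ : ℕ → ℕ
  pred : ℕ → ℕ
  P : ℕ → ℕ
  SV : ℕ → ℕ
  u : ℕ → EReal
  v : ℕ → EReal
  π : ℕ → EReal
  time : ℕ

namespace Store

/-- Read a natural-number variable. -/
def nvar (Γ : Ctx) (x : Store) : NVar → ℕ
  | .n => Γ.n
  | .m => Γ.m
  | .i => x.i
  | .j => x.j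
  | .k => x.k
  | .l => x.l
  | .p => x.p
  | .q => x.q
  | .r => x.r
  | .si => x.si
  | .sj => x.sj
  | .nSU => x.nSU
  | .nLU => x.nLU
  | .nSV => x.nSV
  | .found => x.found

/-- Read a real variable. -/
def rvar (x : Store) : RVar → EReal
  | .w => x.w
  | .δs => x.δs
  | .δε => x.δε
  | .δ => x.δ

/-- The contents of an array of natural numbers. -/
def narr (x : Store) : NArr → ℕ → ℕ
  | .ρ => x.ρ
  | .ϱ => x.ϱ
  | .pred => x.pred
  | .P => x.P
  | .SV => x.SV

/-- The contents of an array of reals. -/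
def rarr (x : Store) : RArr → ℕ → EReal
  | .u => x.u
  | .v => x.v
  | .π => x.π

/-- Assign a natural-number variable; the dimensions `n` and `m` are never assigned. -/
def setN (x : Store) : NVar → ℕ → Store
  | .n, _ => x
  | .m, _ => x
  | .i, a => { x with i := a }
  | .j, a => { x with j := a }
  | .k, a => { x with k := a }
  | .l, a => { x with l := a }
  | .p, a => { x with p := a }
  | .q, a => { x with q := a }
  | .r, a => { x with r := a }
  | .si, a => { x with si := a }
  | .sj, a => { x with sj := a }
  | .nSU, a => { x with nSU := a }
  | .nLU, a => { x with nLU := a }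
  | .nSV, a => { x with nSV := a }
  | .found, a => { x with found := a }

/-- Assign a real variable. -/
def setR (x : Store) : RVar → EReal → Store
  | .w, a => { x with w := a }
  | .δs, a => { x with δs := a }
  | .δε, a => { x with δε := a }
  | .δ, a => { x with δ := a }

/-- Replace the contents of an array of natural numbers. -/
def putN (x : Store) : NArr → (ℕ → ℕ) → Store
  | .ρ, a => { x with ρ := a }
  | .ϱ, a => { x with ϱ := a }
  | .pred, a => { x with pred := a }
  | .P, a => { x with P := a }
  | .SV, a => { x with SV := a }

/-- Replace the contents of an array of reals. -/
def putR (x : Store) : RArr → (ℕ → EReal) → Store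
  | .u, a => { x with u := a }
  | .v, a => { x with v := a }
  | .π, a => { x with π := a }

/-- Let `t` units of time pass. -/
def tick (x : Store) (t : ℕ) : Store := { x with time := x.time + t }

end Store

/-- The machine state made of a fixed and a changing part. -/
def toState (Γ : Ctx) (x : Store) : State where
  nv := x.nvar Γ
  rv := x.rvar
  na := fun a => ⟨Γ.lenN a, x.narr a⟩
  ra := fun a => ⟨Γ.lenR a, x.rarr a⟩
  time := x.time
  peak := Γ.peak

/-- The changing part of a machine state. -/
def State.store (s : State) : Store where
  i := s.nv .i
  j := s.nv .j
  k := s.nv .k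
  l := s.nv .l
  p := s.nv .p
  q := s.nv .q
  r := s.nv .r
  si := s.nv .si
  sj := s.nv .sj
  nSU := s.nv .nSU
  nLU := s.nv .nLU
  nSV := s.nv .nSV
  found := s.nv .found
  w := s.rv .w
  δs := s.rv .δs
  δε := s.rv .δε
  δ := s.rv .δ
  ρ := (s.na .ρ).val
  ϱ := (s.na .ϱ).val
  pred := (s.na .pred).val
  P := (s.na .P).val
  SV := (s.na .SV).val
  u := (s.ra .u).val
  v := (s.ra .v).val
  π := (s.ra .π).val
  time := s.time

theorem toState_store {Γ : Ctx} {s : State} (hn : s.nv .n = Γ.n) (hm : s.nv .m = Γ.m)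
    (hN : ∀ a, (s.na a).len = Γ.lenN a) (hR : ∀ a, (s.ra a).len = Γ.lenR a)
    (hp : s.peak = Γ.peak) : toState Γ s.store = s := by
  obtain ⟨nv, rv, na, ra, t, p⟩ := s
  simp only [toState, State.store, State.mk.injEq]
  refine ⟨?_, ?_, ?_, ?_, trivial, hp.symm⟩
  · funext a; cases a <;> first | rfl | exact hn.symm | exact hm.symm
  · funext a; cases a <;> rfl
  · funext a; rw [← hN a]; cases a <;> rfl
  · funext a; rw [← hR a]; cases a <;> rfl

/-- The cells in use in a given context. -/
def Ctx.space (Γ : Ctx) : ℕ :=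
  Γ.inp.rows * Γ.inp.cols + Fintype.card NVar + Fintype.card RVar
    + ∑ a, Γ.lenN a + ∑ a, Γ.lenR a

/-- Value of an expression, with unchecked array accesses. -/
def NExp.den (Γ : Ctx) (x : Store) : NExp → ℕ
  | .lit k => k
  | .var a => x.nvar Γ a
  | .get a e => x.narr a (e.den Γ x)
  | .add e f => e.den Γ x + f.den Γ x

/-- All array accesses of an expression are within bounds. -/
def NExp.ok (Γ : Ctx) (x : Store) : NExp → Prop
  | .lit _ => True
  | .var _ => True
  | .get a e => e.ok Γ x ∧ 1 ≤ e.den Γ x ∧ e.den Γ x ≤ Γ.lenN a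
  | .add e f => e.ok Γ x ∧ f.ok Γ x

/-- Value of an expression, with unchecked array and matrix accesses. -/
noncomputable def RExp.den (Γ : Ctx) (x : Store) : RExp → EReal
  | .zero => 0
  | .infty => ⊤
  | .var a => x.rvar a
  | .get a e => x.rarr a (e.den Γ x)
  | .mat e f => (Γ.inp.entry (e.den Γ x) (f.den Γ x) : ℝ)
  | .add e f => e.den Γ x + f.den Γ x
  | .sub e f => e.den Γ x - f.den Γ x

/-- All array and matrix accesses of an expression are within bounds. -/
def RExp.ok (Γ : Ctx) (x : Store) : RExp → Prop
  | .zero => True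
  | .infty => True
  | .var _ => True
  | .get a e => e.ok Γ x ∧ 1 ≤ e.den Γ x ∧ e.den Γ x ≤ Γ.lenR a
  | .mat e f => e.ok Γ x ∧ f.ok Γ x ∧ 1 ≤ e.den Γ x ∧ e.den Γ x ≤ Γ.inp.rows ∧
      1 ≤ f.den Γ x ∧ f.den Γ x ≤ Γ.inp.cols
  | .add e f => e.ok Γ x ∧ f.ok Γ x
  | .sub e f => e.ok Γ x ∧ f.ok Γ x

/-- The proposition decided by a test. -/
def BExp.den (Γ : Ctx) (x : Store) : BExp → Prop
  | .eqN e f => e.den Γ x = f.den Γ x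
  | .leN e f => e.den Γ x ≤ f.den Γ x
  | .eqR e f => e.den Γ x = f.den Γ x
  | .ltR e f => e.den Γ x < f.den Γ x
  | .leR e f => e.den Γ x ≤ f.den Γ x
  | .not b => ¬ b.den Γ x
  | .and b c => b.den Γ x ∧ c.den Γ x
  | .or b c => b.den Γ x ∨ c.den Γ x

/-- All array and matrix accesses of a test are within bounds. -/
def BExp.ok (Γ : Ctx) (x : Store) : BExp → Prop
  | .eqN e f => e.ok Γ x ∧ f.ok Γ x
  | .leN e f => e.ok Γ x ∧ f.ok Γ x
  | .eqR e f => e.ok Γ x ∧ f.ok Γ x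
  | .ltR e f => e.ok Γ x ∧ f.ok Γ x
  | .leR e f => e.ok Γ x ∧ f.ok Γ x
  | .not b => b.ok Γ x
  | .and b c => b.ok Γ x ∧ c.ok Γ x
  | .or b c => b.ok Γ x ∧ c.ok Γ x

theorem NExp.eval_eq {Γ : Ctx} {x : Store} (e : NExp) (h : e.ok Γ x) :
    e.eval (toState Γ x) = some (e.den Γ x) := by
  induction e with
  | lit k => rfl
  | var a => rfl
  | get a e ih =>
    obtain ⟨h1, h2, h3⟩ := h
    simp only [NExp.eval, ih h1]
    simp [toState, Arr.read, h2, h3]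
    rfl
  | add e f ihe ihf => simp [NExp.eval, ihe h.1, ihf h.2]; rfl

theorem RExp.eval_eq {Γ : Ctx} {x : Store} (e : RExp) (h : e.ok Γ x) :
    e.eval Γ.inp (toState Γ x) = some (e.den Γ x) := by
  induction e with
  | zero => rfl
  | infty => rfl
  | var a => rfl
  | get a e =>
    obtain ⟨h1, h2, h3⟩ := h
    simp only [RExp.eval, NExp.eval_eq e h1]
    simp [toState, Arr.read, h2, h3]
    rfl
  | mat e f =>
    obtain ⟨h1, h2, h3, h4, h5, h6⟩ := h
    simp [RExp.eval, NExp.eval_eq e h1, NExp.eval_eq f h2, h3, h4, h5, h6]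
    rfl
  | add e f ihe ihf => simp [RExp.eval, ihe h.1, ihf h.2]; rfl
  | sub e f ihe ihf => simp [RExp.eval, ihe h.1, ihf h.2]; rfl

open Classical in
theorem BExp.eval_eq {Γ : Ctx} {x : Store} (b : BExp) (h : b.ok Γ x) :
    b.eval Γ.inp (toState Γ x) = some (decide (b.den Γ x)) := by
  induction b with
  | eqN e f =>
    simp only [BExp.eval, NExp.eval_eq e h.1, NExp.eval_eq f h.2]
    exact congrArg some (decide_eq_decide.2 Iff.rfl)
  | leN e f =>
    simp only [BExp.eval, NExp.eval_eq e h.1, NExp.eval_eq f h.2]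
    exact congrArg some (decide_eq_decide.2 Iff.rfl)
  | eqR e f =>
    simp only [BExp.eval, RExp.eval_eq e h.1, RExp.eval_eq f h.2]
    exact congrArg some (decide_eq_decide.2 Iff.rfl)
  | ltR e f =>
    simp only [BExp.eval, RExp.eval_eq e h.1, RExp.eval_eq f h.2]
    exact congrArg some (decide_eq_decide.2 Iff.rfl)
  | leR e f =>
    simp only [BExp.eval, RExp.eval_eq e h.1, RExp.eval_eq f h.2]
    exact congrArg some (decide_eq_decide.2 Iff.rfl)
  | not b ih => by_cases hb : b.den Γ x <;> simp [BExp.eval, ih h, BExp.den, hb]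
  | and b c ihb ihc =>
    by_cases hb : b.den Γ x <;> by_cases hc : c.den Γ x <;>
      simp [BExp.eval, ihb h.1, ihc h.2, BExp.den, hb, hc]
  | or b c ihb ihc =>
    by_cases hb : b.den Γ x <;> by_cases hc : c.den Γ x <;>
      simp [BExp.eval, ihb h.1, ihc h.2, BExp.den, hb, hc]

theorem toState_tick (Γ : Ctx) (x : Store) (t : ℕ) :
    (toState Γ x).tick t = toState Γ (x.tick t) := rfl

theorem toState_setN (Γ : Ctx) (x : Store) {a : NVar} (hn : a ≠ .n) (hm : a ≠ .m) (k : ℕ) :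
    (toState Γ x).setN a k = toState Γ (x.setN a k) := by
  simp only [toState, State.setN, State.mk.injEq]
  refine ⟨?_, ?_, ?_, ?_, ?_, trivial⟩
  · funext b; cases a <;> cases b <;> first | exact absurd rfl hn | exact absurd rfl hm | rfl
  all_goals cases a <;> rfl

theorem toState_setR (Γ : Ctx) (x : Store) (a : RVar) (y : EReal) :
    (toState Γ x).setR a y = toState Γ (x.setR a y) := by
  simp only [toState, State.setR, State.mk.injEq]
  refine ⟨?_, ?_, ?_, ?_, ?_, trivial⟩
  · funext b; cases a <;> cases b <;> rfl
  · funext b; cases a <;> cases b <;> rfl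
  all_goals cases a <;> rfl

theorem toState_storeN {Γ : Ctx} (hΓ : Γ.space ≤ Γ.peak) (x : Store) (a : NArr) (f : ℕ → ℕ) :
    (toState Γ x).storeN Γ.inp a ⟨Γ.lenN a, f⟩ = toState Γ (x.putN a f) := by
  have hs : space Γ.inp (Function.update (toState Γ x).na a ⟨Γ.lenN a, f⟩) (toState Γ x).ra
      = Γ.space := by
    have : ∀ b, (Function.update (toState Γ x).na a ⟨Γ.lenN a, f⟩ b).len = Γ.lenN b := by
      intro b; by_cases h : b = a
      · subst h; simp
      · simp [h, toState]
    simp only [space, Ctx.space, this]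
    rfl
  simp only [State.storeN, hs]
  simp only [toState, State.mk.injEq]
  refine ⟨?_, ?_, ?_, ?_, ?_, max_eq_left hΓ⟩
  · funext b; cases a <;> cases b <;> rfl
  · cases a <;> rfl
  · funext b; cases a <;> cases b <;> rfl
  all_goals cases a <;> rfl

theorem toState_storeR {Γ : Ctx} (hΓ : Γ.space ≤ Γ.peak) (x : Store) (a : RArr)
    (f : ℕ → EReal) :
    (toState Γ x).storeR Γ.inp a ⟨Γ.lenR a, f⟩ = toState Γ (x.putR a f) := by
  have hs : space Γ.inp (toState Γ x).na (Function.update (toState Γ x).ra a ⟨Γ.lenR a, f⟩)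
      = Γ.space := by
    have : ∀ b, (Function.update (toState Γ x).ra a ⟨Γ.lenR a, f⟩ b).len = Γ.lenR b := by
      intro b; by_cases h : b = a
      · subst h; simp
      · simp [h, toState]
    simp only [space, Ctx.space, this]
    rfl
  simp only [State.storeR, hs]
  simp only [toState, State.mk.injEq]
  refine ⟨?_, ?_, ?_, ?_, ?_, max_eq_left hΓ⟩
  · funext b; cases a <;> cases b <;> rfl
  · cases a <;> rfl
  · cases a <;> rfl
  · funext b; cases a <;> cases b <;> rfl
  · cases a <;> rfl

/-- A precondition under which an allocation-free statement terminates in a store that satisfies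
`Q`.  It is computed from the text of the statement, except for loops, where it merely says that
an execution with this outcome exists. -/
def vc (Γ : Ctx) (ω : ℕ → ℕ) : Stmt → (Store → Prop) → Store → Prop
  | .skip, Q, x => Q x
  | .setN a e, Q, x =>
      (a ≠ .n ∧ a ≠ .m) ∧ e.ok Γ x ∧ Q ((x.setN a (e.den Γ x)).tick (e.cost + 1))
  | .setR a e, Q, x => e.ok Γ x ∧ Q ((x.setR a (e.den Γ x)).tick (e.cost + 1))
  | .putN a e f, Q, x =>
      (e.ok Γ x ∧ f.ok Γ x ∧ 1 ≤ e.den Γ x ∧ e.den Γ x ≤ Γ.lenN a) ∧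
      Q ((x.putN a (Function.update (x.narr a) (e.den Γ x) (f.den Γ x))).tick
        (e.cost + f.cost + 1))
  | .putR a e f, Q, x =>
      (e.ok Γ x ∧ f.ok Γ x ∧ 1 ≤ e.den Γ x ∧ e.den Γ x ≤ Γ.lenR a) ∧
      Q ((x.putR a (Function.update (x.rarr a) (e.den Γ x) (f.den Γ x))).tick
        (e.cost + f.cost + 1))
  | .allocN _ _ _, _, _ => False
  | .allocR _ _ _, _, _ => False
  | .seq c d, Q, x => vc Γ ω c (vc Γ ω d Q) x
  | .cond b c d, Q, x =>
      b.ok Γ x ∧ (b.den Γ x → vc Γ ω c Q (x.tick (b.cost + 1))) ∧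
        (¬ b.den Γ x → vc Γ ω d Q (x.tick (b.cost + 1)))
  | .loop b c, Q, x =>
      ∃ y, Exec ω Γ.inp (.loop b c) (toState Γ x) (toState Γ y) ∧ Q y
  | .choose a e f, Q, x =>
      (a ≠ .n ∧ a ≠ .m) ∧ (e.ok Γ x ∧ f.ok Γ x) ∧ e.den Γ x ≤ f.den Γ x ∧
      ∀ t, e.den Γ x ≤ t → t ≤ f.den Γ x → Q ((x.setN a t).tick (e.cost + f.cost + 1))

section
variable {Γ : Ctx} {ω : ℕ → ℕ} {Q : Store → Prop} {x : Store}

@[simp] theorem vc_skip : vc Γ ω .skip Q x = Q x := rfl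
@[simp] theorem vc_setN {a : NVar} {e : NExp} : vc Γ ω (.setN a e) Q x =
    ((a ≠ .n ∧ a ≠ .m) ∧ e.ok Γ x ∧ Q ((x.setN a (e.den Γ x)).tick (e.cost + 1))) := rfl
@[simp] theorem vc_setR {a : RVar} {e : RExp} : vc Γ ω (.setR a e) Q x =
    (e.ok Γ x ∧ Q ((x.setR a (e.den Γ x)).tick (e.cost + 1))) := rfl
@[simp] theorem vc_putN {a : NArr} {e f : NExp} : vc Γ ω (.putN a e f) Q x =
    ((e.ok Γ x ∧ f.ok Γ x ∧ 1 ≤ e.den Γ x ∧ e.den Γ x ≤ Γ.lenN a) ∧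
      Q ((x.putN a (Function.update (x.narr a) (e.den Γ x) (f.den Γ x))).tick
        (e.cost + f.cost + 1))) := rfl
@[simp] theorem vc_putR {a : RArr} {e : NExp} {f : RExp} : vc Γ ω (.putR a e f) Q x =
    ((e.ok Γ x ∧ f.ok Γ x ∧ 1 ≤ e.den Γ x ∧ e.den Γ x ≤ Γ.lenR a) ∧
      Q ((x.putR a (Function.update (x.rarr a) (e.den Γ x) (f.den Γ x))).tick
        (e.cost + f.cost + 1))) := rfl
@[simp] theorem vc_seq {c d : Stmt} :
    vc Γ ω (.seq c d) Q x = vc Γ ω c (vc Γ ω d Q) x := rfl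
@[simp] theorem vc_cond {b : BExp} {c d : Stmt} : vc Γ ω (.cond b c d) Q x =
    (b.ok Γ x ∧ (b.den Γ x → vc Γ ω c Q (x.tick (b.cost + 1))) ∧
        (¬ b.den Γ x → vc Γ ω d Q (x.tick (b.cost + 1)))) := rfl
@[simp] theorem vc_ifThen {b : BExp} {c : Stmt} : vc Γ ω (ifThen b c) Q x =
    (b.ok Γ x ∧ (b.den Γ x → vc Γ ω c Q (x.tick (b.cost + 1))) ∧
        (¬ b.den Γ x → Q (x.tick (b.cost + 1)))) := rfl
@[simp] theorem vc_choose {a : NVar} {e f : NExp} : vc Γ ω (.choose a e f) Q x =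
    ((a ≠ .n ∧ a ≠ .m) ∧ (e.ok Γ x ∧ f.ok Γ x) ∧ e.den Γ x ≤ f.den Γ x ∧
      ∀ t, e.den Γ x ≤ t → t ≤ f.den Γ x →
        Q ((x.setN a t).tick (e.cost + f.cost + 1))) := rfl

@[simp] theorem NExp.ofNat_eq (k : ℕ) : (OfNat.ofNat k : NExp) = .lit k := rfl
@[simp] theorem NExp.add_eq (e f : NExp) : e + f = .add e f := rfl
@[simp] theorem RExp.add_eq (e f : RExp) : e + f = .add e f := rfl
@[simp] theorem RExp.sub_eq (e f : RExp) : e - f = .sub e f := rfl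
attribute [simp] NExp.cost RExp.cost BExp.cost Store.nvar Store.rvar Store.narr Store.rarr
  NExp.den NExp.ok RExp.den RExp.ok BExp.den BExp.ok Store.setN Store.setR Store.putN Store.putR Store.tick

/-- Soundness: the space record is already large enough for the arrays of the context, so writing
to them does not change it. -/
theorem vc_sound (hΓ : Γ.space ≤ Γ.peak) (c : Stmt) (h : vc Γ ω c Q x) :
    ∃ y, Exec ω Γ.inp c (toState Γ x) (toState Γ y) ∧ Q y := by
  induction c generalizing Q x with
  | skip => exact ⟨x, .skip _, h⟩
  | setN a e =>
    obtain ⟨⟨hn, hm⟩, h1, h2⟩ := h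
    refine ⟨_, ?_, h2⟩
    rw [← toState_tick, ← toState_setN Γ x hn hm]
    exact .setN (NExp.eval_eq e h1)
  | setR a e =>
    obtain ⟨h1, h2⟩ := h
    refine ⟨_, ?_, h2⟩
    rw [← toState_tick, ← toState_setR Γ x]
    exact .setR (RExp.eval_eq e h1)
  | putN a e f =>
    obtain ⟨⟨h1, h2, h3, h4⟩, h5⟩ := h
    refine ⟨_, ?_, h5⟩
    rw [← toState_tick, ← toState_storeN hΓ x]
    exact .putN (NExp.eval_eq e h1) (NExp.eval_eq f h2) (by simp [toState, Arr.write, h3, h4])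
  | putR a e f =>
    obtain ⟨⟨h1, h2, h3, h4⟩, h5⟩ := h
    refine ⟨_, ?_, h5⟩
    rw [← toState_tick, ← toState_storeR hΓ x]
    exact .putR (NExp.eval_eq e h1) (RExp.eval_eq f h2) (by simp [toState, Arr.write, h3, h4])
  | allocN => exact h.elim
  | allocR => exact h.elim
  | seq c d ihc ihd =>
    obtain ⟨y, hy, h'⟩ := ihc h
    obtain ⟨z, hz, hQ⟩ := ihd h'
    exact ⟨z, .seq hy hz, hQ⟩
  | cond b c d ihc ihd =>
    obtain ⟨h1, h2, h3⟩ := h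
    by_cases hb : b.den Γ x
    · obtain ⟨y, hy, hQ⟩ := ihc (h2 hb)
      exact ⟨y, .condTrue (by rw [BExp.eval_eq b h1]; simp [hb]) hy, hQ⟩
    · obtain ⟨y, hy, hQ⟩ := ihd (h3 hb)
      exact ⟨y, .condFalse (by rw [BExp.eval_eq b h1]; simp [hb]) hy, hQ⟩
  | loop b c => exact h
  | choose a e f =>
    obtain ⟨⟨hn, hm⟩, ⟨h1, h2⟩, h3, h4⟩ := h
    refine ⟨_, ?_, h4 (e.den Γ x + ω (toState Γ x).time % (f.den Γ x + 1 - e.den Γ x))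
      (Nat.le_add_right _ _) ?_⟩
    · rw [← toState_tick, ← toState_setN Γ x hn hm]
      exact .choose (NExp.eval_eq e h1) (NExp.eval_eq f h2) h3
    · have := Nat.mod_lt (ω (toState Γ x).time)
        (show 0 < f.den Γ x + 1 - e.den Γ x by omega)
      omega

theorem vc_mono {c : Stmt} {Q' : Store → Prop} (h : vc Γ ω c Q x) (hQ : ∀ y, Q y → Q' y) :
    vc Γ ω c Q' x := by
  induction c generalizing Q Q' x with
  | skip => exact hQ _ h
  | setN a e => exact ⟨h.1, h.2.1, hQ _ h.2.2⟩
  | setR a e => exact ⟨h.1, hQ _ h.2⟩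
  | putN a e f => exact ⟨h.1, hQ _ h.2⟩
  | putR a e f => exact ⟨h.1, hQ _ h.2⟩
  | allocN => exact h
  | allocR => exact h
  | seq c d ihc ihd => exact ihc h fun y hy => ihd hy hQ
  | cond b c d ihc ihd =>
    exact ⟨h.1, fun hb => ihc (h.2.1 hb) hQ, fun hb => ihd (h.2.2 hb) hQ⟩
  | loop b c => obtain ⟨y, h1, h2⟩ := h; exact ⟨y, h1, hQ _ h2⟩
  | choose a e f => exact ⟨h.1, h.2.1, h.2.2.1, fun t h1 h2 => hQ _ (h.2.2.2 t h1 h2)⟩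

/-- Total correctness of a loop, from an invariant indexed by a variant that decreases. -/
theorem vc_loop (hΓ : Γ.space ≤ Γ.peak) {b : BExp} {c : Stmt} (I : ℕ → Store → Prop)
    (h : ∀ t x, I t x → b.ok Γ x ∧
      (b.den Γ x → vc Γ ω c (fun y => ∃ t' < t, I t' y) (x.tick (b.cost + 1))) ∧
      (¬ b.den Γ x → Q (x.tick (b.cost + 1))))
    (t : ℕ) (hx : I t x) : vc Γ ω (.loop b c) Q x := by
  induction t using Nat.strong_induction_on generalizing x with
  | _ t ih =>
    obtain ⟨h1, h2, h3⟩ := h t x hx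
    by_cases hb : b.den Γ x
    · obtain ⟨y, hy, t', ht, hI⟩ := vc_sound hΓ c (h2 hb)
      obtain ⟨z, hz, hQ⟩ := ih t' ht hI
      exact ⟨z, .loopTrue (by rw [BExp.eval_eq b h1]; simp [hb]) hy hz, hQ⟩
    · exact ⟨_, .loopFalse (by rw [BExp.eval_eq b h1]; simp [hb]), h3 hb⟩

/-- Total correctness of a loop, from an invariant indexed by a counter that increases by one in
every round and is bounded by `H` while the loop runs. -/
theorem vc_loop_up (hΓ : Γ.space ≤ Γ.peak) {b : BExp} {c : Stmt} (H : ℕ)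
    (I : ℕ → Store → Prop)
    (h : ∀ t x, I t x → b.ok Γ x ∧
      (b.den Γ x → t ≤ H ∧ vc Γ ω c (I (t + 1)) (x.tick (b.cost + 1))) ∧
      (¬ b.den Γ x → Q (x.tick (b.cost + 1))))
    (t : ℕ) (hx : I t x) : vc Γ ω (.loop b c) Q x := by
  refine vc_loop hΓ (fun s y => ∃ t, I t y ∧ s = H + 1 - t) ?_ (H + 1 - t) ⟨t, hx, rfl⟩
  rintro s y ⟨t, hI, rfl⟩
  obtain ⟨h1, h2, h3⟩ := h t y hI
  refine ⟨h1, fun hb => vc_mono (h2 hb).2 fun z hz => ⟨_, ?_, t + 1, hz, rfl⟩, h3⟩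
  have := (h2 hb).1
  omega

end

end LSAPE

namespace LSAPE

/-! ### Duality -/

/-- Every index of `U` and `V` is selected exactly once, and the dual variables vanish at `ε`. -/
theorem sum_dual_eq_dualValue {n m : ℕ} {C : ℕ → ℕ → ℝ} {ψ : ℕ → Finset ℕ} {u v : ℕ → ℝ}
    (hψ : IsEpsAssignment n m ψ) (h : IsDualFeasible n m C u v) :
    ∑ i ∈ Finset.Icc 1 (n + 1), ∑ j ∈ ψ i, (u i + v j) = dualValue n m u v := by
  obtain ⟨hsub, hrow, hcol, -⟩ := hψ
  simp only [Finset.sum_add_distrib, dualValue]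
  congr 1
  · refine Finset.sum_congr rfl fun i hi => ?_
    rw [Finset.sum_const]
    by_cases hin : i = n + 1
    · subst hin; simp [h.1]
    · rw [hrow i (by simp only [Finset.mem_Icc] at hi ⊢; omega), one_smul]
  · have h1 : ∀ i ∈ Finset.Icc 1 (n + 1), ∑ j ∈ ψ i, v j
        = ∑ j ∈ Finset.Icc 1 (m + 1), if j ∈ ψ i then v j else 0 := by
      intro i hi
      rw [← Finset.sum_filter, Finset.filter_mem_eq_inter,
        Finset.inter_eq_right.2 (hsub i hi)]
    rw [Finset.sum_congr rfl h1, Finset.sum_comm]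
    refine Finset.sum_congr rfl fun j hj => ?_
    rw [← Finset.sum_filter, Finset.sum_const]
    by_cases hjm : j = m + 1
    · subst hjm; simp [h.2.1]
    · rw [hcol j (by simp only [Finset.mem_Icc] at hj ⊢; omega), one_smul]

/-- Weak duality. -/
theorem dualValue_le_totalCost {n m : ℕ} {C : ℕ → ℕ → ℝ} {ψ : ℕ → Finset ℕ} {u v : ℕ → ℝ}
    (hψ : IsEpsAssignment n m ψ) (h : IsDualFeasible n m C u v) :
    dualValue n m u v ≤ totalCost n C ψ := by
  rw [← sum_dual_eq_dualValue hψ h]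
  exact Finset.sum_le_sum fun i hi => Finset.sum_le_sum fun j hj =>
    h.2.2 i hi j (hψ.1 i hi hj)

/-- An `ε`-assignment and feasible dual variables that satisfy complementary slackness are both
optimal. -/
theorem CompSlack.optimal {n m : ℕ} {C : ℕ → ℕ → ℝ} {φ : ℕ → Finset ℕ} {u v : ℕ → ℝ}
    (h : CompSlack n m C φ u v) (hφ : IsEpsAssignment n m φ) :
    IsOptimalAssignment n m C φ ∧ IsOptimalDual n m C u v := by
  have e : totalCost n C φ = dualValue n m u v := by
    rw [← sum_dual_eq_dualValue hφ h.1]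
    exact Finset.sum_congr rfl fun i hi => Finset.sum_congr rfl fun j hj => h.2 i hi j hj
  exact ⟨⟨hφ, fun ψ hψ => e ▸ dualValue_le_totalCost hψ h.1⟩,
    ⟨h.1, fun u' v' h' => e ▸ dualValue_le_totalCost hφ h'⟩⟩

/-! ### Partial assignments given by a pair of vectors -/

/-- The vectors `ρ` and `ϱ` encode a partial `ε`-assignment that satisfies complementary slackness
with the feasible dual variables `u` and `v`.  In this form the condition is symmetric in the two
sides of the assignment. -/
structure Slack (n m : ℕ) (C : ℕ → ℕ → ℝ) (ρ ϱ : ℕ → ℕ) (u v : ℕ → ℝ) : Prop where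
  feas : IsDualFeasible n m C u v
  ρ_le : ∀ i, 1 ≤ i → i ≤ n → ρ i ≤ m + 1
  ϱ_le : ∀ j, 1 ≤ j → j ≤ m → ϱ j ≤ n + 1
  inv : ∀ i j, 1 ≤ i → i ≤ n → 1 ≤ j → j ≤ m → (ρ i = j ↔ ϱ j = i)
  tightρ : ∀ i, 1 ≤ i → i ≤ n → ρ i ≠ 0 → C i (ρ i) = u i + v (ρ i)
  tightϱ : ∀ j, 1 ≤ j → j ≤ m → ϱ j ≠ 0 → C (ϱ j) j = u (ϱ j) + v j

namespace Slack
variable {n m : ℕ} {C : ℕ → ℕ → ℝ} {ρ ϱ : ℕ → ℕ} {u v : ℕ → ℝ}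

theorem le (h : Slack n m C ρ ϱ u v) {i j : ℕ} (hi : 1 ≤ i) (hi' : i ≤ n + 1) (hj : 1 ≤ j)
    (hj' : j ≤ m + 1) : u i + v j ≤ C i j :=
  h.feas.2.2 i (Finset.mem_Icc.2 ⟨hi, hi'⟩) j (Finset.mem_Icc.2 ⟨hj, hj'⟩)

theorem transpose (h : Slack n m C ρ ϱ u v) : Slack m n (fun i j => C j i) ϱ ρ v u where
  feas := ⟨h.feas.2.1, h.feas.1, fun i hi j hj => by
    have := h.feas.2.2 j hj i hi; linarith⟩
  ρ_le := h.ϱ_le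
  ϱ_le := h.ρ_le
  inv i j hi hi' hj hj' := (h.inv j i hj hj' hi hi').symm
  tightρ j hj hj' h0 := by rw [h.tightϱ j hj hj' h0, add_comm]
  tightϱ i hi hi' h0 := by rw [h.tightρ i hi hi' h0, add_comm]

theorem of_encodes {φ : ℕ → Finset ℕ} (hφ : IsPartialEpsAssignment n m φ)
    (he : Encodes n m ρ ϱ φ) (hc : CompSlack n m C φ u v) : Slack n m C ρ ϱ u v := by
  obtain ⟨hsub, -⟩ := hφ
  obtain ⟨hr, hl⟩ := he
  have hr1 : ∀ i, 1 ≤ i → i ≤ n → ρ i ≠ 0 → ρ i ∈ φ i ∧ ρ i ≤ m + 1 := by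
    intro i hi hi' h0
    obtain ⟨h1, h2⟩ := hr i (Finset.mem_Icc.2 ⟨hi, hi'⟩)
    have := mt h2.2 h0
    push Not at this
    obtain ⟨j, hj, hj'⟩ := this
    rw [(h1 j hj).2 hj']
    exact ⟨hj', (Finset.mem_Icc.1 hj).2⟩
  have hl1 : ∀ j, 1 ≤ j → j ≤ m → ϱ j ≠ 0 →
      j ∈ φ (ϱ j) ∧ ϱ j ∈ Finset.Icc 1 (n + 1) := by
    intro j hj hj' h0
    obtain ⟨h1, h2⟩ := hl j (Finset.mem_Icc.2 ⟨hj, hj'⟩)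
    have := mt h2.2 h0
    push Not at this
    obtain ⟨i, hi, hi'⟩ := this
    rw [(h1 i hi).2 hi']
    exact ⟨hi', hi⟩
  refine ⟨hc.1, fun i hi hi' => ?_, fun j hj hj' => ?_, fun i j hi hi' hj hj' => ?_,
    fun i hi hi' h0 => ?_, fun j hj hj' h0 => ?_⟩
  · by_cases h0 : ρ i = 0
    · omega
    · exact (hr1 i hi hi' h0).2
  · by_cases h0 : ϱ j = 0
    · omega
    · exact (Finset.mem_Icc.1 (hl1 j hj hj' h0).2).2
  · rw [(hr i (Finset.mem_Icc.2 ⟨hi, hi'⟩)).1 j (Finset.mem_Icc.2 ⟨hj, by omega⟩),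
      (hl j (Finset.mem_Icc.2 ⟨hj, hj'⟩)).1 i (Finset.mem_Icc.2 ⟨hi, by omega⟩)]
  · exact hc.2 i (Finset.mem_Icc.2 ⟨hi, by omega⟩) _ (hr1 i hi hi' h0).1
  · exact hc.2 _ (hl1 j hj hj' h0).2 _ (hl1 j hj hj' h0).1

/-- When no element is left unassigned, the encoded partial assignment is an optimal
`ε`-assignment and the dual variables are optimal. -/
theorem optimal (h : Slack n m C ρ ϱ u v) (hC : C (n + 1) (m + 1) = 0)
    (hρ : ∀ i, 1 ≤ i → i ≤ n → ρ i ≠ 0) (hϱ : ∀ j, 1 ≤ j → j ≤ m → ϱ j ≠ 0) :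
    (∃ φ, Encodes n m ρ ϱ φ ∧ IsOptimalAssignment n m C φ) ∧ IsOptimalDual n m C u v := by
  classical
  set φ : ℕ → Finset ℕ := fun i =>
    if i = n + 1 then insert (m + 1) ((Finset.Icc 1 m).filter fun j => ϱ j = n + 1) else {ρ i}
    with hφ
  have hφe : ∀ j, j ∈ φ (n + 1) ↔ j = m + 1 ∨ ((1 ≤ j ∧ j ≤ m) ∧ ϱ j = n + 1) := by
    intro j; simp [hφ]
  have hφn : ∀ i, i ≤ n → φ i = {ρ i} := by
    intro i hi; simp only [hφ]; rw [if_neg (by omega)]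
  have hcol : ∀ i j, 1 ≤ i → i ≤ n + 1 → 1 ≤ j → j ≤ m → (j ∈ φ i ↔ ϱ j = i) := by
    intro i j hi hi' hj hj'
    by_cases hin : i = n + 1
    · subst hin
      rw [hφe]
      constructor
      · rintro (h1 | h1)
        · omega
        · exact h1.2
      · exact fun h1 => Or.inr ⟨⟨hj, hj'⟩, h1⟩
    · rw [hφn i (by omega), Finset.mem_singleton, ← h.inv i j hi (by omega) hj hj', eq_comm]
  have hass : IsEpsAssignment n m φ := by
    refine ⟨fun i hi j hj => ?_, fun i hi => ?_, fun j hj => ?_, (hφe _).2 (Or.inl rfl)⟩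
    · rw [Finset.mem_Icc] at hi ⊢
      by_cases hin : i = n + 1
      · subst hin
        rcases (hφe j).1 hj with h1 | h1 <;> omega
      · rw [hφn i (by omega), Finset.mem_singleton] at hj
        have := hρ i hi.1 (by omega)
        have := h.ρ_le i hi.1 (by omega)
        omega
    · rw [hφn i (Finset.mem_Icc.1 hi).2, Finset.card_singleton]
    · rw [Finset.mem_Icc] at hj
      rw [Finset.card_eq_one]
      refine ⟨ϱ j, ?_⟩
      ext i
      have := hϱ j hj.1 hj.2
      have := h.ϱ_le j hj.1 hj.2
      simp only [Finset.mem_filter, Finset.mem_Icc, Finset.mem_singleton]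
      constructor
      · rintro ⟨⟨h1, h2⟩, h3⟩
        exact ((hcol i j h1 h2 hj.1 hj.2).1 h3).symm
      · rintro rfl
        exact ⟨⟨by omega, this⟩, (hcol _ j (by omega) this hj.1 hj.2).2 rfl⟩
  have henc : Encodes n m ρ ϱ φ := by
    refine ⟨fun i hi => ?_, fun j hj => ?_⟩ <;> rw [Finset.mem_Icc] at *
    · have h1 := hρ i hi.1 hi.2
      have h2 := h.ρ_le i hi.1 hi.2
      rw [hφn i hi.2]
      refine ⟨fun j _ => by rw [Finset.mem_singleton, eq_comm], fun h0 => absurd h0 h1,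
        fun h0 => absurd (Finset.mem_singleton_self _)
          (h0 (ρ i) (Finset.mem_Icc.2 ⟨by omega, h2⟩))⟩
    · have h1 := hϱ j hj.1 hj.2
      have h2 := h.ϱ_le j hj.1 hj.2
      refine ⟨fun i hi => ?_, fun h0 => absurd h0 h1, fun h0 => ?_⟩
      · rw [Finset.mem_Icc] at hi
        exact (hcol i j hi.1 hi.2 hj.1 hj.2).symm
      · exact absurd ((hcol (ϱ j) j (by omega) h2 hj.1 hj.2).2 rfl)
          (h0 (ϱ j) (Finset.mem_Icc.2 ⟨by omega, h2⟩))
  have hcs : CompSlack n m C φ u v := by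
    refine ⟨h.feas, fun i hi j hj => ?_⟩
    rw [Finset.mem_Icc] at hi
    by_cases hin : i = n + 1
    · subst hin
      rcases (hφe j).1 hj with rfl | ⟨⟨h1, h2⟩, h3⟩
      · rw [hC, h.feas.1, h.feas.2.1, add_zero]
      · have := h.tightϱ j h1 h2 (hϱ j h1 h2)
        rwa [h3] at this
    · rw [hφn i (by omega), Finset.mem_singleton] at hj
      subst hj
      exact h.tightρ i hi.1 (by omega) (hρ i hi.1 (by omega))
  exact ⟨⟨φ, henc, (hcs.optimal hass).1⟩, (hcs.optimal hass).2⟩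

theorem congr_left {ρ' : ℕ → ℕ} (h : Slack n m C ρ ϱ u v)
    (hρ : ∀ i, 1 ≤ i → i ≤ n → ρ' i = ρ i) : Slack n m C ρ' ϱ u v where
  feas := h.feas
  ρ_le i hi hi' := by rw [hρ i hi hi']; exact h.ρ_le i hi hi'
  ϱ_le := h.ϱ_le
  inv i j hi hi' hj hj' := by rw [hρ i hi hi']; exact h.inv i j hi hi' hj hj'
  tightρ i hi hi' h0 := by rw [hρ i hi hi'] at h0 ⊢; exact h.tightρ i hi hi' h0
  tightϱ := h.tightϱ

/-- A row may be released unless it is assigned to a column of `V`, which would keep pointing to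
it. -/
theorem unassign_row (h : Slack n m C ρ ϱ u v) {i : ℕ} (hi : ρ i = 0 ∨ ρ i = m + 1) :
    Slack n m C (Function.update ρ i 0) ϱ u v := by
  refine ⟨h.feas, fun a ha ha' => ?_, h.ϱ_le, fun a b ha ha' hb hb' => ?_,
    fun a ha ha' h0 => ?_, h.tightϱ⟩ <;> by_cases hai : a = i
  · subst hai; simp
  · rw [Function.update_of_ne hai]; exact h.ρ_le a ha ha'
  · have := h.inv a b ha ha' hb hb'
    subst hai
    rw [Function.update_self, ← this]
    omega
  · rw [Function.update_of_ne hai]; exact h.inv a b ha ha' hb hb'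
  · subst hai; simp at h0
  · rw [Function.update_of_ne hai] at h0 ⊢; exact h.tightρ a ha ha' h0

/-- Reassigning a column `j` to the null row leaves its former row unassigned. -/
theorem assign_null (h : Slack n m C ρ ϱ u v) {j : ℕ} (hj : 1 ≤ j) (hj' : j ≤ m)
    (ht : C (n + 1) j = u (n + 1) + v j) :
    Slack n m C (Function.update ρ (ϱ j) 0) (Function.update ϱ j (n + 1)) u v := by
  refine ⟨h.feas, fun a ha ha' => ?_, fun b hb hb' => ?_, fun a b ha ha' hb hb' => ?_,
    fun a ha ha' h0 => ?_, fun b hb hb' h0 => ?_⟩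
  · rw [Function.update_apply]; split_ifs
    · omega
    · exact h.ρ_le a ha ha'
  · rw [Function.update_apply]; split_ifs
    · omega
    · exact h.ϱ_le b hb hb'
  · have h1 := h.inv a b ha ha' hb hb'
    have h2 := h.inv a j ha ha' hj hj'
    simp only [Function.update_apply]
    split_ifs with e1 e2 e2
    · omega
    · constructor
      · omega
      · intro e; have := h1.2 e; have := h2.2 e1.symm; omega
    · subst e2; constructor
      · intro e; exact absurd (h1.1 e).symm e1
      · omega
    · exact h1
  · rw [Function.update_apply] at h0 ⊢
    split_ifs at h0 ⊢
    · exact absurd rfl h0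
    · exact h.tightρ a ha ha' h0
  · by_cases e : b = j
    · subst e; simpa using ht
    · rw [Function.update_of_ne e] at h0 ⊢; exact h.tightϱ b hb hb' h0

/-- Assigning the free row `i` to the column `j` leaves the former row of `j` unassigned. -/
theorem assign_row {i j : ℕ} (h : Slack n m C (Function.update ρ i 0) ϱ u v) (hi : 1 ≤ i)
    (hi' : i ≤ n) (hj : 1 ≤ j) (hj' : j ≤ m) (ht : C i j = u i + v j) :
    Slack n m C (Function.update (Function.update ρ i j) (ϱ j) 0) (Function.update ϱ j i) u v ∧
      ϱ j ≠ i := by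
  have hne : ϱ j ≠ i := by
    intro e
    have := (h.inv i j hi hi' hj hj').2 e
    rw [Function.update_self] at this
    omega
  refine ⟨⟨h.feas, fun a ha ha' => ?_, fun b hb hb' => ?_, fun a b ha ha' hb hb' => ?_,
    fun a ha ha' h0 => ?_, fun b hb hb' h0 => ?_⟩, hne⟩
  · have := h.ρ_le a ha ha'
    simp only [Function.update_apply] at this ⊢
    split_ifs at this ⊢ <;> omega
  · have := h.ϱ_le b hb hb'
    simp only [Function.update_apply]
    split_ifs <;> omega
  · have h1 := h.inv a b ha ha' hb hb'
    have h2 := h.inv a j ha ha' hj hj'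
    by_cases eb : b = j
    · subst eb
      simp only [Function.update_apply] at h1 ⊢
      split_ifs at h1 ⊢ <;> omega
    · simp only [Function.update_apply, if_neg eb] at h1 h2 ⊢
      split_ifs at h1 h2 ⊢ <;> omega
  · have h1 := h.tightρ a ha ha'
    by_cases e1 : a = ϱ j
    · subst e1; simp at h0
    · by_cases e2 : a = i
      · subst e2
        simpa [Function.update_of_ne e1] using ht
      · simp only [Function.update_of_ne e1, Function.update_of_ne e2] at h0 h1 ⊢
        exact h1 h0
  · by_cases e : b = j
    · subst e; simpa using ht
    · rw [Function.update_of_ne e] at h0 ⊢; exact h.tightϱ b hb hb' h0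

end Slack
end LSAPE

namespace LSAPE

/-! ### Trees of alternating paths -/

/-- Exchanging the entries of `P` at the positions `e` and `f`. -/
def swapAt (P : ℕ → ℕ) (e f : ℕ) : ℕ → ℕ := Function.update (Function.update P e (P f)) f (P e)

theorem swapAt_apply (P : ℕ → ℕ) (e f t : ℕ) :
    swapAt P e f t = if t = f then P e else if t = e then P f else P t := by
  simp only [swapAt, Function.update_apply]

/-- The tree of alternating paths rooted in the column `k`.  The rows of the tree are
`P 1, …, P b`, of which `P 1, …, P a` are expanded; its columns are `SV 1 = k` and, for each
expanded row `P t`, the column `SV (t + 1)` assigned to it.  Each row `i` of the tree hangs below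
one of the first `c` columns, `pred i`, along a tight edge; below an earlier one than its own if
it is expanded, so that the tree has no cycle. -/
structure Tree (n m : ℕ) (C : ℕ → ℕ → ℝ) (ρ ϱ : ℕ → ℕ) (k : ℕ) (u v : ℕ → ℝ)
    (P SV pred : ℕ → ℕ) (a b c : ℕ) : Prop where
  k_pos : 1 ≤ k
  k_le : k ≤ m
  free : ϱ k = 0
  mem : ∀ t, 1 ≤ t → t ≤ n → 1 ≤ P t ∧ P t ≤ n
  inj : ∀ s t, 1 ≤ s → s ≤ n → 1 ≤ t → t ≤ n → P s = P t → s = t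
  a_le : a ≤ b
  b_le : b ≤ n
  root : SV 1 = k
  child : ∀ t, 1 ≤ t → t ≤ a → SV (t + 1) = ρ (P t)
  assigned : ∀ t, 1 ≤ t → t ≤ b → 1 ≤ ρ (P t) ∧ ρ (P t) ≤ m
  parent : ∀ t, 1 ≤ t → t ≤ a → ∃ s, 1 ≤ s ∧ s ≤ t ∧ pred (P t) = SV s
  hang : ∀ t, 1 ≤ t → t ≤ b → ∃ s, 1 ≤ s ∧ s ≤ c ∧ pred (P t) = SV s
  tight : ∀ t, 1 ≤ t → t ≤ b → C (P t) (pred (P t)) = u (P t) + v (pred (P t))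

namespace Tree
variable {n m : ℕ} {C : ℕ → ℕ → ℝ} {ρ ϱ : ℕ → ℕ} {k : ℕ} {u v : ℕ → ℝ}
  {P SV pred : ℕ → ℕ} {a b c : ℕ}

/-- The vector `P` is a permutation of the rows. -/
theorem surj (h : Tree n m C ρ ϱ k u v P SV pred a b c) {i : ℕ} (hi : 1 ≤ i) (hi' : i ≤ n) :
    ∃ t, 1 ≤ t ∧ t ≤ n ∧ P t = i := by
  have := Finset.surj_on_of_inj_on_of_card_le (s := Finset.Icc 1 n) (t := Finset.Icc 1 n)
    (fun t _ => P t) (fun t ht => by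
      rw [Finset.mem_Icc] at ht ⊢; exact h.mem t ht.1 ht.2)
    (fun s t hs ht e => by
      rw [Finset.mem_Icc] at hs ht; exact h.inj s t hs.1 hs.2 ht.1 ht.2 e)
    le_rfl i (Finset.mem_Icc.2 ⟨hi, hi'⟩)
  obtain ⟨t, ht, e⟩ := this
  rw [Finset.mem_Icc] at ht
  exact ⟨t, ht.1, ht.2, e.symm⟩

theorem SV_mem (h : Tree n m C ρ ϱ k u v P SV pred a b c) {s : ℕ} (hs : 1 ≤ s)
    (hs' : s ≤ a + 1) : 1 ≤ SV s ∧ SV s ≤ m := by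
  obtain ⟨t, rfl⟩ : ∃ t, s = t + 1 := ⟨s - 1, by omega⟩
  rcases Nat.eq_zero_or_pos t with rfl | ht
  · rw [h.root]; exact ⟨h.k_pos, h.k_le⟩
  · rw [h.child t ht (by omega)]; exact h.assigned t ht (by have := h.a_le; omega)

theorem ϱ_child (h : Tree n m C ρ ϱ k u v P SV pred a b c) (hs : Slack n m C ρ ϱ u v) {t : ℕ}
    (ht : 1 ≤ t) (ht' : t ≤ a) : ϱ (SV (t + 1)) = P t := by
  have h1 := h.SV_mem (s := t + 1) (by omega) (by omega)
  have h2 := h.mem t ht (by have := h.a_le; have := h.b_le; omega)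
  exact (hs.inv (P t) _ h2.1 h2.2 h1.1 h1.2).1 (h.child t ht ht').symm

/-- The columns of the tree are distinct: those after the root are assigned to distinct rows, and
the root is unassigned. -/
theorem SV_inj (h : Tree n m C ρ ϱ k u v P SV pred a b c) (hs : Slack n m C ρ ϱ u v) {s t : ℕ}
    (hs1 : 1 ≤ s) (hs' : s ≤ a + 1) (ht : 1 ≤ t) (ht' : t ≤ a + 1) (e : SV s = SV t) :
    s = t := by
  obtain ⟨s, rfl⟩ : ∃ r, s = r + 1 := ⟨s - 1, by omega⟩
  obtain ⟨t, rfl⟩ : ∃ r, t = r + 1 := ⟨t - 1, by omega⟩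
  have ha := h.a_le
  have hb := h.b_le
  have key : ∀ r, 1 ≤ r → r ≤ a → SV (r + 1) ≠ SV 1 := by
    intro r hr hr' e
    have h1 := h.ϱ_child hs hr hr'
    rw [e, h.root, h.free] at h1
    have := h.mem r hr (by omega)
    omega
  rcases Nat.eq_zero_or_pos s with rfl | hs0 <;> rcases Nat.eq_zero_or_pos t with rfl | ht0
  · rfl
  · exact absurd e.symm (key t ht0 (by omega))
  · exact absurd e (key s hs0 (by omega))
  · have h1 := h.ϱ_child hs hs0 (by omega)
    have h2 := h.ϱ_child hs ht0 (by omega)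
    rw [e, h2] at h1
    rw [h.inj s t hs0 (by omega) ht0 (by omega) h1.symm]

theorem lt_cols (h : Tree n m C ρ ϱ k u v P SV pred a b c) (hs : Slack n m C ρ ϱ u v) :
    a + 1 ≤ m := by
  have := Finset.card_le_card_of_injOn (s := Finset.Icc 1 (a + 1)) (t := Finset.Icc 1 m) SV
    (fun s hs => by
      have hs := Finset.mem_Icc.1 hs
      exact Finset.mem_coe.2 (Finset.mem_Icc.2 (h.SV_mem hs.1 hs.2)))
    (fun s hs1 t ht e => by
      have hs1 := Finset.mem_Icc.1 hs1
      have ht := Finset.mem_Icc.1 ht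
      exact h.SV_inj hs hs1.1 hs1.2 ht.1 ht.2 e)
  simpa using this

theorem mono (h : Tree n m C ρ ϱ k u v P SV pred a b c) {c' : ℕ} (hc : c ≤ c') :
    Tree n m C ρ ϱ k u v P SV pred a b c' :=
  { h with
    hang := fun t ht ht' => by
      obtain ⟨s, h1, h2, h3⟩ := h.hang t ht ht'
      exact ⟨s, h1, by omega, h3⟩ }

/-- The vector `pred` matters only on the rows of the tree. -/
theorem congr_pred (h : Tree n m C ρ ϱ k u v P SV pred a b c) {pred' : ℕ → ℕ}
    (hp : ∀ t, 1 ≤ t → t ≤ b → pred' (P t) = pred (P t)) :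
    Tree n m C ρ ϱ k u v P SV pred' a b c :=
  { h with
    parent := fun t ht ht' => by
      rw [hp t ht (by have := h.a_le; omega)]; exact h.parent t ht ht'
    hang := fun t ht ht' => by rw [hp t ht ht']; exact h.hang t ht ht'
    tight := fun t ht ht' => by rw [hp t ht ht']; exact h.tight t ht ht' }

theorem swap_mem (h : Tree n m C ρ ϱ k u v P SV pred a b c) {e f : ℕ} (he : 1 ≤ e) (he' : e ≤ n)
    (hf : 1 ≤ f) (hf' : f ≤ n) (t : ℕ) (ht : 1 ≤ t) (ht' : t ≤ n) :
    1 ≤ swapAt P e f t ∧ swapAt P e f t ≤ n := by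
  rw [swapAt_apply]
  split_ifs
  exacts [h.mem e he he', h.mem f hf hf', h.mem t ht ht']

theorem swap_inj (h : Tree n m C ρ ϱ k u v P SV pred a b c) {e f : ℕ} (he : 1 ≤ e) (he' : e ≤ n)
    (hf : 1 ≤ f) (hf' : f ≤ n) (s t : ℕ) (hs : 1 ≤ s) (hs' : s ≤ n) (ht : 1 ≤ t) (ht' : t ≤ n)
    (hst : swapAt P e f s = swapAt P e f t) : s = t := by
  have h1 := h.inj e t he he' ht ht'
  have h2 := h.inj f t hf hf' ht ht'
  have h3 := h.inj s t hs hs' ht ht'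
  have h4 := h.inj s e hs hs' he he'
  have h5 := h.inj s f hs hs' hf hf'
  have h6 := h.inj e f he he' hf hf'
  have h7 := h.inj f e hf hf' he he'
  simp only [swapAt_apply] at hst
  split_ifs at hst <;> omega

/-- A row at a position `p` outside the tree joins it. -/
theorem grow (h : Tree n m C ρ ϱ k u v P SV pred a b c) {p : ℕ} (hp : b < p) (hp' : p ≤ n)
    (hρ : 1 ≤ ρ (P p) ∧ ρ (P p) ≤ m) (hpred : ∃ s, 1 ≤ s ∧ s ≤ c ∧ pred (P p) = SV s)
    (ht : C (P p) (pred (P p)) = u (P p) + v (pred (P p))) :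
    Tree n m C ρ ϱ k u v (swapAt P p (b + 1)) SV pred a (b + 1) c := by
  have ha := h.a_le
  have hold : ∀ t, t ≤ b → swapAt P p (b + 1) t = P t := by
    intro t ht
    rw [swapAt_apply, if_neg (by omega), if_neg (by omega)]
  have hnew : swapAt P p (b + 1) (b + 1) = P p := by rw [swapAt_apply, if_pos rfl]
  refine { h with
    mem := h.swap_mem (by omega) hp' (by omega) (by omega)
    inj := h.swap_inj (by omega) hp' (by omega) (by omega)
    a_le := by omega
    b_le := by omega
    child := fun t h1 h2 => by rw [hold t (by omega)]; exact h.child t h1 h2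
    assigned := fun t h1 h2 => ?_
    parent := fun t h1 h2 => by rw [hold t (by omega)]; exact h.parent t h1 h2
    hang := fun t h1 h2 => ?_
    tight := fun t h1 h2 => ?_ }
  all_goals
    rcases Nat.lt_or_ge b t with h3 | h3
    · obtain rfl : t = b + 1 := by omega
      rw [hnew]; assumption
    · rw [hold t h3]
      first | exact h.assigned t h1 h3 | exact h.hang t h1 h3 | exact h.tight t h1 h3

/-- A row at a position `q` in the tree is expanded: the column assigned to it joins the tree. -/
theorem expand (h : Tree n m C ρ ϱ k u v P SV pred a b (a + 1)) {q : ℕ} (hq : a < q)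
    (hq' : q ≤ b) :
    Tree n m C ρ ϱ k u v (swapAt P q (a + 1))
      (Function.update SV (a + 2) (ρ (swapAt P q (a + 1) (a + 1)))) pred (a + 1) b (a + 1) := by
  have hb := h.b_le
  have hold : ∀ t, t ≤ a → swapAt P q (a + 1) t = P t := by
    intro t ht
    rw [swapAt_apply, if_neg (by omega), if_neg (by omega)]
  have hnew : swapAt P q (a + 1) (a + 1) = P q := by rw [swapAt_apply, if_pos rfl]
  have hSV : ∀ j s, s ≤ a + 1 → Function.update SV (a + 2) j s = SV s :=
    fun j s hs => Function.update_of_ne (by omega) _ _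
  have hex : ∀ t, 1 ≤ t → t ≤ b → ∃ s, 1 ≤ s ∧ s ≤ b ∧ swapAt P q (a + 1) t = P s := by
    intro t h1 h2
    rw [swapAt_apply]
    split_ifs
    exacts [⟨q, by omega, hq', rfl⟩, ⟨a + 1, by omega, by omega, rfl⟩, ⟨t, h1, h2, rfl⟩]
  refine { h with
    mem := h.swap_mem (by omega) (by omega) (by omega) (by omega)
    inj := h.swap_inj (by omega) (by omega) (by omega) (by omega)
    a_le := by omega
    root := by rw [hSV _ _ (by omega)]; exact h.root
    child := fun t h1 h2 => ?_
    assigned := fun t h1 h2 => ?_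
    parent := fun t h1 h2 => ?_
    hang := fun t h1 h2 => ?_
    tight := fun t h1 h2 => ?_ }
  · rcases Nat.lt_or_ge a t with h3 | h3
    · obtain rfl : t = a + 1 := by omega
      rw [Function.update_self]
    · rw [hSV _ _ (by omega), hold t h3]; exact h.child t h1 h3
  · obtain ⟨s, h3, h4, e⟩ := hex t h1 h2
    rw [e]; exact h.assigned s h3 h4
  · rcases Nat.lt_or_ge a t with h3 | h3
    · obtain rfl : t = a + 1 := by omega
      obtain ⟨s, h4, h5, e⟩ := h.hang q (by omega) hq'
      exact ⟨s, h4, h5, by rw [hnew, e, hSV _ _ h5]⟩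
    · obtain ⟨s, h4, h5, e⟩ := h.parent t h1 h3
      exact ⟨s, h4, h5, by rw [hold t h3, e, hSV _ _ (by omega)]⟩
  · obtain ⟨t', h3, h4, e⟩ := hex t h1 h2
    obtain ⟨s, h5, h6, e'⟩ := h.hang t' h3 h4
    exact ⟨s, h5, h6, by rw [e, e', hSV _ _ h6]⟩
  · obtain ⟨s, h3, h4, e⟩ := hex t h1 h2
    rw [e]; exact h.tight s h3 h4

end Tree

/-! ### The dual update -/

open Classical in
/-- The function `f` shifted by `d` on the set `{S 1, …, S c}`. -/
noncomputable def shift (f : ℕ → ℝ) (S : ℕ → ℕ) (c : ℕ) (d : ℝ) (x : ℕ) : ℝ :=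
  if ∃ s, 1 ≤ s ∧ s ≤ c ∧ S s = x then f x + d else f x

theorem shift_of_mem {f : ℕ → ℝ} {S : ℕ → ℕ} {c s : ℕ} {d : ℝ} (h : 1 ≤ s) (h' : s ≤ c) :
    shift f S c d (S s) = f (S s) + d := if_pos ⟨s, h, h', rfl⟩

theorem shift_of_not_mem {f : ℕ → ℝ} {S : ℕ → ℕ} {c x : ℕ} {d : ℝ}
    (h : ∀ s, 1 ≤ s → s ≤ c → S s ≠ x) : shift f S c d x = f x :=
  if_neg fun ⟨s, h1, h2, e⟩ => h s h1 h2 e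

theorem shift_zero (f : ℕ → ℝ) (S : ℕ → ℕ) (d : ℝ) : shift f S 0 d = f := by
  funext x; exact shift_of_not_mem fun s h1 h2 => by omega

section
variable {n m : ℕ} {C : ℕ → ℕ → ℝ} {ρ ϱ : ℕ → ℕ} {k : ℕ} {u v : ℕ → ℝ}
  {P SV pred : ℕ → ℕ} {a : ℕ} {d : ℝ}

theorem Tree.shift_eq (h : Tree n m C ρ ϱ k u v P SV pred a a (a + 1)) {t : ℕ} (h1 : a < t)
    (h2 : t ≤ n) : shift u P a (-d) (P t) = u (P t) :=
  shift_of_not_mem fun s h3 h4 e => by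
    have := h.inj s t h3 (by omega) (by omega) h2 e; omega

/-- When all the rows of the tree are expanded, the dual variables can be increased by `d` on the
columns and decreased by `d` on the rows of the tree, as long as no edge from a column of the tree
to a row outside of it, or to the null row, has a smaller reduced cost. -/
theorem Slack.dual_update (hs : Slack n m C ρ ϱ u v)
    (h : Tree n m C ρ ϱ k u v P SV pred a a (a + 1)) (hd : 0 ≤ d)
    (hε : ∀ s, 1 ≤ s → s ≤ a + 1 → d ≤ C (n + 1) (SV s) - v (SV s))
    (hr : ∀ t, a < t → t ≤ n → ∀ s, 1 ≤ s → s ≤ a + 1 →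
      d ≤ C (P t) (SV s) - u (P t) - v (SV s)) :
    Slack n m C ρ ϱ (shift u P a (-d)) (shift v SV (a + 1) d) ∧
    Tree n m C ρ ϱ k (shift u P a (-d)) (shift v SV (a + 1) d) P SV pred a a (a + 1) := by
  have han := h.b_le
  have hu_row : ∀ t, 1 ≤ t → t ≤ a → shift u P a (-d) (P t) = u (P t) - d :=
    fun t h1 h2 => by rw [shift_of_mem h1 h2, sub_eq_add_neg]
  have hu_out : ∀ t, a < t → t ≤ n → shift u P a (-d) (P t) = u (P t) :=
    fun t h1 h2 => h.shift_eq h1 h2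
  have hu_null : shift u P a (-d) (n + 1) = u (n + 1) :=
    shift_of_not_mem fun s h3 h4 e => by have := h.mem s h3 (by omega); omega
  have hv_null : shift v SV (a + 1) d (m + 1) = v (m + 1) :=
    shift_of_not_mem fun s h3 h4 e => by have := h.SV_mem h3 h4; omega
  have hv_mem : ∀ s, 1 ≤ s → s ≤ a + 1 → shift v SV (a + 1) d (SV s) = v (SV s) + d :=
    fun s h1 h2 => shift_of_mem h1 h2
  -- A tight pair stays tight when both or none of its ends belong to the tree.
  have htight : ∀ t, 1 ≤ t → t ≤ n → ρ (P t) ≠ 0 →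
      shift u P a (-d) (P t) + shift v SV (a + 1) d (ρ (P t)) = u (P t) + v (ρ (P t)) := by
    intro t h1 h2 h0
    have hm := h.mem t h1 h2
    rcases Nat.lt_or_ge a t with h3 | h3
    · rw [hu_out t h3 h2, shift_of_not_mem]
      intro s hs1 hs2 e
      have hS := h.SV_mem hs1 hs2
      have e' := (hs.inv (P t) (SV s) hm.1 hm.2 hS.1 hS.2).1 e.symm
      obtain ⟨s, rfl⟩ : ∃ r, s = r + 1 := ⟨s - 1, by omega⟩
      rcases Nat.eq_zero_or_pos s with rfl | hs0
      · rw [h.root, h.free] at e'; omega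
      · rw [h.ϱ_child hs hs0 (by omega)] at e'
        have := h.inj s t hs0 (by omega) h1 h2 e'
        omega
    · rw [hu_row t h1 h3, ← h.child t h1 h3, hv_mem (t + 1) (by omega) (by omega)]
      ring
  refine ⟨⟨⟨by rw [hu_null]; exact hs.feas.1, by rw [hv_null]; exact hs.feas.2.1, ?_⟩,
    hs.ρ_le, hs.ϱ_le, hs.inv, ?_, ?_⟩, { h with tight := ?_ }⟩
  · intro i hi j hj
    rw [Finset.mem_Icc] at hi hj
    have hle := hs.le hi.1 hi.2 hj.1 hj.2
    by_cases hin : i = n + 1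
    · subst hin
      rw [hu_null]
      by_cases hjS : ∃ s, 1 ≤ s ∧ s ≤ a + 1 ∧ SV s = j
      · obtain ⟨s, h1, h2, rfl⟩ := hjS
        rw [hv_mem s h1 h2, hs.feas.1]
        linarith [hε s h1 h2]
      · rw [shift_of_not_mem fun s h1 h2 e => hjS ⟨s, h1, h2, e⟩]
        exact hle
    · obtain ⟨t, h1, h2, rfl⟩ := h.surj hi.1 (by omega)
      rcases Nat.lt_or_ge a t with h3 | h3
      · rw [hu_out t h3 h2]
        by_cases hjS : ∃ s, 1 ≤ s ∧ s ≤ a + 1 ∧ SV s = j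
        · obtain ⟨s, h4, h5, rfl⟩ := hjS
          rw [hv_mem s h4 h5]
          linarith [hr t h3 h2 s h4 h5]
        · rw [shift_of_not_mem fun s h1 h2 e => hjS ⟨s, h1, h2, e⟩]
          exact hle
      · rw [hu_row t h1 h3]
        have : shift v SV (a + 1) d j ≤ v j + d := by
          unfold shift; split_ifs <;> linarith
        linarith
  · intro i hi hi' h0
    obtain ⟨t, h1, h2, rfl⟩ := h.surj hi hi'
    rw [hs.tightρ _ hi hi' h0, htight t h1 h2 h0]
  · intro j hj hj' h0
    have hb := hs.ϱ_le j hj hj'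
    rw [hs.tightϱ j hj hj' h0]
    by_cases hn : ϱ j = n + 1
    · rw [hn, hu_null, shift_of_not_mem]
      intro s hs1 hs2 e
      obtain ⟨s, rfl⟩ : ∃ r, s = r + 1 := ⟨s - 1, by omega⟩
      rcases Nat.eq_zero_or_pos s with rfl | hs0
      · rw [h.root] at e; rw [← e, h.free] at hn; omega
      · have := h.ϱ_child hs hs0 (by omega)
        rw [e, hn] at this
        have := h.mem s hs0 (by omega)
        omega
    · obtain ⟨t, h1, h2, e⟩ := h.surj (i := ϱ j) (by omega) (by omega)
      have e2 : ρ (P t) = j := by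
        have := h.mem t h1 h2
        exact (hs.inv (P t) j this.1 this.2 hj hj').2 e.symm
      have := htight t h1 h2 (by omega)
      rw [e2, e] at this
      exact this.symm
  · intro t h1 h2
    obtain ⟨s, h3, h4, e⟩ := h.hang t h1 h2
    rw [hu_row t h1 h2, e, hv_mem s h3 h4, ← e, h.tight t h1 h2]
    ring

end

/-! ### Reduced costs outside the tree, and sinks -/

/-- `y` is the least reduced cost of an edge from row `i` to one of the columns `SV 1, …, SV c`
(`⊤` if `c = 0`), attained at the column `pr` if it is finite. -/
def Reach (C : ℕ → ℕ → ℝ) (u v : ℕ → ℝ) (SV : ℕ → ℕ) (c : ℕ) (i pr : ℕ) (y : EReal) : Prop :=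
  (∀ s, 1 ≤ s → s ≤ c → y ≤ ((C i (SV s) - u i - v (SV s) : ℝ) : EReal)) ∧
  (y = ⊤ ∨ ∃ s, 1 ≤ s ∧ s ≤ c ∧ pr = SV s ∧ y = ((C i (SV s) - u i - v (SV s) : ℝ) : EReal))

theorem Reach.tight {C : ℕ → ℕ → ℝ} {u v : ℕ → ℝ} {SV : ℕ → ℕ} {c i pr : ℕ}
    (h : Reach C u v SV c i pr 0) :
    ∃ s, 1 ≤ s ∧ s ≤ c ∧ pr = SV s ∧ C i (SV s) = u i + v (SV s) := by
  rcases h.2 with h | ⟨s, h1, h2, h3, h4⟩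
  · exact absurd h EReal.zero_ne_top
  · refine ⟨s, h1, h2, h3, ?_⟩
    have : (0 : ℝ) = C i (SV s) - u i - v (SV s) := by exact_mod_cast h4
    linarith

/-- The end `(si, sj)` of an augmenting path: the null row, reached from the column `sj`, or (with
`sj = 0`) a row `si` without an image in `V`. -/
def Sink (n m : ℕ) (C : ℕ → ℕ → ℝ) (ρ : ℕ → ℕ) (u v : ℕ → ℝ) (SV pred : ℕ → ℕ)
    (c si sj : ℕ) : Prop :=
  (si = n + 1 ∧ ∃ s, 1 ≤ s ∧ s ≤ c ∧ sj = SV s ∧ C (n + 1) sj = u (n + 1) + v sj) ∨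
  (sj = 0 ∧ (1 ≤ si ∧ si ≤ n) ∧ (ρ si = 0 ∨ ρ si = m + 1) ∧
    ∃ s, 1 ≤ s ∧ s ≤ c ∧ pred si = SV s ∧ C si (SV s) = u si + v (SV s))

end LSAPE

namespace LSAPE
open NVar RVar

/-! ### Growing the tree -/

/-- The context in which columns are assigned. -/
def workCtx (n m : ℕ) (C : ℕ → ℕ → ℝ) (peak : ℕ) : Ctx where
  n := n
  m := m
  inp := costInput n m C
  lenN := fun
    | .ρ => n
    | .ϱ => m
    | .pred => n
    | .P => n
    | .SV => m
  lenR := fun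
    | .u => n + 1
    | .v => m + 1
    | .π => n
  peak := peak

section
variable (n m : ℕ) (C : ℕ → ℕ → ℝ) (pk : ℕ)
@[simp] theorem workCtx_n : (workCtx n m C pk).n = n := rfl
@[simp] theorem workCtx_m : (workCtx n m C pk).m = m := rfl
@[simp] theorem workCtx_rows : (workCtx n m C pk).inp.rows = n + 1 := rfl
@[simp] theorem workCtx_cols : (workCtx n m C pk).inp.cols = m + 1 := rfl
@[simp] theorem workCtx_entry : (workCtx n m C pk).inp.entry = C := rfl
@[simp] theorem workCtx_ρ : (workCtx n m C pk).lenN .ρ = n := rfl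
@[simp] theorem workCtx_ϱ : (workCtx n m C pk).lenN .ϱ = m := rfl
@[simp] theorem workCtx_pred : (workCtx n m C pk).lenN .pred = n := rfl
@[simp] theorem workCtx_P : (workCtx n m C pk).lenN .P = n := rfl
@[simp] theorem workCtx_SV : (workCtx n m C pk).lenN .SV = m := rfl
@[simp] theorem workCtx_u : (workCtx n m C pk).lenR .u = n + 1 := rfl
@[simp] theorem workCtx_v : (workCtx n m C pk).lenR .v = m + 1 := rfl
@[simp] theorem workCtx_π : (workCtx n m C pk).lenR .π = n := rfl
end

/-- A row whose reduced cost has dropped to zero is recognized as a sink or joins the tree. -/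
def joinRow : Stmt :=
  ifThen (.eqR (RArr.π.at (N i)) .zero) (
    .cond (.or (.eqN (NArr.ρ.at (N i)) 0) (.eqN (NArr.ρ.at (N i)) (N m + 1)))
      (.setN si (N i) ;; .setN sj 0 ;; .setN found 1)
      (.setN nLU (N nLU + 1) ;; swapP (N p) (N nLU)))

/-- The loop of `scanColumn`. -/
def scanColumnLoop : Stmt :=
  .loop (.and (.leN (N p) (N n)) (.eqN (N found) 0)) (
    .setN i (NArr.P.at (N p)) ;;
    .setR w (.mat (N i) (N j) - RArr.u.at (N i) - RArr.v.at (N j)) ;;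
    ifThen (.ltR (X w) (RArr.π.at (N i))) (
      .putN .pred (N i) (N j) ;;
      .putR .π (N i) (X w) ;;
      joinRow) ;;
    .setN p (N p + 1))

/-- The reduced costs outside of the tree are updated with the edges from the column `j`. -/
def scanColumn : Stmt := .setN p (N nLU + 1) ;; scanColumnLoop

/-- The invariant of the search for an augmenting path: the assignment, the dual variables (held
in the arrays `u` and `v`) and the tree. -/
structure Core (n m : ℕ) (C : ℕ → ℕ → ℝ) (u v : ℕ → ℝ) (x : Store) : Prop where
  slack : Slack n m C x.ρ x.ϱ u v
  tree : Tree n m C x.ρ x.ϱ x.k u v x.P x.SV x.pred x.nSU x.nLU x.nSV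
  hu : ∀ i, 1 ≤ i → i ≤ n + 1 → x.u i = (u i : ℝ)
  hv : ∀ j, 1 ≤ j → j ≤ m + 1 → x.v j = (v j : ℝ)

/-- The values `pr` of `pred` and `y` of `π` are those of a row `i` that has been compared with the
first `c` columns of the tree and has to stay outside of the tree. -/
def Waits (C : ℕ → ℕ → ℝ) (u v : ℕ → ℝ) (SV : ℕ → ℕ) (c i pr : ℕ) (y : EReal) : Prop :=
  Reach C u v SV c i pr y ∧ y ≠ 0

/-- The row at position `s` has been compared with all the columns of the tree and has to stay
outside of the tree. -/
def Ready (C : ℕ → ℕ → ℝ) (u v : ℕ → ℝ) (x : Store) (s : ℕ) : Prop :=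
  Waits C u v x.SV x.nSV (x.P s) (x.pred (x.P s)) (x.π (x.P s))

/-- What a scan of the rows outside of the tree leaves unchanged. -/
structure Frame (x₀ x : Store) : Prop where
  ρ : x.ρ = x₀.ρ
  ϱ : x.ϱ = x₀.ϱ
  k : x.k = x₀.k
  SV : x.SV = x₀.SV
  nSU : x.nSU = x₀.nSU
  nSV : x.nSV = x₀.nSV
  j : x.j = x₀.j
  δ : x.δ = x₀.δ

/-- The invariant of a scan of the rows outside of the tree, at position `t`.  The rows that have
not been visited satisfy `G`; either there are at least `b₀` rows in the tree, or some row that has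
not been visited satisfies `H`. -/
structure RowInv (n m : ℕ) (C : ℕ → ℕ → ℝ) (u v : ℕ → ℝ) (x₀ : Store) (b₀ : ℕ)
    (G : ℕ → ℕ → EReal → Prop) (H : ℕ → Prop) (t : ℕ) (x : Store) : Prop where
  core : Core n m C u v x
  frame : Frame x₀ x
  p_eq : x.p = t
  lo : x.nLU < t
  hi : t ≤ n + 1
  mono : b₀ ≤ x.nLU + 1
  time_le : x.time ≤ x₀.time + 100 * t
  status : (x.found = 0 ∧ (∀ s, x.nLU < s → s < t → Ready C u v x s) ∧
      (∀ s, t ≤ s → s ≤ n → G (x.P s) (x.pred (x.P s)) (x.π (x.P s))) ∧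
      (b₀ ≤ x.nLU ∨ ∃ s, t ≤ s ∧ s ≤ n ∧ H (x.P s))) ∨
    (x.found = 1 ∧ Sink n m C x.ρ u v x.SV x.pred x.nSV x.si x.sj)

section
variable {n m : ℕ} {C : ℕ → ℕ → ℝ} {pk : ℕ} {ω : ℕ → ℕ} {u v : ℕ → ℝ} {x₀ x : Store} {b₀ : ℕ}
  {G : ℕ → ℕ → EReal → Prop} {H : ℕ → Prop} {t : ℕ}

/-- The body of both scans of the rows.  The hypothesis `hprog` ensures that the tree will have at
least `b₀` rows: they are there, or the current row joins, or a later one will. -/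
theorem vc_joinRow (hc : Core n m C u v x) (hF : Frame x₀ x) (hf : x.found = 0) (hp : x.p = t)
    (hi : x.i = x.P t) (hlo : x.nLU < t) (hmono : b₀ ≤ x.nLU + 1) (ht : t ≤ n)
    (hdone : ∀ s, x.nLU < s → s < t → Ready C u v x s)
    (htodo : ∀ s, t < s → s ≤ n → G (x.P s) (x.pred (x.P s)) (x.π (x.P s)))
    (hcur : Reach C u v x.SV x.nSV (x.P t) (x.pred (x.P t)) (x.π (x.P t)))
    (hprog : b₀ ≤ x.nLU ∨ x.π (x.P t) = 0 ∨ ∃ s, t < s ∧ s ≤ n ∧ H (x.P s))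
    (htime : x.time + 40 ≤ x₀.time + 100 * (t + 1)) :
    vc (workCtx n m C pk) ω joinRow
      (vc (workCtx n m C pk) ω (.setN p (N p + 1)) (RowInv n m C u v x₀ b₀ G H (t + 1))) x := by
  have hm := hc.tree.mem t (by omega) ht
  simp [joinRow, swapP, hi, hp]
  refine ⟨hm, fun h0 => ⟨hm, fun hsink => ?_, fun hρ0 hρ1 => ?_⟩, fun h0 => ?_⟩
  · rw [h0] at hcur
    exact ⟨⟨hc.slack, hc.tree, hc.hu, hc.hv⟩, ⟨hF.1, hF.2, hF.3, hF.4, hF.5, hF.6, hF.7, hF.8⟩,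
      rfl, by simp only; omega, by omega, hmono, by simp only; omega,
      Or.inr ⟨rfl, Or.inr ⟨rfl, hm, hsink, hcur.tight⟩⟩⟩
  · rw [h0] at hcur
    have hρ := hc.slack.ρ_le _ hm.1 hm.2
    obtain ⟨s, hs1, hs2, hs3, hs4⟩ := hcur.tight
    have hg := hc.tree.grow hlo ht (by omega) ⟨s, hs1, hs2, hs3⟩ (by rw [hs3]; exact hs4)
    refine ⟨by omega, by omega, by omega, ⟨hc.slack, hg, hc.hu, hc.hv⟩,
      ⟨hF.1, hF.2, hF.3, hF.4, hF.5, hF.6, hF.7, hF.8⟩, rfl, by simp only; omega, by omega,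
      by simp only; omega, by simp only; omega, Or.inl ⟨hf, ?_, ?_, Or.inl hmono⟩⟩
    · intro s h1 h2
      simp only at h1
      have e : ∀ r, swapAt x.P t (x.nLU + 1) s = x.P r → Ready C u v x r →
          Ready C u v { x with P := swapAt x.P t (x.nLU + 1) } s := by
        intro r e h; unfold Ready at h ⊢; simp only [e]; exact h
      rcases Nat.lt_or_ge s t with h3 | h3
      · exact e s (by rw [swapAt_apply, if_neg (by omega), if_neg (by omega)])
          (hdone s (by omega) h3)
      · exact e (x.nLU + 1) (by rw [swapAt_apply, if_neg (by omega), if_pos (by omega)])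
          (hdone _ (by omega) (by omega))
    · intro s h1 h2
      have e : swapAt x.P t (x.nLU + 1) s = x.P s := by
        rw [swapAt_apply, if_neg (by omega), if_neg (by omega)]
      change G (swapAt x.P t (x.nLU + 1) s) _ _
      rw [e]
      have := htodo s (by omega) h2
      simp only
      change G (x.P s) (x.pred (swapAt x.P t (x.nLU + 1) s)) (x.π (swapAt x.P t (x.nLU + 1) s))
      rw [e]; exact this
  · refine ⟨⟨hc.slack, hc.tree, hc.hu, hc.hv⟩,
      ⟨hF.1, hF.2, hF.3, hF.4, hF.5, hF.6, hF.7, hF.8⟩, rfl, by simp only; omega, by omega,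
      hmono, by simp only; omega, Or.inl ⟨hf, ?_, fun s h1 h2 => htodo s (by omega) h2, ?_⟩⟩
    · intro s h1 h2
      rcases Nat.lt_or_ge s t with h3 | h3
      · exact hdone s h1 h3
      · obtain rfl : s = t := by omega
        exact ⟨hcur, h0⟩
    · rcases hprog with h | h | ⟨s, h1, h2, h3⟩
      · exact Or.inl h
      · exact absurd h h0
      · exact Or.inr ⟨s, h1, h2, h3⟩

/-- The outcome of a scan of the rows outside of the tree: all of them have been visited, and the
tree has at least `b₀` rows, or a sink has been found. -/
structure Grown (n m : ℕ) (C : ℕ → ℕ → ℝ) (u v : ℕ → ℝ) (x₀ : Store) (b₀ T : ℕ)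
    (x : Store) : Prop where
  core : Core n m C u v x
  frame : Frame x₀ x
  time_le : x.time ≤ x₀.time + T
  status : (x.found = 0 ∧ (∀ s, x.nLU < s → s ≤ n → Ready C u v x s) ∧ b₀ ≤ x.nLU) ∨
    (x.found = 1 ∧ Sink n m C x.ρ u v x.SV x.pred x.nSV x.si x.sj)

theorem RowInv.grown (h : RowInv n m C u v x₀ b₀ G H t x)
    (hx : ¬ (x.p ≤ n ∧ x.found = 0)) (T : ℕ) (hT : 100 * (n + 1) + T ≤ b) :
    Grown n m C u v x₀ b₀ b (x.tick T) := by
  have h1 := h.p_eq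
  have h2 := h.hi
  have hc := h.core
  have hF := h.frame
  refine ⟨⟨hc.slack, hc.tree, hc.hu, hc.hv⟩, ⟨hF.1, hF.2, hF.3, hF.4, hF.5, hF.6, hF.7, hF.8⟩,
    ?_, ?_⟩
  · have := h.time_le
    simp only [Store.tick]; omega
  · rcases h.status with ⟨h3, h4, h5, h6⟩ | h3
    · refine Or.inl ⟨h3, fun s h7 h8 => h4 s h7 (by omega), ?_⟩
      rcases h6 with h6 | ⟨s, h7, h8, -⟩
      · exact h6
      · omega
    · exact Or.inr h3

theorem Reach.lt_last {SV : ℕ → ℕ} {c i pr : ℕ} {y : EReal} (h : Reach C u v SV c i pr y)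
    (hlt : ((C i (SV (c + 1)) - u i - v (SV (c + 1)) : ℝ) : EReal) < y) :
    Reach C u v SV (c + 1) i (SV (c + 1))
      ((C i (SV (c + 1)) - u i - v (SV (c + 1)) : ℝ) : EReal) := by
  refine ⟨fun s h1 h2 => ?_, Or.inr ⟨c + 1, by omega, le_rfl, rfl, rfl⟩⟩
  rcases Nat.lt_or_ge c s with h3 | h3
  · obtain rfl : s = c + 1 := by omega
    exact le_rfl
  · exact hlt.le.trans (h.1 s h1 h3)

theorem Reach.le_last {SV : ℕ → ℕ} {c i pr : ℕ} {y : EReal} (h : Reach C u v SV c i pr y)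
    (hle : y ≤ ((C i (SV (c + 1)) - u i - v (SV (c + 1)) : ℝ) : EReal)) :
    Reach C u v SV (c + 1) i pr y := by
  refine ⟨fun s h1 h2 => ?_, ?_⟩
  · rcases Nat.lt_or_ge c s with h3 | h3
    · obtain rfl : s = c + 1 := by omega
      exact hle
    · exact h.1 s h1 h3
  · rcases h.2 with h | ⟨s, h1, h2, h3⟩
    · exact Or.inl h
    · exact Or.inr ⟨s, h1, by omega, h3⟩

/-- Comparing the rows outside of the tree with its newest column makes them `Ready`. -/
theorem vc_scanColumn (hΓ : (workCtx n m C pk).space ≤ pk) (hc : Core n m C u v x)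
    (hf : x.found = 0) (hV : x.nSV = x.nSU + 1) (hj : x.j = x.SV x.nSV)
    (hr : ∀ s, x.nLU < s → s ≤ n →
      Waits C u v x.SV x.nSU (x.P s) (x.pred (x.P s)) (x.π (x.P s))) :
    vc (workCtx n m C pk) ω scanColumn (Grown n m C u v x 0 (100 * (n + 2))) x := by
  have hb := hc.tree.b_le
  simp [scanColumn, scanColumnLoop]
  refine vc_loop_up hΓ n (RowInv n m C u v x 0
    (Waits C u v x.SV x.nSU) (fun _ => False)) ?_ (x.nLU + 1) ?_
  · intro t y hy
    refine ⟨by simp, fun hcond => ?_, fun hcond => hy.grown (by simpa using hcond) _ (by simp; omega)⟩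
    simp at hcond
    obtain ⟨hpn, hf0⟩ := hcond
    have hpt := hy.p_eq
    have hcy := hy.core
    have hF := hy.frame
    have htime := hy.time_le
    have hlo := hy.lo
    refine ⟨by omega, ?_⟩
    have hm := hcy.tree.mem t (by omega) (by omega)
    have hjy : y.j = y.SV (y.nSU + 1) := by rw [hF.j, hF.SV, hj, hV, hF.nSU]
    have hVy : y.nSV = y.nSU + 1 := by rw [hF.nSU, hF.nSV, hV]
    have hjm := hcy.tree.SV_mem (s := y.nSU + 1) (by omega) le_rfl
    rw [← hjy] at hjm
    have hw : (C (y.P t) y.j : EReal) - y.u (y.P t) - y.v y.j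
        = ((C (y.P t) (y.SV (y.nSU + 1)) - u (y.P t) - v (y.SV (y.nSU + 1)) : ℝ) : EReal) := by
      rw [hcy.hu _ hm.1 (by omega), hcy.hv _ hjm.1 (by omega), ← hjy]
      norm_cast
    obtain ⟨-, hdone, htodo, -⟩ | ⟨h1, -⟩ := hy.status
    swap
    · omega
    obtain ⟨hR, hne⟩ := htodo t le_rfl (by omega)
    rw [← hF.SV, ← hF.nSU] at hR
    simp [hpt, hw, -EReal.coe_sub]
    refine ⟨by omega, by omega, hm, fun hlt => ⟨hm, ?_⟩, fun hle => ?_⟩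
    · have hne' : ∀ s, 1 ≤ s → s ≤ n → s ≠ t → y.P s ≠ y.P t := fun s h1 h2 h3 e =>
        h3 (hcy.tree.inj s t h1 h2 (by omega) (by omega) e)
      refine vc_joinRow
        ⟨hcy.slack, hcy.tree.congr_pred fun s h1 h2 => Function.update_of_ne
          (hne' s h1 (by omega) (by omega)) _ _, hcy.hu, hcy.hv⟩
        ⟨hF.1, hF.2, hF.3, hF.4, hF.5, hF.6, hF.7, hF.8⟩ hf0 rfl rfl hlo (by omega) (by omega)
        ?_ ?_ ?_ (Or.inl (by omega)) (by simp only; omega)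
      · intro s h1 h2
        have := hdone s h1 h2
        have e := hne' s (by omega) (by omega) (by omega)
        unfold Ready at this ⊢
        simp only [Function.update_of_ne e]
        exact this
      · intro s h1 h2
        have := htodo s (by omega) h2
        have e := hne' s (by omega) h2 (by omega)
        simp only [Function.update_of_ne e]
        exact this
      · simp only [Function.update_self]
        rw [hjy, hVy]
        exact hR.lt_last hlt
    · refine ⟨⟨hcy.slack, hcy.tree, hcy.hu, hcy.hv⟩,
        ⟨hF.1, hF.2, hF.3, hF.4, hF.5, hF.6, hF.7, hF.8⟩, rfl, by simp only; omega, by omega,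
        by omega, by simp only; omega, Or.inl ⟨hf0, fun s h1 h2 => ?_,
          fun s h1 h2 => htodo s (by omega) h2, Or.inl (by omega)⟩⟩
      rcases Nat.lt_or_ge s t with h3 | h3
      · exact hdone s h1 h3
      · obtain rfl : s = t := by omega
        refine ⟨?_, hne⟩
        change Reach C u v y.SV y.nSV _ _ _
        rw [hVy]
        exact hR.le_last hle
  · exact ⟨⟨hc.slack, hc.tree, hc.hu, hc.hv⟩, ⟨rfl, rfl, rfl, rfl, rfl, rfl, rfl, rfl⟩, rfl,
      by simp only; omega, by omega, by omega, by simp only; omega,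
      Or.inl ⟨hf, fun s h1 h2 => by simp only at h1; omega,
        fun s h1 h2 => hr s (by omega) h2, Or.inl (by omega)⟩⟩
end
end LSAPE

namespace LSAPE
open NVar RVar

/-! ### The dual step of the search -/

/-- The loop of `minRows`. -/
def minRowsLoop : Stmt :=
  forLoop p (N nLU + 1) (N n) (
    ifThen (.ltR (RArr.π.at (NArr.P.at (N p))) (X δs)) (.setR δs (RArr.π.at (NArr.P.at (N p)))))

/-- The least reduced cost `δs` outside of the tree. -/
def minRows : Stmt := .setR δs .infty ;; minRowsLoop

/-- The loop of `minNull`. -/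
def minNullLoop : Stmt :=
  forLoop p 1 (N nSV) (
    .setN q (NArr.SV.at (N p)) ;;
    ifThen (.ltR (.mat (N n + 1) (N q) - RArr.v.at (N q)) (X δε))
      (.setN l (N q) ;; .setR δε (.mat (N n + 1) (N q) - RArr.v.at (N q))))

/-- The least reduced cost `δε` of an edge from a column of the tree to the null row, attained at
the column `l`. -/
def minNull : Stmt := .setR δε .infty ;; minNullLoop

/-- The dual variables of the columns of the tree are increased by `δ`. -/
def raiseCols : Stmt :=
  forLoop p 1 (N nSV) (
    .setN q (NArr.SV.at (N p)) ;; .putR .v (N q) (RArr.v.at (N q) + X δ))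

/-- The dual variables of the rows of the tree are decreased by `δ`. -/
def lowerRows : Stmt :=
  forLoop p 1 (N nLU) (
    .setN q (NArr.P.at (N p)) ;; .putR .u (N q) (RArr.u.at (N q) - X δ))

/-- The reduced costs outside of the tree are decreased by `δ`. -/
def scanRows : Stmt :=
  .setN p (N nLU + 1) ;;
  .loop (.and (.leN (N p) (N n)) (.eqN (N found) 0)) (
    .setN i (NArr.P.at (N p)) ;;
    .putR .π (N i) (RArr.π.at (N i) - X δ) ;;
    joinRow ;;
    .setN p (N p + 1))

/-- The dual update. -/
def dualStep : Stmt :=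
  .setR δs .infty ;; minRowsLoop ;; .setR δε .infty ;; minNullLoop ;;
  .cond (.leR (X δs) (X δε)) (.setR δ (X δs)) (.setR δ (X δε)) ;;
  raiseCols ;; lowerRows ;;
  .cond (.leR (X δε) (X δs)) (.setN si (N n + 1) ;; .setN sj (N l) ;; .setN found 1) scanRows

open Classical in
/-- A shift is built up one element at a time, as in a loop. -/
theorem shift_step {f : ℕ → ℝ} {S : ℕ → ℕ} {t : ℕ} {d : ℝ} (ht : 1 ≤ t)
    (hS : ∀ s, 1 ≤ s → s < t → S s ≠ S t) (y : ℕ) :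
    shift f S t d y = if y = S t then f y + d else shift f S (t - 1) d y := by
  split_ifs with h
  · subst h; exact shift_of_mem ht le_rfl
  · unfold shift
    refine if_congr ⟨?_, ?_⟩ rfl rfl
    · rintro ⟨s, h1, h2, h3⟩
      refine ⟨s, h1, ?_, h3⟩
      by_contra h4
      obtain rfl : s = t := by omega
      exact h h3.symm
    · rintro ⟨s, h1, h2, h3⟩
      exact ⟨s, h1, by omega, h3⟩

section
variable {n m : ℕ} {C : ℕ → ℕ → ℝ} {pk : ℕ} {ω : ℕ → ℕ} {u v : ℕ → ℝ} {x : Store}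
  {Q : Store → Prop}

theorem vc_minRows (hΓ : (workCtx n m C pk).space ≤ pk)
    (hP : ∀ t, 1 ≤ t → t ≤ n → 1 ≤ x.P t ∧ x.P t ≤ n) (hL : x.nLU ≤ n)
    (hQ : ∀ p d T, T ≤ x.time + 30 * (n + 3) → (∀ s, x.nLU < s → s ≤ n → d ≤ x.π (x.P s)) →
      (d = ⊤ ∨ ∃ s, x.nLU < s ∧ s ≤ n ∧ d = x.π (x.P s)) →
      Q { x with p := p, δs := d, time := T }) :
    vc (workCtx n m C pk) ω minRows Q x := by
  simp [minRows, minRowsLoop, forLoop]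
  let I : ℕ → Store → Prop := fun t y => ∃ d T, y = { x with p := t, δs := d, time := T } ∧
    T ≤ x.time + 30 * t ∧ x.nLU < t ∧ t ≤ n + 1 ∧ (∀ s, x.nLU < s → s < t → d ≤ x.π (x.P s)) ∧
    (d = ⊤ ∨ ∃ s, x.nLU < s ∧ s ≤ n ∧ d = x.π (x.P s))
  refine vc_loop_up hΓ n I ?_ (x.nLU + 1) ?_
  · rintro t _ ⟨d, T, rfl, hT, hlo, hhi, hle, hex⟩
    refine ⟨by simp, fun hcond => ?_, fun hcond => ?_⟩
    · simp at hcond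
      have hm := hP t (by omega) hcond
      refine ⟨hcond, ?_⟩
      simp
      refine ⟨⟨⟨by omega, hcond⟩, hm⟩, fun hlt => ⟨⟨⟨by omega, hcond⟩, hm⟩, ?_⟩, fun hge => ?_⟩
      · refine ⟨_, _, rfl, by omega, by omega, by omega, fun s h1 h2 => ?_,
          Or.inr ⟨t, hlo, hcond, rfl⟩⟩
        rcases Nat.lt_or_ge s t with h3 | h3
        · exact hlt.le.trans (hle s h1 h3)
        · obtain rfl : s = t := by omega
          exact le_rfl
      · refine ⟨_, _, rfl, by omega, by omega, by omega, fun s h1 h2 => ?_, hex⟩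
        rcases Nat.lt_or_ge s t with h3 | h3
        · exact hle s h1 h3
        · obtain rfl : s = t := by omega
          exact hge
    · simp at hcond
      simp
      exact hQ _ _ _ (by omega) (fun s h1 h2 => hle s h1 (by omega)) hex
  · exact ⟨_, _, rfl, by omega, by omega, by omega, fun s h1 h2 => by omega, Or.inl rfl⟩

theorem vc_minNull (hΓ : (workCtx n m C pk).space ≤ pk)
    (hS : ∀ t, 1 ≤ t → t ≤ x.nSV → 1 ≤ x.SV t ∧ x.SV t ≤ m) (hn : x.nSV ≤ n + 1)
    (hm : x.nSV ≤ m) (hpos : 1 ≤ x.nSV) (hv : ∀ j, 1 ≤ j → j ≤ m + 1 → x.v j = (v j : ℝ))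
    (hQ : ∀ p q r e T, T ≤ x.time + 50 * (n + 3) → 1 ≤ r → r ≤ x.nSV →
      e = C (n + 1) (x.SV r) - v (x.SV r) →
      (∀ s, 1 ≤ s → s ≤ x.nSV → e ≤ C (n + 1) (x.SV s) - v (x.SV s)) →
      Q { x with p := p, q := q, l := x.SV r, δε := (e : ℝ), time := T }) :
    vc (workCtx n m C pk) ω minNull Q x := by
  simp [minNull, minNullLoop, forLoop]
  let I : ℕ → Store → Prop := fun t y => ∃ q l d T,
    y = { x with p := t, q := q, l := l, δε := d, time := T } ∧
    T ≤ x.time + 50 * t ∧ 1 ≤ t ∧ t ≤ x.nSV + 1 ∧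
    (∀ s, 1 ≤ s → s < t → d ≤ ((C (n + 1) (x.SV s) - v (x.SV s) : ℝ) : EReal)) ∧
    ((t = 1 ∧ d = ⊤) ∨ ∃ r, 1 ≤ r ∧ r ≤ x.nSV ∧ l = x.SV r ∧
      d = ((C (n + 1) (x.SV r) - v (x.SV r) : ℝ) : EReal))
  refine vc_loop_up hΓ x.nSV I ?_ 1 ?_
  · rintro t _ ⟨q, l, d, T, rfl, hT, hlo, hhi, hle, hex⟩
    refine ⟨by simp, fun hcond => ?_, fun hcond => ?_⟩
    · simp at hcond
      have hSt := hS t (by omega) hcond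
      refine ⟨hcond, ?_⟩
      have hw : (C (n + 1) (x.SV t) : EReal) - x.v (x.SV t)
          = ((C (n + 1) (x.SV t) - v (x.SV t) : ℝ) : EReal) := by
        rw [hv _ hSt.1 (by omega)]; norm_cast
      simp [hw, -EReal.coe_sub]
      refine ⟨by omega, ⟨by omega, by omega⟩,
        fun hlt => ⟨⟨by omega, by omega⟩, ?_⟩, fun hge => ?_⟩
      · refine ⟨_, _, _, _, rfl, by omega, by omega, by omega, fun s h1 h2 => ?_,
          Or.inr ⟨t, hlo, hcond, rfl, rfl⟩⟩
        rcases Nat.lt_or_ge s t with h3 | h3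
        · exact hlt.le.trans (hle s h1 h3)
        · obtain rfl : s = t := by omega
          exact le_rfl
      · refine ⟨_, _, _, _, rfl, by omega, by omega, by omega, fun s h1 h2 => ?_, ?_⟩
        · rcases Nat.lt_or_ge s t with h3 | h3
          · exact hle s h1 h3
          · obtain rfl : s = t := by omega
            exact hge
        · rcases hex with ⟨-, rfl⟩ | h
          · exact absurd hge (not_le.2 (EReal.coe_lt_top _))
          · exact Or.inr h
    · simp at hcond
      simp
      rcases hex with ⟨rfl, -⟩ | ⟨r, h1, h2, rfl, rfl⟩
      · omega
      · exact hQ _ _ r _ _ (by omega) h1 h2 rfl fun s h3 h4 => by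
          exact_mod_cast hle s h3 (by omega)
  · exact ⟨_, _, _, _, rfl, by omega, by omega, by omega, fun s h1 h2 => by omega,
      Or.inl ⟨rfl, rfl⟩⟩

theorem vc_raiseCols (hΓ : (workCtx n m C pk).space ≤ pk) {d : ℝ} (hδ : x.δ = d)
    (hS : ∀ t, 1 ≤ t → t ≤ x.nSV → 1 ≤ x.SV t ∧ x.SV t ≤ m)
    (hinj : ∀ s t, 1 ≤ s → s < t → t ≤ x.nSV → x.SV s ≠ x.SV t) (hn : x.nSV ≤ n + 1)
    (hm : x.nSV ≤ m) (hv : ∀ j, 1 ≤ j → j ≤ m + 1 → x.v j = (v j : ℝ))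
    (hQ : ∀ p q, ∀ V : ℕ → EReal, ∀ T, T ≤ x.time + 30 * (n + 3) →
      (∀ j, 1 ≤ j → j ≤ m + 1 → V j = (shift v x.SV x.nSV d j : ℝ)) →
      Q { x with p := p, q := q, v := V, time := T }) :
    vc (workCtx n m C pk) ω raiseCols Q x := by
  simp [raiseCols, forLoop]
  let I : ℕ → Store → Prop := fun t y => ∃ q, ∃ V : ℕ → EReal, ∃ T,
    y = { x with p := t, q := q, v := V, time := T } ∧
    T ≤ x.time + 30 * t ∧ 1 ≤ t ∧ t ≤ x.nSV + 1 ∧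
    (∀ j, 1 ≤ j → j ≤ m + 1 → V j = (shift v x.SV (t - 1) d j : ℝ))
  refine vc_loop_up hΓ x.nSV I ?_ 1 ?_
  · rintro t _ ⟨q, V, T, rfl, hT, hlo, hhi, hV⟩
    refine ⟨by simp, fun hcond => ?_, fun hcond => ?_⟩
    · simp at hcond
      have hSt := hS t (by omega) hcond
      refine ⟨hcond, ?_⟩
      simp
      refine ⟨by omega, ⟨by omega, by omega⟩, _, _, _, rfl, by omega, by omega, by omega,
        fun j h1 h2 => ?_⟩
      have hi : ∀ s, 1 ≤ s → s < t → x.SV s ≠ x.SV t := fun s h1 h2 => hinj s t h1 h2 hcond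
      rw [Nat.add_sub_cancel, shift_step hlo hi, Function.update_apply]
      split_ifs with h
      · subst h
        rw [hV _ h1 h2, shift_of_not_mem fun s h3 h4 => hi s h3 (by omega), hδ]
        norm_cast
      · exact hV j h1 h2
    · simp at hcond
      simp
      refine hQ _ _ _ _ (by omega) ?_
      obtain rfl : t = x.nSV + 1 := by omega
      simpa using hV
  · exact ⟨_, _, _, rfl, by omega, by omega, by omega, by simpa [shift_zero] using hv⟩

theorem vc_lowerRows (hΓ : (workCtx n m C pk).space ≤ pk) {d : ℝ} (hδ : x.δ = d)
    (hP : ∀ t, 1 ≤ t → t ≤ x.nLU → 1 ≤ x.P t ∧ x.P t ≤ n)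
    (hinj : ∀ s t, 1 ≤ s → s < t → t ≤ x.nLU → x.P s ≠ x.P t) (hn : x.nLU ≤ n)
    (hu : ∀ i, 1 ≤ i → i ≤ n + 1 → x.u i = (u i : ℝ))
    (hQ : ∀ p q, ∀ U : ℕ → EReal, ∀ T, T ≤ x.time + 30 * (n + 3) →
      (∀ i, 1 ≤ i → i ≤ n + 1 → U i = (shift u x.P x.nLU (-d) i : ℝ)) →
      Q { x with p := p, q := q, u := U, time := T }) :
    vc (workCtx n m C pk) ω lowerRows Q x := by
  simp [lowerRows, forLoop]
  let I : ℕ → Store → Prop := fun t y => ∃ q, ∃ U : ℕ → EReal, ∃ T,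
    y = { x with p := t, q := q, u := U, time := T } ∧
    T ≤ x.time + 30 * t ∧ 1 ≤ t ∧ t ≤ x.nLU + 1 ∧
    (∀ i, 1 ≤ i → i ≤ n + 1 → U i = (shift u x.P (t - 1) (-d) i : ℝ))
  refine vc_loop_up hΓ x.nLU I ?_ 1 ?_
  · rintro t _ ⟨q, U, T, rfl, hT, hlo, hhi, hU⟩
    refine ⟨by simp, fun hcond => ?_, fun hcond => ?_⟩
    · simp at hcond
      have hPt := hP t (by omega) hcond
      refine ⟨hcond, ?_⟩
      simp
      refine ⟨by omega, ⟨by omega, by omega⟩, _, _, _, rfl, by omega, by omega, by omega,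
        fun i h1 h2 => ?_⟩
      have hi : ∀ s, 1 ≤ s → s < t → x.P s ≠ x.P t := fun s h1 h2 => hinj s t h1 h2 hcond
      rw [Nat.add_sub_cancel, shift_step hlo hi, Function.update_apply]
      split_ifs with h
      · subst h
        rw [hU _ h1 h2, shift_of_not_mem fun s h3 h4 => hi s h3 (by omega), hδ,
          ← sub_eq_add_neg]
        norm_cast
      · exact hU i h1 h2
    · simp at hcond
      simp
      refine hQ _ _ _ _ (by omega) ?_
      obtain rfl : t = x.nLU + 1 := by omega
      simpa using hU
  · exact ⟨_, _, _, rfl, by omega, by omega, by omega, by simpa [shift_zero] using hu⟩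

/-- After a dual update by `d`, some row outside of the tree has reduced cost `0`, so a row joins the
tree or a sink is found. -/
theorem vc_scanRows (hΓ : (workCtx n m C pk).space ≤ pk) (hc : Core n m C u v x)
    (hf : x.found = 0) {d : ℝ} (hδ : x.δ = d)
    (hr : ∀ s, x.nLU < s → s ≤ n →
      Reach C u v x.SV x.nSV (x.P s) (x.pred (x.P s)) (x.π (x.P s) - (d : ℝ)))
    (hd : ∃ s, x.nLU < s ∧ s ≤ n ∧ x.π (x.P s) = (d : ℝ)) :
    vc (workCtx n m C pk) ω scanRows (Grown n m C u v x (x.nLU + 1) (100 * (n + 2))) x := by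
  have hb := hc.tree.b_le
  simp [scanRows]
  refine vc_loop_up hΓ n (RowInv n m C u v x (x.nLU + 1)
    (fun i pr y => y = x.π i ∧ Reach C u v x.SV x.nSV i pr (y - (d : ℝ)))
    (fun i => x.π i = (d : ℝ))) ?_ (x.nLU + 1) ?_
  · intro t y hy
    refine ⟨by simp, fun hcond => ?_, fun hcond => hy.grown (by simpa using hcond) _ (by simp; omega)⟩
    simp at hcond
    obtain ⟨hpn, hf0⟩ := hcond
    have hpt := hy.p_eq
    have hcy := hy.core
    have hF := hy.frame
    have htime := hy.time_le
    have hlo := hy.lo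
    have hmono := hy.mono
    refine ⟨by omega, ?_⟩
    have hm := hcy.tree.mem t (by omega) (by omega)
    obtain ⟨-, hdone, htodo, hprog⟩ | ⟨h1, -⟩ := hy.status
    swap
    · omega
    obtain ⟨hπ, hR⟩ := htodo t le_rfl (by omega)
    simp [hpt, hF.δ, hδ]
    refine ⟨by omega, hm, ?_⟩
    have hne' : ∀ s, 1 ≤ s → s ≤ n → s ≠ t → y.P s ≠ y.P t := fun s h1 h2 h3 e =>
      h3 (hcy.tree.inj s t h1 h2 (by omega) (by omega) e)
    refine vc_joinRow ⟨hcy.slack, hcy.tree, hcy.hu, hcy.hv⟩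
      ⟨hF.1, hF.2, hF.3, hF.4, hF.5, hF.6, hF.7, by simp only; exact hδ.symm⟩ hf0 rfl rfl hlo hmono
      (by omega) ?_ ?_ ?_ ?_ (by simp only; omega)
    · intro s h1 h2
      have := hdone s h1 h2
      have e := hne' s (by omega) (by omega) (by omega)
      unfold Ready at this ⊢
      simp only [Function.update_of_ne e]
      exact this
    · intro s h1 h2
      have := htodo s (by omega) h2
      have e := hne' s (by omega) h2 (by omega)
      simp only [Function.update_of_ne e]
      exact this
    · simp only [Function.update_self]
      rw [hF.SV, hF.nSV]
      exact hR
    · rcases hprog with h | ⟨s, h1, h2, h3⟩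
      · exact Or.inl h
      · rcases Nat.lt_or_ge t s with h4 | h4
        · exact Or.inr (Or.inr ⟨s, h4, h2, h3⟩)
        · obtain rfl : s = t := by omega
          refine Or.inr (Or.inl ?_)
          simp only [Function.update_self]
          rw [hπ, h3, ← EReal.coe_sub, sub_self, EReal.coe_zero]
  · obtain ⟨s, h1, h2, h3⟩ := hd
    exact ⟨⟨hc.slack, hc.tree, hc.hu, hc.hv⟩, ⟨rfl, rfl, rfl, rfl, rfl, rfl, rfl, rfl⟩, rfl,
      by simp only; omega, by omega, by simp only; omega, by simp only; omega,
      Or.inl ⟨hf, fun s h1 h2 => by simp only at h1; omega,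
        fun s h1 h2 => ⟨rfl, hr s (by omega) h2⟩, Or.inr ⟨s, by omega, h2, h3⟩⟩⟩

end
end LSAPE

namespace LSAPE
open NVar RVar

/-! ### The search for an augmenting path -/

/-- The names under which the columns are assigned. -/
def colRoles : Roles := ⟨n, m, .ρ, .ϱ, .u, .v, fun e f => .mat e f⟩

/-- The names under which the rows are assigned. -/
def rowRoles : Roles := ⟨m, n, .ϱ, .ρ, .v, .u, fun e f => .mat f e⟩

/-- The tree is extended by an arbitrary row, unless a sink has been found. -/
def extend : Stmt :=
  ifThen (.eqN (N found) 0) (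
    .choose q (N nSU + 1) (N nLU) ;;
    .setN nSU (N nSU + 1) ;;
    swapP (N q) (N nSU) ;;
    .setN i (NArr.P.at (N nSU)) ;;
    .setN j (NArr.ρ.at (N i)))

/-- One round of the search. -/
def round : Stmt :=
  .setN nSV (N nSV + 1) ;;
  .putN .SV (N nSV) (N j) ;;
  .cond (.and (.leN (NArr.ϱ.at (N j)) (N n))
      (.eqR (.mat (N n + 1) (N j) - RArr.v.at (N j)) .zero))
    (.setN si (N n + 1) ;; .setN sj (N j) ;; .setN found 1)
    (.setN p (N nLU + 1) ;; scanColumnLoop ;;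
      ifThen (.and (.eqN (N found) 0) (.eqN (N nLU) (N nSU))) dualStep ;; extend)

/-- The initialization of the search. -/
def initSearch : Stmt :=
  forLoop p 1 (N n) (.putR .π (N p) .infty ;; .putN .P (N p) (N p))

theorem augment_colRoles : augment colRoles =
    (initSearch ;; .setN nSU 0 ;; .setN nLU 0 ;; .setN nSV 0 ;; .setN found 0 ;;
      .setN j (N k) ;; .loop (.eqN (N found) 0) round) := rfl

/-- The state of the search, at the end of a round but for the choice of the next column: either
some row of the tree is not expanded, or a sink has been found. -/
structure Searched (n m : ℕ) (C : ℕ → ℕ → ℝ) (x₀ : Store) (T : ℕ) (u v : ℕ → ℝ)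
    (y : Store) : Prop where
  core : Core n m C u v y
  ρ : y.ρ = x₀.ρ
  ϱ : y.ϱ = x₀.ϱ
  k : y.k = x₀.k
  nSU : y.nSU = x₀.nSU
  nSV : y.nSV = x₀.nSV
  time_le : y.time ≤ x₀.time + T
  status : (y.found = 0 ∧ (∀ s, y.nLU < s → s ≤ n → Ready C u v y s) ∧ y.nSU < y.nLU) ∨
    (y.found = 1 ∧ Sink n m C y.ρ u v y.SV y.pred y.nSV y.si y.sj)

/-- The invariant of the search, at the beginning of the round in which the column `j` is the
`t + 1`-st column of the tree, or at the end, when `t` is the number of columns. -/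
structure Head (n m : ℕ) (C : ℕ → ℕ → ℝ) (x₀ : Store) (t : ℕ) (u v : ℕ → ℝ)
    (y : Store) : Prop where
  ρ : y.ρ = x₀.ρ
  ϱ : y.ϱ = x₀.ϱ
  k : y.k = x₀.k
  nSV : y.nSV = t
  time_le : y.time ≤ x₀.time + 1000 * (n + 3) * t
  status :
    (y.found = 0 ∧ y.nSU = t ∧
      Core n m C u v { y with SV := Function.update y.SV (t + 1) y.j } ∧
      ∀ s, y.nLU < s → s ≤ n → Waits C u v (Function.update y.SV (t + 1) y.j) t (y.P s)
        (y.pred (y.P s)) (y.π (y.P s))) ∨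
    (y.found = 1 ∧ t = y.nSU + 1 ∧ Core n m C u v y ∧
      Sink n m C y.ρ u v y.SV y.pred y.nSV y.si y.sj)

/-- The outcome of the search: a tree with an augmenting path. -/
structure Augmented (n m : ℕ) (C : ℕ → ℕ → ℝ) (x₀ : Store) (u v : ℕ → ℝ) (y : Store) : Prop where
  core : Core n m C u v y
  ρ : y.ρ = x₀.ρ
  ϱ : y.ϱ = x₀.ϱ
  k : y.k = x₀.k
  nSV : y.nSV = y.nSU + 1
  time_le : y.time ≤ x₀.time + 1000 * (n + 3) * (y.nSV + 1)
  sink : Sink n m C y.ρ u v y.SV y.pred y.nSV y.si y.sj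

theorem Reach.congr {C : ℕ → ℕ → ℝ} {u v : ℕ → ℝ} {SV SV' : ℕ → ℕ} {c i pr : ℕ} {y : EReal}
    (h : Reach C u v SV c i pr y) (hS : ∀ s, s ≤ c → SV' s = SV s) :
    Reach C u v SV' c i pr y := by
  refine ⟨fun s h1 h2 => ?_, ?_⟩
  · rw [hS s h2]; exact h.1 s h1 h2
  · rcases h.2 with h | ⟨s, h1, h2, h3⟩
    · exact Or.inl h
    · exact Or.inr ⟨s, h1, h2, by rw [hS s h2]; exact h3⟩

section
variable {n m : ℕ} {C : ℕ → ℕ → ℝ} {pk : ℕ} {ω : ℕ → ℕ} {u v : ℕ → ℝ} {x : Store}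
  {Q : Store → Prop}

/-- The dual update, in a state in which all the rows of the tree are expanded.  If the null row is
at least as near as the others, it is the sink; otherwise some row becomes tight. -/
theorem vc_dualStep (hΓ : (workCtx n m C pk).space ≤ pk) (hc : Core n m C u v x)
    (hf : x.found = 0) (hL : x.nLU = x.nSU) (hV : x.nSV = x.nSU + 1)
    (hr : ∀ s, x.nLU < s → s ≤ n → Ready C u v x s) :
    vc (workCtx n m C pk) ω dualStep
      (fun y => ∃ u v, Searched n m C x (300 * (n + 3)) u v y) x := by
  change vc (workCtx n m C pk) ω (minRows ;; minNull ;;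
    .cond (.leR (X δs) (X δε)) (.setR δ (X δs)) (.setR δ (X δε)) ;;
    raiseCols ;; lowerRows ;;
    .cond (.leR (X δε) (X δs)) (.setN si (N .n + 1) ;; .setN sj (N l) ;; .setN found 1)
      scanRows) _ x
  have ht := hc.tree
  have hs := hc.slack
  have hLn := ht.b_le
  have hmem := ht.mem
  have hSV : ∀ t, 1 ≤ t → t ≤ x.nSV → 1 ≤ x.SV t ∧ x.SV t ≤ m := fun t h1 h2 =>
    ht.SV_mem h1 (by omega)
  have hcols := ht.lt_cols hs
  have hTree : Tree n m C x.ρ x.ϱ x.k u v x.P x.SV x.pred x.nSU x.nSU (x.nSU + 1) := by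
    rw [hL, hV] at ht; exact ht
  simp only [vc_seq]
  refine vc_minRows hΓ hmem hLn fun p₁ ds T₁ hT₁ hds hdsex => ?_
  refine vc_minNull (v := v) hΓ hSV (by simp only; omega) (by simp only; omega)
    (by simp only; omega) hc.hv fun p₂ q₂ r e T₂ hT₂ hr1 hr2 he hemin => ?_
  simp only at hT₂ hr2 hemin
  -- The step length `δ` is a non-negative real number.
  obtain ⟨d, hd, hd0, hdε, hds'⟩ : ∃ d : ℝ, min ds (e : EReal) = (d : EReal) ∧ 0 ≤ d ∧
      d ≤ e ∧ (d : EReal) ≤ ds := by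
    have he0 : 0 ≤ e := by
      have := hs.le (i := n + 1) (j := x.SV r) (by omega) le_rfl (hSV r hr1 hr2).1
        (by have := hSV r hr1 hr2; omega)
      rw [hs.feas.1] at this
      rw [he]; linarith
    rcases le_or_gt (e : EReal) ds with h | h
    · exact ⟨e, min_eq_right h, he0, le_rfl, h⟩
    · rcases hdsex with rfl | ⟨s, h1, h2, h3⟩
      · exact absurd h (not_lt.2 le_top)
      · rcases (hr s h1 h2).1.2 with h4 | ⟨s', h5, h6, h7, h8⟩
        · rw [h3, h4] at h; exact absurd h (not_lt.2 le_top)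
        · refine ⟨C (x.P s) (x.SV s') - u (x.P s) - v (x.SV s'), ?_, ?_, ?_, ?_⟩
          · rw [← h8, ← h3]; exact min_eq_left h.le
          · have hm1 := hmem s (by omega) h2
            have hm2 := hSV s' h5 h6
            have := hs.le (i := x.P s) (j := x.SV s') (by omega) (by omega) (by omega) (by omega)
            linarith
          · rw [h3, h8] at h; exact_mod_cast h.le
          · rw [h3, h8]
  obtain ⟨hs', hT'⟩ := hs.dual_update hTree hd0
    (fun s h1 h2 => hdε.trans (hemin s h1 (by omega)))
    (fun t h1 h2 s h3 h4 => by
      have h5 := (hds t (by omega) h2).trans ((hr t (by omega) h2).1.1 s h3 (by omega))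
      exact_mod_cast hds'.trans h5)
  have hnull : shift u x.P x.nSU (-d) (n + 1) = u (n + 1) := by
    rw [hs'.feas.1, hs.feas.1]
  -- The rest of the program behaves alike after both branches of the computation of `δ`.
  have main : ∀ T₃, T₃ ≤ x.time + 90 * (n + 3) → vc (workCtx n m C pk) ω raiseCols
      (vc (workCtx n m C pk) ω lowerRows (vc (workCtx n m C pk) ω
        (.cond (.leR (X δε) (X δs)) (.setN si (N .n + 1) ;; .setN sj (N l) ;; .setN found 1)
          scanRows) (fun y => ∃ u v, Searched n m C x (300 * (n + 3)) u v y)))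
      { x with p := p₂, δs := ds, q := q₂, l := x.SV r, δε := e, δ := d, time := T₃ } := by
    intro T₃ hT₃
    refine vc_raiseCols (v := v) (d := d) hΓ rfl hSV ?_ (by simp only; omega) (by simp only; omega)
      hc.hv fun p₄ q₄ V T₄ hT₄ hV' => ?_
    · intro s t h1 h2 h3 e
      simp only at h3
      have := ht.SV_inj hs h1 (by omega) (by omega) (by omega) e
      omega
    refine vc_lowerRows (u := u) (d := d) hΓ rfl (fun t h1 h2 => hmem t h1 (by simp only at h2; omega))
      ?_ hLn hc.hu fun p₅ q₅ U T₅ hT₅ hU => ?_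
    · intro s t h1 h2 h3 e
      simp only at h3
      have := ht.inj s t h1 (by omega) (by omega) (by omega) e
      omega
    simp only at hV' hU hT₄ hT₅
    rw [hV] at hV'
    rw [hL] at hU
    simp
    refine ⟨fun hle => ?_, fun hlt => ?_⟩
    · have hde : d = e := by
        rw [min_eq_right hle] at hd; exact_mod_cast hd.symm
      refine ⟨shift u x.P x.nSU (-d), shift v x.SV (x.nSU + 1) d,
        ⟨hs', by simp only [hL, hV]; exact hT', hU, hV'⟩, rfl, rfl, rfl, rfl, rfl,
        by simp only; omega, Or.inr ⟨rfl, Or.inl ⟨rfl, r, hr1, hr2, rfl, ?_⟩⟩⟩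
      rw [hnull, hs.feas.1, shift_of_mem hr1 (by omega), hde, he]
      ring
    · have hdds : ds = (d : EReal) := by rw [min_eq_left hlt.le] at hd; exact hd
      refine vc_mono (vc_scanRows (u := shift u x.P x.nSU (-d))
        (v := shift v x.SV (x.nSU + 1) d) (d := d) hΓ
        ⟨hs', by simp only [hL, hV]; exact hT', hU, hV'⟩ hf rfl ?_ ?_) ?_
      · intro s h1 h2
        simp only at h1 ⊢
        have hR := (hr s h1 h2).1
        have hshift : ∀ s', 1 ≤ s' → s' ≤ x.nSV →
            ((C (x.P s) (x.SV s') - shift u x.P x.nSU (-d) (x.P s)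
              - shift v x.SV (x.nSU + 1) d (x.SV s') : ℝ) : EReal)
            = ((C (x.P s) (x.SV s') - u (x.P s) - v (x.SV s') : ℝ) : EReal) - (d : ℝ) := by
          intro s' h3 h4
          rw [hTree.shift_eq (by omega) h2, shift_of_mem h3 (by omega), ← EReal.coe_sub]
          congr 1; ring
        refine ⟨fun s' h3 h4 => ?_, ?_⟩
        · rw [hshift s' h3 h4]
          exact EReal.sub_le_sub (hR.1 s' h3 h4) le_rfl
        · rcases hR.2 with h3 | ⟨s', h3, h4, h5, h6⟩
          · exact Or.inl (by rw [h3, EReal.top_sub_coe])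
          · exact Or.inr ⟨s', h3, h4, h5, by rw [hshift s' h3 h4, h6]⟩
      · rcases hdsex with h | ⟨s, h1, h2, h3⟩
        · rw [h] at hdds; exact absurd hdds.symm (EReal.coe_ne_top d)
        · exact ⟨s, h1, h2, by rw [← hdds, h3]⟩
      · intro y hy
        have hF := hy.frame
        have htime := hy.time_le
        simp only at htime
        refine ⟨_, _, hy.core, hF.ρ, hF.ϱ, hF.k, hF.nSU, hF.nSV, by omega, ?_⟩
        rcases hy.status with ⟨h1, h2, h3⟩ | h
        · refine Or.inl ⟨h1, h2, ?_⟩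
          have := hF.nSU
          simp only at this h3
          omega
        · exact Or.inr h
  simp
  refine ⟨fun hle => ?_, fun hlt => ?_⟩
  · rw [min_eq_left hle] at hd
    rw [hd] at main ⊢
    exact main _ (by omega)
  · rw [min_eq_right hlt.le] at hd
    have := main (T₂ + 4 + 2) (by omega)
    rw [← hd] at this
    exact this

/-- The expansion of any row of the tree starts a new round. -/
theorem vc_extend {x₀ : Store} {T t : ℕ} (hy : Searched n m C x₀ T u v x) (hV : x.nSV = x.nSU + 1)
    (ht : x.nSV = t) {x₁ : Store} (hρ : x₀.ρ = x₁.ρ) (hϱ : x₀.ϱ = x₁.ϱ) (hk : x₀.k = x₁.k)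
    (hT : x₀.time + T + 50 ≤ x₁.time + 1000 * (n + 3) * t) :
    vc (workCtx n m C pk) ω extend (fun y => ∃ u v, Head n m C x₁ t u v y) x := by
  have htime := hy.time_le
  have htree := hy.core.tree
  have hb := htree.b_le
  simp [extend, swapP]
  rcases hy.status with ⟨hf, hready, hlt⟩ | ⟨hf, hsink⟩
  · refine ⟨fun _ => ⟨by omega, fun q hq1 hq2 => ?_⟩, fun h => absurd hf h⟩
    have hq : 1 ≤ x.P q ∧ x.P q ≤ n := htree.mem q (by omega) (by omega)
    rw [hV] at htree
    have hexp := htree.expand (q := q) (by omega) hq2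
    have hup : swapAt x.P q (x.nSU + 1) (x.nSU + 1) = x.P q := by
      rw [swapAt_apply, if_pos rfl]
    rw [hup] at hexp
    have htt : t = x.nSU + 1 := by omega
    subst htt
    refine ⟨by omega, ⟨by omega, by omega, by omega⟩, by omega, hq, u, v,
      hy.ρ.trans hρ, hy.ϱ.trans hϱ, hy.k.trans hk, hV, by simp only; omega,
      Or.inl ⟨hf, rfl, ⟨hy.core.slack, ?_, hy.core.hu, hy.core.hv⟩, fun s h1 h2 => ?_⟩⟩
    · simp only [hV]; exact hexp
    · simp only at h1 ⊢
      have e : swapAt x.P q (x.nSU + 1) s = x.P s := by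
        rw [swapAt_apply, if_neg (by omega), if_neg (by omega)]
      have := hready s h1 h2
      change Waits C u v _ _ (swapAt x.P q (x.nSU + 1) s)
        (x.pred (swapAt x.P q (x.nSU + 1) s)) (x.π (swapAt x.P q (x.nSU + 1) s))
      rw [e]
      refine ⟨?_, this.2⟩
      have h3 := this.1
      rw [hV] at h3
      exact h3.congr fun s' h4 => Function.update_of_ne (by omega) _ _
  · refine ⟨fun h => by omega, fun h => ⟨u, v, hy.ρ.trans hρ, hy.ϱ.trans hϱ, hy.k.trans hk, ht,
      by simp only; omega, Or.inr ⟨hf, by simp only; omega, ?_, hsink⟩⟩⟩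
    exact ⟨hy.core.slack, hy.core.tree, hy.core.hu, hy.core.hv⟩

end
end LSAPE

namespace LSAPE
open NVar RVar

section
variable {n m : ℕ} {C : ℕ → ℕ → ℝ} {pk : ℕ} {ω : ℕ → ℕ} {u v : ℕ → ℝ} {x : Store}
  {Q : Store → Prop}

/-- A round consists of boundedly many loops over the rows or over the columns of the tree, of which
there are at most `n + 1`; hence the bound `1000 * (n + 3)` for its time, with a generous constant. -/
theorem vc_round (hΓ : (workCtx n m C pk).space ≤ pk) {x₀ : Store} {t : ℕ}
    (h : Head n m C x₀ t u v x) (hf : x.found = 0) :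
    vc (workCtx n m C pk) ω round (fun y => ∃ u v, Head n m C x₀ (t + 1) u v y) (x.tick 4) := by
  obtain ⟨-, hU, hc, hw⟩ | ⟨h1, -⟩ := h.status
  swap
  · omega
  have htime := h.time_le
  have hsucc : 1000 * (n + 3) * (t + 1) = 1000 * (n + 3) * t + 1000 * (n + 3) := by ring
  have hV := h.nSV
  have hcols := hc.tree.lt_cols hc.slack
  simp only [hU] at hcols
  have hj := hc.tree.SV_mem (s := t + 1) (by omega) (by simp only; omega)
  simp only [Function.update_self] at hj
  have hc1 : ∀ (p₁ q₁ s₁ s₂ f₁ T₁ : ℕ), Core n m C u v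
      { x with
        SV := Function.update x.SV (t + 1) x.j, nSV := t + 1, p := p₁, q := q₁, si := s₁,
        sj := s₂, found := f₁, time := T₁ } :=
    fun _ _ _ _ _ _ => ⟨hc.slack, by
      have h1 := hc.tree
      simp only [hV] at h1
      exact h1.mono (Nat.le_succ t), hc.hu, hc.hv⟩
  have hred : (C (n + 1) x.j : EReal) - x.v x.j = ((C (n + 1) x.j - v x.j : ℝ) : EReal) := by
    have := hc.hv x.j hj.1 (by omega)
    simp only at this
    rw [this]; norm_cast
  change vc (workCtx n m C pk) ω (
    .setN nSV (N nSV + 1) ;;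
    .putN .SV (N nSV) (N j) ;;
    .cond (.and (.leN (NArr.ϱ.at (N j)) (N .n))
        (.eqR (.mat (N .n + 1) (N j) - RArr.v.at (N j)) .zero))
      (.setN si (N .n + 1) ;; .setN sj (N j) ;; .setN found 1)
      (scanColumn ;;
        ifThen (.and (.eqN (N found) 0) (.eqN (N nLU) (N nSU))) dualStep ;; extend)) _ _
  simp [hV, hred, -EReal.coe_sub]
  refine ⟨by omega, by omega, fun _ h0 => ?_, fun _ => ?_⟩
  · refine ⟨u, v, h.ρ, h.ϱ, h.k, rfl, by simp only; omega,
      Or.inr ⟨rfl, by simp only; omega, hc1 _ _ _ _ _ _, Or.inl ⟨rfl, t + 1, by omega, le_rfl,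
        by simp only [Function.update_self], ?_⟩⟩⟩
    have h0' : C (n + 1) x.j - v x.j = 0 := by exact_mod_cast h0
    rw [hc.slack.feas.1]
    simp only
    linarith
  · refine vc_mono (vc_scanColumn hΓ (hc1 _ _ _ _ _ _) hf (by simp only; omega)
      (by simp only [Function.update_self]) (fun s h1 h2 => by
        have := hw s h1 h2
        simp only [hU]
        exact this)) fun y hy => ?_
    have hF := hy.frame
    have hyt := hy.time_le
    simp only at hyt
    have hyV : y.nSV = y.nSU + 1 := by
      have h1 := hF.nSU
      have h2 := hF.nSV
      simp only at h1 h2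
      omega
    have hyV' : y.nSV = t + 1 := hF.nSV
    simp
    refine ⟨fun hyf hyL => ?_, fun hne => ?_⟩
    · have hcy := hy.core
      have hready : ∀ s, y.nLU < s → s ≤ n → Ready C u v y s := by
        rcases hy.status with h | h
        · exact h.2.1
        · omega
      refine vc_mono (vc_dualStep hΓ ⟨hcy.slack, hcy.tree, hcy.hu, hcy.hv⟩ hyf hyL hyV hready)
        fun z ⟨u', v', hz⟩ => ?_
      refine vc_extend hz ?_ ?_ (hF.ρ.trans h.ρ) (hF.ϱ.trans h.ϱ) (hF.k.trans h.k)
        (by simp only; omega)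
      · rw [hz.nSV, hz.nSU]; exact hyV
      · rw [hz.nSV]; exact hyV'
    · have hcy := hy.core
      have hst : (y.found = 0 ∧ (∀ s, y.nLU < s → s ≤ n → Ready C u v y s) ∧ y.nSU < y.nLU) ∨
          (y.found = 1 ∧ Sink n m C y.ρ u v y.SV y.pred y.nSV y.si y.sj) := by
        rcases hy.status with ⟨h1, h2, -⟩ | h1
        · refine Or.inl ⟨h1, h2, ?_⟩
          have h3 := hcy.tree.a_le
          have h4 := hne h1
          omega
        · exact Or.inr h1
      have hS : ∀ T, Searched n m C y T u v { y with time := y.time + T } := fun T =>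
        ⟨⟨hcy.slack, hcy.tree, hcy.hu, hcy.hv⟩, rfl, rfl, rfl, rfl, rfl, le_rfl, hst⟩
      exact vc_extend (x₁ := x₀) (hS 8) hyV hyV' (hF.ρ.trans h.ρ) (hF.ϱ.trans h.ϱ)
        (hF.k.trans h.k) (by omega)

theorem vc_initSearch (hΓ : (workCtx n m C pk).space ≤ pk)
    (hQ : ∀ p P π T, T ≤ x.time + 30 * (n + 2) → (∀ t, 1 ≤ t → t ≤ n → P t = t) →
      (∀ t, 1 ≤ t → t ≤ n → π t = ⊤) → Q { x with p := p, P := P, π := π, time := T }) :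
    vc (workCtx n m C pk) ω initSearch Q x := by
  simp [initSearch, forLoop]
  let I : ℕ → Store → Prop := fun t y => ∃ P, ∃ π : ℕ → EReal, ∃ T,
    y = { x with p := t, P := P, π := π, time := T } ∧
    T ≤ x.time + 30 * t ∧ 1 ≤ t ∧ t ≤ n + 1 ∧ (∀ s, 1 ≤ s → s < t → P s = s) ∧
    (∀ s, 1 ≤ s → s < t → π s = ⊤)
  refine vc_loop_up hΓ n I ?_ 1 ?_
  · rintro t _ ⟨P, π, T, rfl, hT, hlo, hhi, hP, hπ⟩
    refine ⟨by simp, fun hcond => ?_, fun hcond => ?_⟩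
    · simp at hcond
      refine ⟨hcond, ?_⟩
      simp
      refine ⟨by omega, _, _, _, rfl, by omega, by omega, by omega, fun s h1 h2 => ?_,
        fun s h1 h2 => ?_⟩ <;>
      · rw [Function.update_apply]
        split_ifs with h
        · first | exact h.symm | rfl
        · first | exact hP s h1 (by omega) | exact hπ s h1 (by omega)
    · simp at hcond
      simp
      exact hQ _ _ _ _ (by omega) (fun s h1 h2 => hP s h1 (by omega))
        (fun s h1 h2 => hπ s h1 (by omega))
  · exact ⟨_, _, _, rfl, by omega, by omega, by omega, fun s h1 h2 => by omega,
      fun s h1 h2 => by omega⟩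

/-- The number of expanded rows increases in every round, so at most `n + 1` rounds take place. -/
theorem vc_augment (hΓ : (workCtx n m C pk).space ≤ pk) (hs : Slack n m C x.ρ x.ϱ u v)
    (hu : ∀ i, 1 ≤ i → i ≤ n + 1 → x.u i = (u i : ℝ))
    (hv : ∀ j, 1 ≤ j → j ≤ m + 1 → x.v j = (v j : ℝ))
    (hk : 1 ≤ x.k) (hk' : x.k ≤ m) (hfree : x.ϱ x.k = 0) :
    vc (workCtx n m C pk) ω (augment colRoles)
      (fun y => ∃ u v, Augmented n m C x u v y) x := by
  rw [augment_colRoles, vc_seq]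
  refine vc_initSearch hΓ fun p P π T hT hP hπ => ?_
  simp
  let I : ℕ → Store → Prop := fun t y => ∃ u v, Head n m C { x with time := x.time + 100 * (n + 2) }
    t u v y
  refine vc_loop_up hΓ n I ?_ 0 ?_
  · rintro t y ⟨u, v, h⟩
    refine ⟨by simp, fun hcond => ?_, fun hcond => ?_⟩
    · simp at hcond
      obtain ⟨-, h1, h2, -⟩ | ⟨h1, -⟩ := h.status
      · refine ⟨?_, vc_round hΓ h hcond⟩
        have h3 := h2.tree.a_le
        have h4 := h2.tree.b_le
        simp only at h3 h4
        omega
      · omega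
    · simp at hcond
      obtain ⟨h1, -⟩ | ⟨h1, h2, h3, h4⟩ := h.status
      · exact absurd h1 hcond
      · have htime := h.time_le
        simp only at htime
        have hV := h.nSV
        subst h2
        refine ⟨u, v, ⟨h3.slack, h3.tree, h3.hu, h3.hv⟩, h.ρ, h.ϱ, h.k, hV, ?_, h4⟩
        simp only [Store.tick, BExp.cost, NExp.cost]
        have : 1000 * (n + 3) * (y.nSV + 1) = 1000 * (n + 3) * (y.nSU + 1) + 1000 * (n + 3) := by
          rw [hV]; ring
        omega
  · have hup : ∀ s, s ≤ 0 → Function.update x.SV 1 x.k s = x.SV s := fun s h =>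
      Function.update_of_ne (by omega) _ _
    refine ⟨u, v, rfl, rfl, rfl, rfl, by simp only; omega, Or.inl ⟨rfl, rfl,
      ⟨hs, ?_, hu, hv⟩, fun s h1 h2 => ?_⟩⟩
    · refine ⟨hk, hk', hfree, fun t h1 h2 => ?_, fun s t h1 h2 h3 h4 e => ?_, le_rfl,
        Nat.zero_le n, ?_, fun t h1 h2 => ?_, fun t h1 h2 => ?_, fun t h1 h2 => ?_,
        fun t h1 h2 => ?_, fun t h1 h2 => ?_⟩
      · simp only [hP t h1 h2]; omega
      · simpa only [hP s h1 h2, hP t h3 h4] using e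
      · simp only [Nat.zero_add, Function.update_self]
      all_goals (simp only at h2; omega)
    · simp only at h1
      simp only [hP s h1 h2, hπ s h1 h2]
      exact ⟨⟨fun _ _ _ => by omega, Or.inl rfl⟩, EReal.top_ne_zero⟩

end
end LSAPE

namespace LSAPE
open NVar RVar

/-! ### Exchange along an augmenting path -/

/-- The exchange of assigned and unassigned pairs along the path that ends in `(si, sj)`. -/
def flipPath : Stmt :=
  .setN i (N si) ;;
  .setN j (N sj) ;;
  .cond (.eqN (N i) (N n + 1))
    (.setN r (NArr.ϱ.at (N j)) ;; .putN .ϱ (N j) (N i) ;; .setN i (N r))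
    (.setN j 0) ;;
  .loop (.not (.eqN (N j) (N k))) (
    .setN j (NArr.pred.at (N i)) ;;
    .putN .ρ (N i) (N j) ;;
    .setN r (NArr.ϱ.at (N j)) ;;
    .putN .ϱ (N j) (N i) ;;
    .setN i (N r))

/-- The assignment of the columns, after the allocation of the work space. -/
def colsLoop : Stmt :=
  forLoop k 1 (N m) (ifThen (.eqN (NArr.ϱ.at (N k)) 0) (.seq (augment colRoles) flipPath))

theorem assignCols_colRoles : assignCols colRoles =
    (.allocR .π (N n) .infty ;; .allocN .pred (N n) 0 ;; .allocN .P (N n) 0 ;;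
      .allocN .SV (N m) 0 ;; colsLoop) := rfl

/-- The invariant of the exchange: either it is complete, or the row `i` has lost its column and
hangs in the tree below one of the first `t` columns, whose assignment has not been touched. -/
structure Flipping (n m : ℕ) (C : ℕ → ℕ → ℝ) (u v : ℕ → ℝ) (y : Store) (ρ ϱ : ℕ → ℕ)
    (i j t : ℕ) : Prop where
  keepϱ : ∀ b, 1 ≤ b → b ≤ m → y.ϱ b ≠ 0 → ϱ b ≠ 0
  keepρ : ∀ a, 1 ≤ a → a ≤ n → y.ρ a ≠ 0 → ρ a ≠ 0
  status : (j = y.k ∧ Slack n m C ρ ϱ u v ∧ ϱ y.k ≠ 0) ∨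
    (j ≠ y.k ∧ (1 ≤ i ∧ i ≤ n) ∧ Slack n m C (Function.update ρ i 0) ϱ u v ∧
      (1 ≤ t ∧ t ≤ y.nSV) ∧
      (∃ s, 1 ≤ s ∧ s ≤ t ∧ y.pred i = y.SV s ∧ C i (y.SV s) = u i + v (y.SV s)) ∧
      ∀ s, 1 ≤ s → s ≤ t → ϱ (y.SV s) = y.ϱ (y.SV s))

section
variable {n m : ℕ} {C : ℕ → ℕ → ℝ} {pk : ℕ} {ω : ℕ → ℕ} {u v : ℕ → ℝ} {x y : Store}
  {Q : Store → Prop} {ρ ϱ : ℕ → ℕ}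

/-- One step of the exchange: the column `j = SV s` has been given a new row, and the former row of
`j` is next. -/
theorem Flipping.next (hc : Core n m C u v y) (hV : y.nSV = y.nSU + 1) {s : ℕ} (hs1 : 1 ≤ s)
    (hs2 : s ≤ y.nSV)
    (hS : Slack n m C (Function.update ρ (y.ϱ (y.SV s)) 0) ϱ u v)
    (hnew : ϱ (y.SV s) ≠ 0)
    (hϱ : ∀ b, 1 ≤ b → b ≤ m → y.ϱ b ≠ 0 → ϱ b ≠ 0)
    (hρ : ∀ a, 1 ≤ a → a ≤ n → y.ρ a ≠ 0 → ρ a ≠ 0)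
    (hold : ∀ s', 1 ≤ s' → s' < s → ϱ (y.SV s') = y.ϱ (y.SV s')) :
    Flipping n m C u v y ρ ϱ (y.ϱ (y.SV s)) (y.SV s) (s - 1) := by
  have ht := hc.tree
  refine ⟨hϱ, hρ, ?_⟩
  obtain ⟨t, rfl⟩ : ∃ t, s = t + 1 := ⟨s - 1, by omega⟩
  rcases Nat.eq_zero_or_pos t with rfl | h0
  · have hroot : y.SV (0 + 1) = y.k := ht.root
    rw [hroot, ht.free] at hS
    rw [hroot] at hnew ⊢
    exact Or.inl ⟨rfl, hS.congr_left fun a h1 _ => (Function.update_of_ne (by omega) _ _).symm,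
      hnew⟩
  · have hch := ht.ϱ_child hc.slack h0 (by omega)
    have hb := ht.b_le
    have ha := ht.a_le
    rw [hch] at hS ⊢
    refine Or.inr ⟨fun e => ?_, ht.mem t h0 (by omega), hS, ⟨by omega, by omega⟩, ?_,
      fun s h1 h2 => hold s h1 (by omega)⟩
    · rw [← ht.root] at e
      have := ht.SV_inj hc.slack (by omega) (by omega) le_rfl (by omega) e
      omega
    · obtain ⟨s, h1, h2, h3⟩ := ht.parent t h0 (by omega)
      exact ⟨s, h1, h2, h3, h3 ▸ ht.tight t h0 (by omega)⟩

/-- The exchange assigns the column `k`, and whatever was assigned before remains so.  The variant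
is the position in `SV` that bounds the ancestors of the row `i`. -/
theorem vc_flipPath (hΓ : (workCtx n m C pk).space ≤ pk) (hc : Core n m C u v y)
    (hV : y.nSV = y.nSU + 1) (hsink : Sink n m C y.ρ u v y.SV y.pred y.nSV y.si y.sj)
    (hQ : ∀ ρ ϱ i j r T, T ≤ y.time + 40 * (y.nSV + 2) → Slack n m C ρ ϱ u v → ϱ y.k ≠ 0 →
      (∀ b, 1 ≤ b → b ≤ m → y.ϱ b ≠ 0 → ϱ b ≠ 0) → (∀ a, 1 ≤ a → a ≤ n → y.ρ a ≠ 0 → ρ a ≠ 0) →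
      Q { y with ρ := ρ, ϱ := ϱ, i := i, j := j, r := r, time := T }) :
    vc (workCtx n m C pk) ω flipPath Q y := by
  have ht := hc.tree
  have hk := ht.k_pos
  have hSV : ∀ s, 1 ≤ s → s ≤ y.nSV → 1 ≤ y.SV s ∧ y.SV s ≤ m := fun s h1 h2 =>
    ht.SV_mem h1 (by omega)
  let I : ℕ → Store → Prop := fun t z => ∃ ρ ϱ i j r T,
    z = { y with ρ := ρ, ϱ := ϱ, i := i, j := j, r := r, time := T } ∧
    T + 40 * t ≤ y.time + 40 * (y.nSV + 1) ∧ Flipping n m C u v y ρ ϱ i j t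
  have hloop : ∀ t z, I t z → vc (workCtx n m C pk) ω (.loop (.not (.eqN (N j) (N k))) (
      .setN j (NArr.pred.at (N i)) ;;
      .putN .ρ (N i) (N j) ;;
      .setN r (NArr.ϱ.at (N j)) ;;
      .putN .ϱ (N j) (N i) ;;
      .setN i (N r))) Q z := by
    intro t z hI
    refine vc_loop hΓ I ?_ t hI
    rintro t _ ⟨ρ, ϱ, i, j, r, T, rfl, hT, hfl⟩
    refine ⟨by simp, fun hcond => ?_, fun hcond => ?_⟩
    · simp at hcond
      obtain ⟨h1, -⟩ | ⟨-, hi, hS, ht', ⟨s, hs1, hs2, hpred, htight⟩, hold⟩ := hfl.status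
      · exact absurd h1 hcond
      have hSs := hSV s hs1 (by omega)
      simp [hpred]
      refine ⟨hi, hSs, s - 1, by omega, _, _, _, _, _, _, rfl, by omega, ?_⟩
      rw [hold s hs1 hs2]
      have hstep := hS.assign_row hi.1 hi.2 hSs.1 hSs.2 htight
      rw [hold s hs1 hs2] at hstep
      refine Flipping.next hc hV hs1 (by omega) hstep.1 ?_ (fun b h1 h2 h3 => ?_)
        (fun a h1 h2 h3 => ?_) fun s' h1 h2 => ?_
      · rw [Function.update_self]; omega
      · rw [Function.update_apply]; split_ifs
        · omega
        · exact hfl.keepϱ b h1 h2 h3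
      · rw [Function.update_apply]; split_ifs
        · omega
        · exact hfl.keepρ a h1 h2 h3
      · rw [Function.update_of_ne fun e => by
          have := ht.SV_inj hc.slack h1 (by omega) hs1 (by omega) e; omega]
        exact hold s' h1 (by omega)
    · simp at hcond
      obtain ⟨h1, h2, h3⟩ | ⟨h1, -⟩ := hfl.status
      · simp
        exact hQ _ _ _ _ _ _ (by omega) h2 h3 hfl.keepϱ hfl.keepρ
      · exact absurd hcond h1
  simp only [flipPath, vc_seq]
  rcases hsink with ⟨hsi, s, hs1, hs2, hsj, htight⟩ | ⟨hsj, hsi, hfree, s, hs1, hs2, hpred, htight⟩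
  · have hSs := hSV s hs1 hs2
    rw [hsj] at htight
    simp
    refine ⟨fun _ => ⟨by rw [hsj]; exact hSs, hloop (s - 1) _ ?_⟩, fun h => absurd hsi h⟩
    refine ⟨_, _, _, _, _, _, rfl, by omega, ?_⟩
    rw [hsi, hsj]
    refine Flipping.next hc hV hs1 hs2 (hc.slack.assign_null hSs.1 hSs.2 htight) ?_
      (fun b h1 h2 h3 => ?_) (fun a h1 h2 h3 => h3) fun s' h1 h2 => ?_
    · rw [Function.update_self]; omega
    · rw [Function.update_apply]; split_ifs
      · omega
      · exact h3
    · exact Function.update_of_ne (fun e => by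
        have := ht.SV_inj hc.slack h1 (by omega) hs1 (by omega) e; omega) _ _
  · -- The sink is a row.  If its image is the null column, it is released first.
    simp [show y.si ≠ n + 1 by omega]
    refine hloop y.nSV _ ⟨_, _, _, _, _, _, rfl, by omega, fun _ _ _ h => h,
      fun _ _ _ h => h, Or.inr ⟨by omega, hsi, hc.slack.unassign_row hfree, ⟨by omega, le_rfl⟩,
        ⟨s, hs1, hs2, hpred, htight⟩, fun _ _ _ => rfl⟩⟩

/-! ### Assignment of all columns -/

/-- The part of the time bound that is due to one column: the tree has at most `min (n + 1) m`
columns, and each of them costs time `O(n)`. -/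
@[irreducible] def colTime (n m : ℕ) : ℕ := 2000 * (n + 3) * (min (n + 1) m + 1)

/-- The time of the search and of the exchange, when `a` rows have been expanded. -/
theorem le_colTime {n m a : ℕ} (h : a + 1 ≤ min (n + 1) m) :
    1000 * (n + 3) * (a + 1) + 40 * (a + 3) + 1000 * (n + 3) + 100 ≤ colTime n m := by
  have key : ∀ E D : ℕ, 3000 ≤ E → a + 2 ≤ D →
      E * (a + 1) + 40 * (a + 3) + E + 100 ≤ 2 * (E * D) := by
    intro E D hE hD
    have h1 : E * (a + 2) ≤ E * D := Nat.mul_le_mul_left E hD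
    have h2 : 3000 * (a + 2) ≤ E * (a + 2) := Nat.mul_le_mul_right (a + 2) hE
    have h3 : E * (a + 2) = E * (a + 1) + E := by ring
    omega
  have h3 : colTime n m = 2 * (1000 * (n + 3) * (min (n + 1) m + 1)) := by
    unfold colTime; ring
  rw [h3]
  exact key _ _ (by omega) (by omega)

/-- The outcome of the assignment of the columns before `t`. -/
structure Cols (n m : ℕ) (C : ℕ → ℕ → ℝ) (x : Store) (t : ℕ) (u v : ℕ → ℝ) (y : Store) : Prop where
  slack : Slack n m C y.ρ y.ϱ u v
  hu : ∀ i, 1 ≤ i → i ≤ n + 1 → y.u i = (u i : ℝ)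
  hv : ∀ j, 1 ≤ j → j ≤ m + 1 → y.v j = (v j : ℝ)
  keep : ∀ a, 1 ≤ a → a ≤ n → x.ρ a ≠ 0 → y.ρ a ≠ 0
  done : ∀ b, 1 ≤ b → b < t → y.ϱ b ≠ 0
  time_le : y.time ≤ x.time + colTime n m * t

theorem vc_colsLoop (hΓ : (workCtx n m C pk).space ≤ pk) (hs : Slack n m C x.ρ x.ϱ u v)
    (hu : ∀ i, 1 ≤ i → i ≤ n + 1 → x.u i = (u i : ℝ))
    (hv : ∀ j, 1 ≤ j → j ≤ m + 1 → x.v j = (v j : ℝ)) :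
    vc (workCtx n m C pk) ω colsLoop (fun y => ∃ u v, Cols n m C x (m + 1) u v y) x := by
  simp [colsLoop, forLoop]
  let I : ℕ → Store → Prop := fun t y => y.k = t ∧ 1 ≤ t ∧ t ≤ m + 1 ∧
    y.time + 10 ≤ x.time + colTime n m * t ∧ ∃ u v, Cols n m C x t u v y
  have hsucc : ∀ t, colTime n m * (t + 1) = colTime n m * t + colTime n m := fun t => by ring
  have hpos : 6000 ≤ colTime n m := by
    have h : 6000 ≤ 2000 * (n + 3) := by omega
    unfold colTime
    exact h.trans (Nat.le_mul_of_pos_right _ (Nat.succ_pos _))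
  refine vc_loop_up hΓ m I ?_ 1 ?_
  · rintro t y ⟨hk, hlo, hhi, htime, u, v, h⟩
    have hsc := hsucc t
    refine ⟨by simp, fun hcond => ?_, fun hcond => ?_⟩
    · simp [hk] at hcond
      refine ⟨hcond, ?_⟩
      simp [hk]
      refine ⟨⟨hlo, hcond⟩, fun hfree => ?_, fun hne => ?_⟩
      · refine vc_mono (vc_augment (u := u) (v := v) hΓ h.slack h.hu h.hv (by simp only; omega)
          (by simp only; omega) hfree) fun z ⟨u', v', hz⟩ => ?_
        have hzt := hz.time_le
        have hzk := hz.k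
        simp only at hzt hzk
        refine vc_flipPath hΓ hz.core hz.nSV hz.sink fun ρ ϱ i j r T hT hS hnew hϱ hρ => ?_
        have hV := hz.nSV
        have hD : z.nSV ≤ min (n + 1) m := by
          have h1 := hz.core.tree.a_le
          have h2 := hz.core.tree.b_le
          have h3 := hz.core.tree.lt_cols hz.core.slack
          omega
        have hcost := le_colTime (n := n) (m := m) (a := z.nSU) (by omega)
        have h5 : 1000 * (n + 3) * (z.nSV + 1) = 1000 * (n + 3) * (z.nSU + 1) + 1000 * (n + 3) := by
          rw [hV]; ring
        simp
        refine ⟨by simp only; omega, by omega, by omega, by simp only; omega, u', v', hS, hz.core.hu, hz.core.hv,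
          fun a h1 h2 h3 => ?_, fun b h1 h2 => ?_, ?_⟩
        · refine hρ a h1 h2 ?_
          rw [hz.ρ]
          exact h.keep a h1 h2 h3
        · rcases Nat.lt_or_ge b t with h3 | h3
          · refine hϱ b h1 (by omega) ?_
            rw [hz.ϱ]
            exact h.done b h1 h3
          · obtain rfl : b = t := by omega
            rw [hzk] at hnew
            exact hnew
        · simp only
          omega
      · refine ⟨by simp only, by omega, by omega, by simp only; omega, u, v, h.slack, h.hu, h.hv, h.keep,
          fun b h1 h2 => ?_, by simp only; omega⟩
        rcases Nat.lt_or_ge b t with h3 | h3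
        · exact h.done b h1 h3
        · obtain rfl : b = t := by omega
          exact hne
    · simp [hk] at hcond
      obtain rfl : t = m + 1 := by omega
      exact ⟨u, v, h.slack, h.hu, h.hv, h.keep, h.done, by simp; omega⟩
  · exact ⟨rfl, le_rfl, by omega, by simp only; omega, u, v, hs, hu, hv, fun a _ _ h => h,
      fun b h1 h2 => by omega, by simp only; omega⟩

end
end LSAPE

namespace LSAPE

/-! ### Exchange of the two sides -/

/-- Exchange of the variables of the two sides of the assignment. -/
def NVar.swap : NVar → NVar
  | .n => .m
  | .m => .n
  | a => a

/-- Exchange of the arrays of the two sides of the assignment. -/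
def NArr.swap : NArr → NArr
  | .ρ => .ϱ
  | .ϱ => .ρ
  | a => a

/-- Exchange of the dual variables of the two sides of the assignment. -/
def RArr.swap : RArr → RArr
  | .u => .v
  | .v => .u
  | .π => .π

theorem NVar.swap_swap : Function.Involutive NVar.swap := fun a => by cases a <;> rfl
theorem NArr.swap_swap : Function.Involutive NArr.swap := fun a => by cases a <;> rfl
theorem RArr.swap_swap : Function.Involutive RArr.swap := fun a => by cases a <;> rfl

/-- Exchange of the two sides in an expression. -/
def NExp.swap : NExp → NExp
  | .lit k => .lit k
  | .var a => .var a.swap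
  | .get a e => .get a.swap e.swap
  | .add e f => .add e.swap f.swap

/-- Exchange of the two sides in an expression; the input matrix is read transposed. -/
def RExp.swap : RExp → RExp
  | .zero => .zero
  | .infty => .infty
  | .var a => .var a
  | .get a e => .get a.swap e.swap
  | .mat e f => .mat f.swap e.swap
  | .add e f => .add e.swap f.swap
  | .sub e f => .sub e.swap f.swap

/-- Exchange of the two sides in a test. -/
def BExp.swap : BExp → BExp
  | .eqN e f => .eqN e.swap f.swap
  | .leN e f => .leN e.swap f.swap
  | .eqR e f => .eqR e.swap f.swap
  | .ltR e f => .ltR e.swap f.swap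
  | .leR e f => .leR e.swap f.swap
  | .not b => .not b.swap
  | .and b c => .and b.swap c.swap
  | .or b c => .or b.swap c.swap

/-- Exchange of the two sides in a statement. -/
def Stmt.swap : Stmt → Stmt
  | .skip => .skip
  | .setN a e => .setN a.swap e.swap
  | .setR a e => .setR a e.swap
  | .putN a e f => .putN a.swap e.swap f.swap
  | .putR a e f => .putR a.swap e.swap f.swap
  | .allocN a e f => .allocN a.swap e.swap f.swap
  | .allocR a e f => .allocR a.swap e.swap f.swap
  | .seq c d => .seq c.swap d.swap
  | .cond b c d => .cond b.swap c.swap d.swap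
  | .loop b c => .loop b.swap c.swap
  | .choose a e f => .choose a.swap e.swap f.swap

/-- Exchange of the two sides in a state. -/
def State.swap (s : State) : State where
  nv := fun a => s.nv a.swap
  rv := s.rv
  na := fun a => s.na a.swap
  ra := fun a => s.ra a.swap
  time := s.time
  peak := s.peak

/-- The transposed input matrix. -/
def Input.swap (inp : Input) : Input := ⟨inp.cols, inp.rows, fun i j => inp.entry j i⟩

theorem State.swap_swap (s : State) : s.swap.swap = s := by
  simp only [State.swap, NVar.swap_swap _, NArr.swap_swap _, RArr.swap_swap _]

theorem NExp.cost_swap (e : NExp) : e.swap.cost = e.cost := by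
  induction e <;> simp_all [NExp.swap]

theorem RExp.cost_swap (e : RExp) : e.swap.cost = e.cost := by
  induction e <;> simp_all [RExp.swap, NExp.cost_swap]
  omega

theorem BExp.cost_swap (e : BExp) : e.swap.cost = e.cost := by
  induction e <;> simp_all [BExp.swap, NExp.cost_swap, RExp.cost_swap]

theorem NExp.eval_swap (s : State) (e : NExp) : e.swap.eval s.swap = e.eval s := by
  induction e with
  | lit k => rfl
  | var a => simp only [NExp.swap, NExp.eval, State.swap, NVar.swap_swap _]
  | get a e ih => simp only [NExp.swap, NExp.eval, ih]; simp only [State.swap, NArr.swap_swap _]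
  | add e f ihe ihf => simp only [NExp.swap, NExp.eval, ihe, ihf]

theorem RExp.eval_swap (inp : Input) (s : State) (e : RExp) :
    e.swap.eval inp.swap s.swap = e.eval inp s := by
  induction e with
  | zero => rfl
  | infty => rfl
  | var a => rfl
  | get a e =>
    simp only [RExp.swap, RExp.eval, NExp.eval_swap]
    simp only [State.swap, RArr.swap_swap _]
  | mat e f =>
    simp only [RExp.swap, RExp.eval, NExp.eval_swap]
    rcases e.eval s with _ | a <;> rcases f.eval s with _ | b <;> try rfl
    simp only [Input.swap]
    exact if_congr (by tauto) rfl rfl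
  | add e f ihe ihf => simp only [RExp.swap, RExp.eval, ihe, ihf]
  | sub e f ihe ihf => simp only [RExp.swap, RExp.eval, ihe, ihf]

theorem BExp.eval_swap (inp : Input) (s : State) (e : BExp) :
    e.swap.eval inp.swap s.swap = e.eval inp s := by
  induction e <;> simp_all only [BExp.swap, BExp.eval, NExp.eval_swap, RExp.eval_swap]

theorem space_swap (inp : Input) (na : NArr → Arr ℕ) (ra : RArr → Arr EReal) :
    space inp.swap (fun a => na a.swap) (fun a => ra a.swap) = space inp na ra := by
  have h1 := Equiv.sum_comp (NArr.swap_swap.toPerm) fun a => (na a).len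
  have h2 := Equiv.sum_comp (RArr.swap_swap.toPerm) fun a => (ra a).len
  simp only [Function.Involutive.coe_toPerm] at h1 h2
  simp only [space, h1, h2, Input.swap, mul_comm inp.cols]

theorem update_swap {α β : Type*} [DecidableEq α] {f : α → α} (hf : Function.Involutive f)
    (g : α → β) (a : α) (b : β) :
    (fun x => Function.update g a b (f x)) = Function.update (fun x => g (f x)) (f a) b := by
  funext x
  by_cases h : x = f a
  · subst h; simp [hf a]
  · rw [Function.update_of_ne h, Function.update_of_ne]
    exact fun e => h (by rw [← e, hf x])

theorem State.swap_setN (s : State) (a : NVar) (k : ℕ) :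
    (s.setN a k).swap = s.swap.setN a.swap k := by
  simp only [State.swap, State.setN, update_swap NVar.swap_swap]

theorem State.swap_storeN (inp : Input) (s : State) (a : NArr) (A : Arr ℕ) :
    (s.storeN inp a A).swap = s.swap.storeN inp.swap a.swap A := by
  simp only [State.swap, State.storeN, ← update_swap NArr.swap_swap, space_swap]

theorem State.swap_storeR (inp : Input) (s : State) (a : RArr) (A : Arr EReal) :
    (s.storeR inp a A).swap = s.swap.storeR inp.swap a.swap A := by
  simp only [State.swap, State.storeR, ← update_swap RArr.swap_swap, space_swap]

theorem State.swap_tick (s : State) (t : ℕ) : (s.tick t).swap = s.swap.tick t := rfl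

/-- An execution remains one when the two sides are exchanged everywhere. -/
theorem Exec.swap {ω : ℕ → ℕ} {inp : Input} {c : Stmt} {s s' : State} (h : Exec ω inp c s s') :
    Exec ω inp.swap c.swap s.swap s'.swap := by
  induction h with
  | skip s => exact .skip _
  | @setN s a e k he =>
    rw [State.swap_tick, State.swap_setN, ← NExp.cost_swap]
    exact .setN (by rw [NExp.eval_swap, he])
  | @setR s a e y he =>
    rw [State.swap_tick, ← RExp.cost_swap]
    exact .setR (by rw [RExp.eval_swap, he])
  | @putN s a i e p k A hi he hA =>
    rw [State.swap_tick, State.swap_storeN, ← NExp.cost_swap e, ← NExp.cost_swap i]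
    exact .putN (by rw [NExp.eval_swap, hi]) (by rw [NExp.eval_swap, he])
      (by simpa only [State.swap, NArr.swap_swap _] using hA)
  | @putR s a i e p k A hi he hA =>
    rw [State.swap_tick, State.swap_storeR, ← RExp.cost_swap e, ← NExp.cost_swap i]
    exact .putR (by rw [NExp.eval_swap, hi]) (by rw [RExp.eval_swap, he])
      (by simpa only [State.swap, RArr.swap_swap _] using hA)
  | @allocN s a l e p k hl he =>
    rw [State.swap_tick, State.swap_storeN, ← NExp.cost_swap e, ← NExp.cost_swap l]
    exact .allocN (by rw [NExp.eval_swap, hl]) (by rw [NExp.eval_swap, he])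
  | @allocR s a l e p k hl he =>
    rw [State.swap_tick, State.swap_storeR, ← RExp.cost_swap e, ← NExp.cost_swap l]
    exact .allocR (by rw [NExp.eval_swap, hl]) (by rw [RExp.eval_swap, he])
  | seq _ _ ih₁ ih₂ => exact .seq ih₁ ih₂
  | condTrue hb _ ih =>
    rw [State.swap_tick, ← BExp.cost_swap] at ih
    exact .condTrue (by rw [BExp.eval_swap, hb]) ih
  | condFalse hb _ ih =>
    rw [State.swap_tick, ← BExp.cost_swap] at ih
    exact .condFalse (by rw [BExp.eval_swap, hb]) ih
  | loopTrue hb _ _ ih₁ ih₂ =>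
    rw [State.swap_tick, ← BExp.cost_swap] at ih₁
    exact .loopTrue (by rw [BExp.eval_swap, hb]) ih₁ ih₂
  | loopFalse hb =>
    rw [State.swap_tick, ← BExp.cost_swap]
    exact .loopFalse (by rw [BExp.eval_swap, hb])
  | @choose s x lo hi a b hlo hhi hab =>
    rw [State.swap_tick, State.swap_setN, ← NExp.cost_swap lo, ← NExp.cost_swap hi]
    exact .choose (by rw [NExp.eval_swap, hlo]) (by rw [NExp.eval_swap, hhi]) hab

theorem swap_assignCols : (assignCols colRoles).swap = assignCols rowRoles := rfl

/-! ### The two phases of the algorithm -/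

open NVar RVar

/-- A bound for the number of cells in use when no array is longer than `n + m + 1`: there are
`15 + 4` variables and `5 + 3` arrays besides the input matrix. -/
def cells (n m : ℕ) : ℕ := (n + 1) * (m + 1) + 19 + 8 * (n + m + 1)

theorem cells_comm (n m : ℕ) : cells n m = cells m n := by
  simp only [cells, mul_comm (n + 1), add_comm n m]

theorem space_le_cells {n m : ℕ} {C : ℕ → ℕ → ℝ} {na : NArr → Arr ℕ} {ra : RArr → Arr EReal}
    (hN : ∀ a, (na a).len ≤ n + m + 1) (hR : ∀ a, (ra a).len ≤ n + m + 1) :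
    space (costInput n m C) na ra ≤ cells n m := by
  have h1 := Finset.sum_le_card_nsmul Finset.univ _ _ fun a _ => hN a
  have h2 := Finset.sum_le_card_nsmul Finset.univ _ _ fun a _ => hR a
  have c1 : Finset.card (Finset.univ : Finset NArr) = 5 := rfl
  have c2 : Finset.card (Finset.univ : Finset RArr) = 3 := rfl
  have c3 : Fintype.card NVar = 15 := rfl
  have c4 : Fintype.card RVar = 4 := rfl
  rw [c1, smul_eq_mul] at h1
  rw [c2, smul_eq_mul] at h2
  simp only [space, cells, costInput, c3, c4]
  omega

/-- The states between two phases: the arrays hold a partial `ε`-assignment and dual variables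
that satisfy complementary slackness. -/
structure Loaded (n m : ℕ) (C : ℕ → ℕ → ℝ) (s : State) : Prop where
  hn : s.nv .n = n
  hm : s.nv .m = m
  lenρ : (s.na .ρ).len = n
  lenϱ : (s.na .ϱ).len = m
  lenu : (s.ra .u).len = n + 1
  lenv : (s.ra .v).len = m + 1
  lenN : ∀ a, (s.na a).len ≤ n + m + 1
  lenR : ∀ a, (s.ra a).len ≤ n + m + 1
  peak_le : s.peak ≤ cells n m
  slack : ∃ u v : ℕ → ℝ, Slack n m C (s.na .ρ).val (s.na .ϱ).val u v ∧
    (∀ i, 1 ≤ i → i ≤ n + 1 → (s.ra .u).val i = (u i : ℝ)) ∧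
    ∀ j, 1 ≤ j → j ≤ m + 1 → (s.ra .v).val j = (v j : ℝ)

section
variable {n m : ℕ} {C : ℕ → ℕ → ℝ} {s : State} {ω : ℕ → ℕ}

theorem Loaded.swap (h : Loaded n m C s) : Loaded m n (fun i j => C j i) s.swap := by
  obtain ⟨u, v, h1, h2, h3⟩ := h.slack
  exact ⟨h.hm, h.hn, h.lenϱ, h.lenρ, h.lenv, h.lenu, fun a => by
    rw [add_comm m n]; exact h.lenN _, fun a => by rw [add_comm m n]; exact h.lenR _,
    cells_comm n m ▸ h.peak_le, v, u, h1.transpose, h3, h2⟩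

theorem Loaded.allocN (h : Loaded n m C s) {a : NArr} (hρ : a ≠ .ρ) (hϱ : a ≠ .ϱ)
    {p : ℕ} (hp : p ≤ n + m + 1) (k t : ℕ) :
    Loaded n m C ((s.storeN (costInput n m C) a ⟨p, fun _ => k⟩).tick t) := by
  have hlen : ∀ b, (Function.update s.na a ⟨p, fun _ => k⟩ b).len ≤ n + m + 1 := by
    intro b
    by_cases hb : b = a
    · subst hb; simpa using hp
    · rw [Function.update_of_ne hb]; exact h.lenN b
  have e1 : Function.update s.na a ⟨p, fun _ => k⟩ .ρ = s.na .ρ := Function.update_of_ne hρ.symm _ _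
  have e2 : Function.update s.na a ⟨p, fun _ => k⟩ .ϱ = s.na .ϱ := Function.update_of_ne hϱ.symm _ _
  refine ⟨h.hn, h.hm, ?_, ?_, h.lenu, h.lenv, hlen, h.lenR,
    max_le h.peak_le (space_le_cells hlen h.lenR), ?_⟩
  all_goals simp only [State.tick, State.storeN, e1, e2]
  exacts [h.lenρ, h.lenϱ, h.slack]

theorem Loaded.allocπ (h : Loaded n m C s) {p : ℕ} (hp : p ≤ n + m + 1) (y : EReal) (t : ℕ) :
    Loaded n m C ((s.storeR (costInput n m C) .π ⟨p, fun _ => y⟩).tick t) := by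
  have hlen : ∀ b, (Function.update s.ra .π ⟨p, fun _ => y⟩ b).len ≤ n + m + 1 := by
    intro b
    by_cases hb : b = .π
    · subst hb; simpa using hp
    · rw [Function.update_of_ne hb]; exact h.lenR b
  exact ⟨h.hn, h.hm, h.lenρ, h.lenϱ, h.lenu, h.lenv, h.lenN, hlen,
    max_le h.peak_le (space_le_cells h.lenN hlen), h.slack⟩

/-- A bound for the time to assign all columns. -/
def phaseTime (n m : ℕ) : ℕ := 3 * n + m + 20 + colTime n m * (m + 1)

/-- The specification of the phase that assigns the columns. -/
theorem Loaded.exec_assignCols_colRoles (h : Loaded n m C s) (ω : ℕ → ℕ) :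
    ∃ s', Exec ω (costInput n m C) (assignCols colRoles) s s' ∧ Loaded n m C s' ∧
      (∀ a, 1 ≤ a → a ≤ n → (s.na .ρ).val a ≠ 0 → (s'.na .ρ).val a ≠ 0) ∧
      (∀ b, 1 ≤ b → b ≤ m → (s'.na .ϱ).val b ≠ 0) ∧
      s'.time ≤ s.time + phaseTime n m := by
  obtain ⟨s₁, hs₁⟩ : ∃ s₁, s₁ = (s.storeR (costInput n m C) .π ⟨n, fun _ => ⊤⟩).tick
    (1 + 1 + n + 1) := ⟨_, rfl⟩
  have L₁ : Loaded n m C s₁ := hs₁ ▸ h.allocπ (by omega) _ _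
  have E₁ : Exec ω (costInput n m C) (.allocR .π (N .n) .infty) s s₁ := by
    rw [hs₁]; exact .allocR (congrArg some h.hn) rfl
  obtain ⟨s₂, hs₂⟩ : ∃ s₂, s₂ = (s₁.storeN (costInput n m C) .pred ⟨n, fun _ => 0⟩).tick
    (1 + 1 + n + 1) := ⟨_, rfl⟩
  have L₂ : Loaded n m C s₂ := hs₂ ▸ L₁.allocN (by decide) (by decide) (by omega) _ _
  have E₂ : Exec ω (costInput n m C) (.allocN .pred (N .n) 0) s₁ s₂ := by
    rw [hs₂]; exact .allocN (congrArg some L₁.hn) rfl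
  obtain ⟨s₃, hs₃⟩ : ∃ s₃, s₃ = (s₂.storeN (costInput n m C) .P ⟨n, fun _ => 0⟩).tick
    (1 + 1 + n + 1) := ⟨_, rfl⟩
  have L₃ : Loaded n m C s₃ := hs₃ ▸ L₂.allocN (by decide) (by decide) (by omega) _ _
  have E₃ : Exec ω (costInput n m C) (.allocN .P (N .n) 0) s₂ s₃ := by
    rw [hs₃]; exact .allocN (congrArg some L₂.hn) rfl
  obtain ⟨s₄, hs₄⟩ : ∃ s₄, s₄ = (s₃.storeN (costInput n m C) .SV ⟨m, fun _ => 0⟩).tick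
    (1 + 1 + m + 1) := ⟨_, rfl⟩
  have L₄ : Loaded n m C s₄ := hs₄ ▸ L₃.allocN (by decide) (by decide) (by omega) _ _
  have E₄ : Exec ω (costInput n m C) (.allocN .SV (N .m) 0) s₃ s₄ := by
    rw [hs₄]; exact .allocN (congrArg some L₃.hm) rfl
  have hlenN : ∀ a, (s₄.na a).len = (workCtx n m C s₄.peak).lenN a := by
    intro a
    cases a
    · exact L₄.lenρ
    · exact L₄.lenϱ
    all_goals simp [hs₄, hs₃, hs₂, State.tick, State.storeN, workCtx]
  have hlenR : ∀ a, (s₄.ra a).len = (workCtx n m C s₄.peak).lenR a := by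
    intro a
    cases a
    · exact L₄.lenu
    · exact L₄.lenv
    · simp [hs₄, hs₃, hs₂, hs₁, State.tick, State.storeN, State.storeR, workCtx]
  -- The last allocation has recorded the space now in use.
  have hΓ : (workCtx n m C s₄.peak).space ≤ s₄.peak := by
    have e : (workCtx n m C s₄.peak).space = space (costInput n m C) s₄.na s₄.ra := by
      simp only [Ctx.space, space, hlenN, hlenR]
      rfl
    rw [e, hs₄]
    exact le_max_right _ _
  have hst : toState (workCtx n m C s₄.peak) s₄.store = s₄ :=
    toState_store L₄.hn L₄.hm hlenN hlenR rfl
  obtain ⟨u, v, hS, hu, hv⟩ := L₄.slack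
  obtain ⟨y, hy, u', v', hc⟩ := vc_sound hΓ _
    (vc_colsLoop (ω := ω) (u := u) (v := v) (x := s₄.store) hΓ hS hu hv)
  rw [hst] at hy
  refine ⟨toState (workCtx n m C s₄.peak) y, assignCols_colRoles ▸
    .seq E₁ (.seq E₂ (.seq E₃ (.seq E₄ hy))), ?_, fun a h1 h2 h3 => ?_, fun b h1 h2 => ?_, ?_⟩
  · exact ⟨rfl, rfl, rfl, rfl, rfl, rfl, fun a => (hlenN a).symm.le.trans (L₄.lenN a),
      fun a => (hlenR a).symm.le.trans (L₄.lenR a), L₄.peak_le, u', v', hc.slack, hc.hu, hc.hv⟩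
  · refine hc.keep a h1 h2 ?_
    simpa [State.store, hs₄, hs₃, hs₂, hs₁, State.tick, State.storeN, State.storeR] using h3
  · exact hc.done b h1 (by omega)
  · refine hc.time_le.trans ?_
    have ht : s₄.store.time = s.time + (3 * n + m + 12) := by
      simp only [State.store, hs₄, hs₃, hs₂, hs₁, State.tick, State.storeN, State.storeR]
      omega
    rw [ht, phaseTime]
    omega

/-- The specification of the phase that assigns the rows, by exchange of the two sides. -/
theorem Loaded.exec_assignCols_rowRoles (h : Loaded n m C s) (ω : ℕ → ℕ) :
    ∃ s', Exec ω (costInput n m C) (assignCols rowRoles) s s' ∧ Loaded n m C s' ∧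
      (∀ b, 1 ≤ b → b ≤ m → (s.na .ϱ).val b ≠ 0 → (s'.na .ϱ).val b ≠ 0) ∧
      (∀ a, 1 ≤ a → a ≤ n → (s'.na .ρ).val a ≠ 0) ∧
      s'.time ≤ s.time + phaseTime m n := by
  obtain ⟨s', hE, hL, h1, h2, h3⟩ := h.swap.exec_assignCols_colRoles ω
  have hE' := hE.swap
  rw [State.swap_swap, swap_assignCols] at hE'
  exact ⟨s'.swap, hE', hL.swap, h1, h2, h3⟩

theorem Loaded.returnsDual_and_returnsAssignment (h : Loaded n m C s)
    (hC : IsEditCost n m C) (hρ : ∀ a, 1 ≤ a → a ≤ n → (s.na .ρ).val a ≠ 0)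
    (hϱ : ∀ b, 1 ≤ b → b ≤ m → (s.na .ϱ).val b ≠ 0) :
    ReturnsAssignment n m C s ∧ ReturnsDual n m C s := by
  obtain ⟨u, v, hS, hu, hv⟩ := h.slack
  obtain ⟨h1, h2⟩ := hS.optimal hC.2 hρ hϱ
  refine ⟨⟨h.lenρ, h.lenϱ, h1⟩, h.lenu, h.lenv, u, v, h2, fun i hi => ?_, fun j hj => ?_⟩
  · rw [Finset.mem_Icc] at hi; exact hu i hi.1 hi.2
  · rw [Finset.mem_Icc] at hj; exact hv j hj.1 hj.2

/-- The modified Hungarian algorithm, started in a state in which complementary slackness holds. -/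
theorem Loaded.exec_hungarian (h : Loaded n m C s) (hC : IsEditCost n m C) (ω : ℕ → ℕ) :
    ∃ s', Exec ω (costInput n m C) hungarian s s' ∧ ReturnsAssignment n m C s' ∧
      ReturnsDual n m C s' ∧ s'.time ≤ s.time + (phaseTime n m + phaseTime m n) ∧
      s'.peak ≤ cells n m := by
  obtain ⟨s₁, hE₁, hL₁, -, h2, h3⟩ := h.exec_assignCols_colRoles ω
  obtain ⟨s₂, hE₂, hL₂, g1, g2, g3⟩ := hL₁.exec_assignCols_rowRoles ω
  obtain ⟨hA, hD⟩ := hL₂.returnsDual_and_returnsAssignment hC g2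
    fun b hb hb' => g1 b hb hb' (h2 b hb hb')
  exact ⟨s₂, .seq hE₁ hE₂, hA, hD, by omega, hL₂.peak_le⟩

end
end LSAPE

namespace LSAPE
open NVar RVar

/-! ### The pre-processing -/

/-- The context of the pre-processing after the allocation of its arrays. -/
def preCtx (n m : ℕ) (C : ℕ → ℕ → ℝ) (peak : ℕ) : Ctx where
  n := n
  m := m
  inp := costInput n m C
  lenN := fun
    | .ρ => n
    | .ϱ => m
    | _ => 0
  lenR := fun
    | .u => n + 1
    | .v => m + 1
    | .π => 0
  peak := peak

section
variable (n m : ℕ) (C : ℕ → ℕ → ℝ) (pk : ℕ)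
@[simp] theorem preCtx_n : (preCtx n m C pk).n = n := rfl
@[simp] theorem preCtx_m : (preCtx n m C pk).m = m := rfl
@[simp] theorem preCtx_rows : (preCtx n m C pk).inp.rows = n + 1 := rfl
@[simp] theorem preCtx_cols : (preCtx n m C pk).inp.cols = m + 1 := rfl
@[simp] theorem preCtx_entry : (preCtx n m C pk).inp.entry = C := rfl
@[simp] theorem preCtx_ρ : (preCtx n m C pk).lenN .ρ = n := rfl
@[simp] theorem preCtx_ϱ : (preCtx n m C pk).lenN .ϱ = m := rfl
@[simp] theorem preCtx_u : (preCtx n m C pk).lenR .u = n + 1 := rfl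
@[simp] theorem preCtx_v : (preCtx n m C pk).lenR .v = m + 1 := rfl
end

/-- The minimum `w` of the row `i`. -/
def rowMin : Stmt :=
  forLoop j 1 (N m + 1) (
    ifThen (.ltR (.mat (N i) (N j)) (X w)) (.setR w (.mat (N i) (N j))))

/-- The dual variables of all rows. -/
def initU : Stmt := forLoop i 1 (N n) (.setR w .infty ;; rowMin ;; .putR .u (N i) (X w))

/-- The minimum `w` of the column `j`, reduced by the dual variables of the rows. -/
def colMin : Stmt :=
  forLoop i 1 (N n + 1) (
    ifThen (.ltR (.mat (N i) (N j) - RArr.u.at (N i)) (X w))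
      (.setR w (.mat (N i) (N j) - RArr.u.at (N i))))

/-- The dual variables of all columns. -/
def initV : Stmt := forLoop j 1 (N m) (.setR w .infty ;; colMin ;; .putR .v (N j) (X w))

/-- The loop that assigns the row `i` to the first free column in which it is tight. -/
def greedyRow : Stmt :=
  .loop (.and (.leN (N j) (N m)) (.eqN (N found) 0)) (
    ifThen (.and (.eqN (NArr.ϱ.at (N j)) 0)
        (.eqR (.mat (N i) (N j)) (RArr.u.at (N i) + RArr.v.at (N j)))) (
      .putN .ρ (N i) (N j) ;;
      .putN .ϱ (N j) (N i) ;;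
      .setN found 1) ;;
    .setN j (N j + 1))

/-- The greedy assignment of the rows. -/
def greedy : Stmt :=
  forLoop i 1 (N n) (
    .setN j 1 ;;
    .setN found 0 ;;
    greedyRow ;;
    ifThen (.and (.eqN (NArr.ρ.at (N i)) 0) (.eqR (.mat (N i) (N m + 1)) (RArr.u.at (N i))))
      (.putN .ρ (N i) (N m + 1)))

/-- The assignment of free columns to the null row. -/
def nullCols : Stmt :=
  forLoop j 1 (N m) (
    ifThen (.and (.eqN (NArr.ϱ.at (N j)) 0) (.eqR (.mat (N n + 1) (N j)) (RArr.v.at (N j))))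
      (.putN .ϱ (N j) (N n + 1)))

theorem preproc_eq : preproc =
    (.allocR .u (N n + 1) .zero ;; .allocR .v (N m + 1) .zero ;; .allocN .ρ (N n) 0 ;;
      .allocN .ϱ (N m) 0 ;; initU ;; initV ;; greedy ;; nullCols) := rfl

section
variable {n m : ℕ} {C : ℕ → ℕ → ℝ} {pk : ℕ} {ω : ℕ → ℕ} {x : Store} {u v : ℕ → ℝ}

/-- The minimum is a real number since the row has at least the entry of the null column. -/
theorem vc_rowMin (hΓ : (preCtx n m C pk).space ≤ pk) (hi : 1 ≤ x.i) (hi' : x.i ≤ n)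
    (hw : x.w = ⊤) :
    vc (preCtx n m C pk) ω rowMin (fun y => ∃ (b T : ℕ) (r : ℝ),
      y = { x with j := b, w := (r : EReal), time := T } ∧
      (∀ b, 1 ≤ b → b ≤ m + 1 → r ≤ C x.i b) ∧ T ≤ x.time + (20 * m + 50)) x := by
  simp [rowMin, forLoop]
  let I : ℕ → Store → Prop := fun t y => ∃ (T : ℕ) (e : EReal),
    y = { x with j := t, w := e, time := T } ∧ 1 ≤ t ∧ t ≤ m + 2 ∧ T ≤ x.time + 20 * t ∧
    (∀ b, 1 ≤ b → b < t → e ≤ (C x.i b : ℝ)) ∧ ((t = 1 ∧ e = ⊤) ∨ ∃ r : ℝ, e = r)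
  refine vc_loop_up hΓ (m + 1) I ?_ 1 ?_
  · rintro t y ⟨T, e, rfl, h1, h2, hT, hmin, he⟩
    refine ⟨by simp, fun hcond => ?_, fun hcond => ?_⟩
    · simp at hcond
      refine ⟨hcond, ?_⟩
      simp
      refine ⟨⟨hi, by omega, h1, hcond⟩, fun hlt => ?_, fun hle => ?_⟩
      · refine ⟨⟨hi, by omega, h1, hcond⟩, _, _, rfl, by omega, by omega, by omega, fun b hb hb' => ?_, Or.inr ⟨_, rfl⟩⟩
        rcases Nat.lt_or_ge b t with h | h
        · exact hlt.le.trans (hmin b hb h)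
        · obtain rfl : b = t := by omega
          exact le_rfl
      · refine ⟨_, _, rfl, by omega, by omega, by omega, fun b hb hb' => ?_, Or.inr ?_⟩
        · rcases Nat.lt_or_ge b t with h | h
          · exact hmin b hb h
          · obtain rfl : b = t := by omega
            exact hle
        · rcases he with ⟨-, rfl⟩ | he
          · exact absurd hle (by simp)
          · exact he
    · simp at hcond
      obtain rfl : t = m + 2 := by omega
      obtain ⟨r, rfl⟩ : ∃ r : ℝ, e = r := by
        rcases he with ⟨h, -⟩ | he
        · omega
        · exact he
      refine ⟨m + 2, T + 6, r, rfl, fun b hb hb' => ?_, by omega⟩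
      exact EReal.coe_le_coe_iff.1 (hmin b hb (by omega))
  · refine ⟨_, _, rfl, le_rfl, by omega, by omega, fun b hb hb' => by omega, Or.inl ⟨rfl, hw⟩⟩

/-- The dual variables of the rows are lower bounds of the entries; that these are attained is not
needed for feasibility. -/
theorem vc_initU (hΓ : (preCtx n m C pk).space ≤ pk) :
    vc (preCtx n m C pk) ω initU (fun y => ∃ (a b T : ℕ) (w : EReal) (U : ℕ → EReal),
      y = { x with i := a, j := b, w := w, u := U, time := T } ∧
      (∀ a, 1 ≤ a → a ≤ n → ∃ r : ℝ, U a = r ∧ ∀ b, 1 ≤ b → b ≤ m + 1 → r ≤ C a b) ∧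
      U (n + 1) = x.u (n + 1) ∧ T ≤ x.time + (20 * m + 100) * (n + 1)) x := by
  simp [initU, forLoop]
  have hsucc : ∀ t, (20 * m + 100) * (t + 1) = (20 * m + 100) * t + (20 * m + 100) :=
    fun t => by ring
  let I : ℕ → Store → Prop := fun t y => ∃ (b T : ℕ) (w : EReal) (U : ℕ → EReal),
    y = { x with i := t, j := b, w := w, u := U, time := T } ∧ 1 ≤ t ∧ t ≤ n + 1 ∧
    (∀ a, 1 ≤ a → a < t → ∃ r : ℝ, U a = r ∧ ∀ b, 1 ≤ b → b ≤ m + 1 → r ≤ C a b) ∧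
    U (n + 1) = x.u (n + 1) ∧ T + 10 ≤ x.time + (20 * m + 100) * t
  refine vc_loop_up hΓ n I ?_ 1 ?_
  · rintro t y ⟨b, T, e, U, rfl, h1, h2, hU, hn, hT⟩
    have hsc := hsucc t
    refine ⟨by simp, fun hcond => ?_, fun hcond => ?_⟩
    · simp at hcond
      refine ⟨hcond, ?_⟩
      simp
      refine vc_mono (vc_rowMin hΓ h1 hcond rfl) fun z ⟨b, T', d, hz, hd, hT'⟩ => ?_
      subst hz
      simp
      refine ⟨⟨h1, by omega⟩, _, _, _, _, rfl, by omega, by omega, fun a ha ha' => ?_, ?_, ?_⟩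
      · rcases Nat.lt_or_ge a t with h | h
        · rw [Function.update_of_ne (by omega)]; exact hU a ha h
        · obtain rfl : a = t := by omega
          exact ⟨d, Function.update_self .., hd⟩
      · rw [Function.update_of_ne (by omega)]; exact hn
      · simp only at hT'; omega
    · simp at hcond
      obtain rfl : t = n + 1 := by omega
      exact ⟨_, _, _, _, _, rfl, fun a ha ha' => hU a ha (by omega), hn, by simp; omega⟩
  · exact ⟨_, _, _, _, rfl, le_rfl, by omega, fun a ha ha' => by omega, rfl, by omega⟩

theorem vc_colMin (hΓ : (preCtx n m C pk).space ≤ pk) (hj : 1 ≤ x.j) (hj' : x.j ≤ m)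
    (hw : x.w = ⊤) (hu : ∀ a, 1 ≤ a → a ≤ n + 1 → x.u a = (u a : ℝ)) :
    vc (preCtx n m C pk) ω colMin (fun y => ∃ (a T : ℕ) (r : ℝ),
      y = { x with i := a, w := (r : EReal), time := T } ∧
      (∀ a, 1 ≤ a → a ≤ n + 1 → r ≤ C a x.j - u a) ∧ T ≤ x.time + (30 * n + 70)) x := by
  simp [colMin, forLoop]
  let I : ℕ → Store → Prop := fun t y => ∃ (T : ℕ) (e : EReal),
    y = { x with i := t, w := e, time := T } ∧ 1 ≤ t ∧ t ≤ n + 2 ∧ T ≤ x.time + 30 * t ∧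
    (∀ a, 1 ≤ a → a < t → e ≤ (C a x.j - u a : ℝ)) ∧ ((t = 1 ∧ e = ⊤) ∨ ∃ r : ℝ, e = r)
  refine vc_loop_up hΓ (n + 1) I ?_ 1 ?_
  · rintro t y ⟨T, e, rfl, h1, h2, hT, hmin, he⟩
    refine ⟨by simp, fun hcond => ?_, fun hcond => ?_⟩
    · simp at hcond
      refine ⟨hcond, ?_⟩
      simp [hu t h1 hcond, ← EReal.coe_sub]
      refine ⟨⟨⟨h1, hcond, hj, by omega⟩, h1, hcond⟩, fun hlt => ?_, fun hle => ?_⟩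
      · refine ⟨⟨⟨h1, hcond, hj, by omega⟩, h1, hcond⟩, _, _, rfl, by omega, by omega, by omega, fun b hb hb' => ?_, Or.inr ⟨_, rfl⟩⟩
        rcases Nat.lt_or_ge b t with h | h
        · exact hlt.le.trans (hmin b hb h)
        · obtain rfl : b = t := by omega
          exact le_rfl
      · refine ⟨_, _, rfl, by omega, by omega, by omega, fun b hb hb' => ?_, Or.inr ?_⟩
        · rcases Nat.lt_or_ge b t with h | h
          · exact hmin b hb h
          · obtain rfl : b = t := by omega
            exact hle
        · rcases he with ⟨-, rfl⟩ | he
          · exact absurd hle (EReal.coe_lt_top _).not_ge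
          · exact he
    · simp at hcond
      obtain rfl : t = n + 2 := by omega
      obtain ⟨r, rfl⟩ : ∃ r : ℝ, e = r := by
        rcases he with ⟨h, -⟩ | he
        · omega
        · exact he
      refine ⟨n + 2, T + 6, r, rfl, fun b hb hb' => ?_, by omega⟩
      exact EReal.coe_le_coe_iff.1 (hmin b hb (by omega))
  · refine ⟨_, _, rfl, le_rfl, by omega, by omega, fun b hb hb' => by omega, Or.inl ⟨rfl, hw⟩⟩

theorem vc_initV (hΓ : (preCtx n m C pk).space ≤ pk)
    (hu : ∀ a, 1 ≤ a → a ≤ n + 1 → x.u a = (u a : ℝ)) :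
    vc (preCtx n m C pk) ω initV (fun y => ∃ (a b T : ℕ) (w : EReal) (V : ℕ → EReal),
      y = { x with i := a, j := b, w := w, v := V, time := T } ∧
      (∀ b, 1 ≤ b → b ≤ m → ∃ r : ℝ, V b = r ∧ ∀ a, 1 ≤ a → a ≤ n + 1 → r ≤ C a b - u a) ∧
      V (m + 1) = x.v (m + 1) ∧ T ≤ x.time + (30 * n + 100) * (m + 1)) x := by
  simp [initV, forLoop]
  have hsucc : ∀ t, (30 * n + 100) * (t + 1) = (30 * n + 100) * t + (30 * n + 100) :=
    fun t => by ring
  let I : ℕ → Store → Prop := fun t y => ∃ (a T : ℕ) (w : EReal) (V : ℕ → EReal),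
    y = { x with i := a, j := t, w := w, v := V, time := T } ∧ 1 ≤ t ∧ t ≤ m + 1 ∧
    (∀ b, 1 ≤ b → b < t → ∃ r : ℝ, V b = r ∧ ∀ a, 1 ≤ a → a ≤ n + 1 → r ≤ C a b - u a) ∧
    V (m + 1) = x.v (m + 1) ∧ T + 10 ≤ x.time + (30 * n + 100) * t
  refine vc_loop_up hΓ m I ?_ 1 ?_
  · rintro t y ⟨b, T, e, U, rfl, h1, h2, hU, hn, hT⟩
    have hsc := hsucc t
    refine ⟨by simp, fun hcond => ?_, fun hcond => ?_⟩
    · simp at hcond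
      refine ⟨hcond, ?_⟩
      simp
      refine vc_mono (vc_colMin hΓ h1 hcond rfl hu) fun z ⟨b, T', d, hz, hd, hT'⟩ => ?_
      subst hz
      simp
      refine ⟨⟨h1, by omega⟩, _, _, _, _, rfl, by omega, by omega, fun a ha ha' => ?_, ?_, ?_⟩
      · rcases Nat.lt_or_ge a t with h | h
        · rw [Function.update_of_ne (by omega)]; exact hU a ha h
        · obtain rfl : a = t := by omega
          exact ⟨d, Function.update_self .., hd⟩
      · rw [Function.update_of_ne (by omega)]; exact hn
      · simp only at hT'; omega
    · simp at hcond
      obtain rfl : t = m + 1 := by omega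
      exact ⟨_, _, _, _, _, rfl, fun a ha ha' => hU a ha (by omega), hn, by simp; omega⟩
  · exact ⟨_, _, _, _, rfl, le_rfl, by omega, fun a ha ha' => by omega, rfl, by omega⟩

theorem Slack.assign_free {ρ ϱ : ℕ → ℕ} (h : Slack n m C ρ ϱ u v) {a b : ℕ} (ha : 1 ≤ a)
    (ha' : a ≤ n) (hb : 1 ≤ b) (hb' : b ≤ m) (ht : C a b = u a + v b) (hρ : ρ a = 0)
    (hϱ : ϱ b = 0) : Slack n m C (Function.update ρ a b) (Function.update ϱ b a) u v := by
  have h1 := ((h.unassign_row (Or.inl hρ)).assign_row ha ha' hb hb' ht).1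
  rw [hϱ] at h1
  exact h1.congr_left fun i hi _ => (Function.update_of_ne (by omega) _ _).symm

theorem Slack.assign_col_null {ρ ϱ : ℕ → ℕ} (h : Slack n m C ρ ϱ u v) {b : ℕ} (hb : 1 ≤ b)
    (hb' : b ≤ m) (ht : C (n + 1) b = v b) (hϱ : ϱ b = 0) :
    Slack n m C ρ (Function.update ϱ b (n + 1)) u v := by
  have h1 := h.assign_null hb hb' (by rw [ht, h.feas.1, zero_add])
  rw [hϱ] at h1
  exact h1.congr_left fun i hi _ => (Function.update_of_ne (by omega) _ _).symm

/-- The row `i` is unassigned as long as `found = 0`, so the invariant allows to assign it. -/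
theorem vc_greedyRow (hΓ : (preCtx n m C pk).space ≤ pk) (hs : Slack n m C x.ρ x.ϱ u v)
    (hu : ∀ a, 1 ≤ a → a ≤ n + 1 → x.u a = (u a : ℝ))
    (hv : ∀ b, 1 ≤ b → b ≤ m + 1 → x.v b = (v b : ℝ))
    (hi : 1 ≤ x.i) (hi' : x.i ≤ n) (hρ : x.ρ x.i = 0) (hj : x.j = 1) :
    vc (preCtx n m C pk) ω greedyRow (fun y => ∃ (b f T : ℕ) (ρ ϱ : ℕ → ℕ),
      y = { x with j := b, found := f, ρ := ρ, ϱ := ϱ, time := T } ∧ Slack n m C ρ ϱ u v ∧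
      (∀ a, a ≠ x.i → ρ a = x.ρ a) ∧ T ≤ x.time + (40 * m + 100)) x := by
  unfold greedyRow
  let I : ℕ → Store → Prop := fun t y => ∃ (f T : ℕ) (ρ ϱ : ℕ → ℕ),
    y = { x with j := t, found := f, ρ := ρ, ϱ := ϱ, time := T } ∧ 1 ≤ t ∧ t ≤ m + 1 ∧
    Slack n m C ρ ϱ u v ∧ (∀ a, a ≠ x.i → ρ a = x.ρ a) ∧ (f = 0 → ρ x.i = 0) ∧
    T ≤ x.time + 40 * t
  refine vc_loop_up hΓ m I ?_ 1 ?_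
  · rintro t y ⟨f, T, ρ, ϱ, rfl, h1, h2, hS, hne, hf, hT⟩
    refine ⟨by simp, fun hcond => ?_, fun hcond => ?_⟩
    · simp at hcond
      obtain ⟨htm, rfl⟩ := hcond
      refine ⟨htm, ?_⟩
      simp [hu x.i hi (by omega), hv t h1 (by omega), ← EReal.coe_add]
      refine ⟨by omega,
        fun hϱ htight => ?_, fun h => ?_⟩
      · refine ⟨⟨hi, hi'⟩, ⟨h1, htm⟩, _, _, _, _, rfl, by omega, by omega,
          hS.assign_free hi hi' h1 htm htight (hf rfl) hϱ, fun a ha => ?_, by simp, by omega⟩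
        rw [Function.update_of_ne ha]
        exact hne a ha
      · exact ⟨_, _, _, _, rfl, by omega, by omega, hS, hne, hf, by omega⟩
    · exact ⟨_, _, _, _, _, rfl, hS, hne, by simp; omega⟩
  · exact ⟨_, _, _, _, by rw [← hj], le_rfl, by omega, hs, fun _ _ => rfl, fun _ => hρ, by omega⟩

theorem vc_greedy (hΓ : (preCtx n m C pk).space ≤ pk) (hs : Slack n m C x.ρ x.ϱ u v)
    (hu : ∀ a, 1 ≤ a → a ≤ n + 1 → x.u a = (u a : ℝ))
    (hv : ∀ b, 1 ≤ b → b ≤ m + 1 → x.v b = (v b : ℝ)) (hρ : ∀ a, 1 ≤ a → a ≤ n → x.ρ a = 0) :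
    vc (preCtx n m C pk) ω greedy (fun y => ∃ (a b f T : ℕ) (ρ ϱ : ℕ → ℕ),
      y = { x with i := a, j := b, found := f, ρ := ρ, ϱ := ϱ, time := T } ∧
      Slack n m C ρ ϱ u v ∧ T ≤ x.time + (40 * m + 200) * (n + 1)) x := by
  simp [greedy, forLoop]
  have hsucc : ∀ t, (40 * m + 200) * (t + 1) = (40 * m + 200) * t + (40 * m + 200) :=
    fun t => by ring
  let I : ℕ → Store → Prop := fun t y => ∃ (b f T : ℕ) (ρ ϱ : ℕ → ℕ),
    y = { x with i := t, j := b, found := f, ρ := ρ, ϱ := ϱ, time := T } ∧ 1 ≤ t ∧ t ≤ n + 1 ∧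
    Slack n m C ρ ϱ u v ∧ (∀ a, t ≤ a → a ≤ n → ρ a = 0) ∧
    T + 10 ≤ x.time + (40 * m + 200) * t
  refine vc_loop_up hΓ n I ?_ 1 ?_
  · rintro t y ⟨b, f, T, ρ, ϱ, rfl, h1, h2, hS, h0, hT⟩
    have hsc := hsucc t
    refine ⟨by simp, fun hcond => ?_, fun hcond => ?_⟩
    · simp at hcond
      refine ⟨hcond, ?_⟩
      simp
      refine vc_mono (vc_greedyRow hΓ hS hu hv h1 hcond (h0 t le_rfl hcond) rfl)
        fun z ⟨b, f, T', ρ', ϱ', hz, hS', hne, hT'⟩ => ?_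
      subst hz
      simp only at hne hT'
      simp [hu t h1 (by omega)]
      refine ⟨by omega, fun hfree htight => ?_, fun h => ?_⟩
      · refine ⟨⟨h1, hcond⟩, _, _, _, _, _, rfl, by omega, by omega,
          (hS'.transpose.assign_col_null h1 hcond htight hfree).transpose, fun a ha ha' => ?_,
          by omega⟩
        rw [Function.update_of_ne (by omega), hne a (by omega)]
        exact h0 a (by omega) ha'
      · refine ⟨_, _, _, _, _, rfl, by omega, by omega, hS', fun a ha ha' => ?_, by omega⟩
        rw [hne a (by omega)]
        exact h0 a (by omega) ha'
    · simp at hcond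
      obtain rfl : t = n + 1 := by omega
      exact ⟨_, _, _, _, _, _, rfl, hS, by simp; omega⟩
  · exact ⟨_, _, _, _, _, rfl, le_rfl, by omega, hs, hρ, by omega⟩

theorem vc_nullCols (hΓ : (preCtx n m C pk).space ≤ pk) (hs : Slack n m C x.ρ x.ϱ u v)
    (hv : ∀ b, 1 ≤ b → b ≤ m + 1 → x.v b = (v b : ℝ)) :
    vc (preCtx n m C pk) ω nullCols (fun y => ∃ (b T : ℕ) (ϱ : ℕ → ℕ),
      y = { x with j := b, ϱ := ϱ, time := T } ∧ Slack n m C x.ρ ϱ u v ∧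
      T ≤ x.time + 40 * (m + 2)) x := by
  simp [nullCols, forLoop]
  let I : ℕ → Store → Prop := fun t y => ∃ (T : ℕ) (ϱ : ℕ → ℕ),
    y = { x with j := t, ϱ := ϱ, time := T } ∧ 1 ≤ t ∧ t ≤ m + 1 ∧ Slack n m C x.ρ ϱ u v ∧
    T ≤ x.time + 40 * t
  refine vc_loop_up hΓ m I ?_ 1 ?_
  · rintro t y ⟨T, ϱ, rfl, h1, h2, hS, hT⟩
    refine ⟨by simp, fun hcond => ?_, fun hcond => ?_⟩
    · simp at hcond
      refine ⟨hcond, ?_⟩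
      simp [hv t h1 (by omega)]
      refine ⟨by omega, fun hfree htight => ?_, fun h => ?_⟩
      · exact ⟨⟨h1, hcond⟩, _, _, rfl, by omega, by omega,
          hS.assign_col_null h1 hcond htight hfree, by omega⟩
      · exact ⟨_, _, rfl, by omega, by omega, hS, by omega⟩
    · exact ⟨_, _, _, rfl, hS, by simp; omega⟩
  · exact ⟨_, _, rfl, le_rfl, by omega, hs, by omega⟩

end
end LSAPE

namespace LSAPE
open NVar RVar

/-! ### Executions of the whole algorithms -/

/-- The states of the pre-processing: all arrays are short and little space has been used. -/
structure Small (n m : ℕ) (s : State) : Prop where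
  hn : s.nv .n = n
  hm : s.nv .m = m
  lenN : ∀ a, (s.na a).len ≤ n + m + 1
  lenR : ∀ a, (s.ra a).len ≤ n + m + 1
  peak_le : s.peak ≤ cells n m

section
variable {n m : ℕ} {C : ℕ → ℕ → ℝ} {s : State} {u v : ℕ → ℝ}

theorem Small.storeN (h : Small n m s) (a : NArr) {A : Arr ℕ} (hA : A.len ≤ n + m + 1) (t : ℕ) :
    Small n m ((s.storeN (costInput n m C) a A).tick t) := by
  have hlen : ∀ b, (Function.update s.na a A b).len ≤ n + m + 1 := by
    intro b
    by_cases hb : b = a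
    · subst hb; simpa using hA
    · rw [Function.update_of_ne hb]; exact h.lenN b
  exact ⟨h.hn, h.hm, hlen, h.lenR, max_le h.peak_le (space_le_cells hlen h.lenR)⟩

theorem Small.storeR (h : Small n m s) (a : RArr) {A : Arr EReal} (hA : A.len ≤ n + m + 1)
    (t : ℕ) : Small n m ((s.storeR (costInput n m C) a A).tick t) := by
  have hlen : ∀ b, (Function.update s.ra a A b).len ≤ n + m + 1 := by
    intro b
    by_cases hb : b = a
    · subst hb; simpa using hA
    · rw [Function.update_of_ne hb]; exact h.lenR b
  exact ⟨h.hn, h.hm, h.lenN, hlen, max_le h.peak_le (space_le_cells h.lenN hlen)⟩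

theorem small_startState : Small n m (startState n m C) :=
  ⟨rfl, rfl, fun _ => Nat.zero_le _, fun _ => Nat.zero_le _,
    space_le_cells (fun _ => Nat.zero_le _) fun _ => Nat.zero_le _⟩

theorem loaded_loadState {φ : ℕ → Finset ℕ} {ρ ϱ : ℕ → ℕ} (hφ : IsPartialEpsAssignment n m φ)
    (he : Encodes n m ρ ϱ φ) (hc : CompSlack n m C φ u v) :
    Loaded n m C (loadState n m C ρ ϱ u v) := by
  have hN : ∀ a, (loadN n m ρ ϱ a).len ≤ n + m + 1 := fun a => by
    cases a <;> simp only [loadN] <;> omega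
  have hR : ∀ a, (loadR n m u v a).len ≤ n + m + 1 := fun a => by
    cases a <;> simp only [loadR] <;> omega
  exact ⟨rfl, rfl, rfl, rfl, rfl, rfl, hN, hR, space_le_cells hN hR, u, v,
    Slack.of_encodes hφ he hc, fun _ _ _ => rfl, fun _ _ _ => rfl⟩

/-- The empty assignment satisfies complementary slackness with all feasible dual variables. -/
theorem slack_zero (h : IsDualFeasible n m C u v) : Slack n m C (fun _ => 0) (fun _ => 0) u v where
  feas := h
  ρ_le _ _ _ := Nat.zero_le _
  ϱ_le _ _ _ := Nat.zero_le _
  inv i j hi _ hj _ := by omega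
  tightρ _ _ _ h0 := absurd rfl h0
  tightϱ _ _ _ h0 := absurd rfl h0

/-- Dual variables that are lower bounds as in the pre-processing are feasible. -/
theorem isDualFeasible_of_le (hC : C (n + 1) (m + 1) = 0) (hu : u (n + 1) = 0)
    (hv : v (m + 1) = 0) (h1 : ∀ i, 1 ≤ i → i ≤ n → u i ≤ C i (m + 1))
    (h2 : ∀ j, 1 ≤ j → j ≤ m → ∀ i, 1 ≤ i → i ≤ n + 1 → v j ≤ C i j - u i) :
    IsDualFeasible n m C u v := by
  refine ⟨hu, hv, fun i hi j hj => ?_⟩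
  rw [Finset.mem_Icc] at hi hj
  rcases Nat.lt_or_ge m j with h | h
  · obtain rfl : j = m + 1 := by omega
    rcases Nat.lt_or_ge n i with h' | h'
    · obtain rfl : i = n + 1 := by omega
      rw [hu, hv, hC, add_zero]
    · rw [hv, add_zero]
      exact h1 i hi.1 h'
  · linarith [h2 j hj.1 h i hi.1 hi.2]

theorem preTime_bound (n m : ℕ) :
    2 * n + 2 * m + 40 + (20 * m + 100) * (n + 1) + (30 * n + 100) * (m + 1)
      + (40 * m + 200) * (n + 1) + 40 * (m + 2) ≤ 1000 * ((n + 1) * (m + 1)) := by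
  nlinarith [Nat.zero_le (n * m)]

/-- The specification of the pre-processing. -/
theorem exec_preproc (hC : IsEditCost n m C) (ω : ℕ → ℕ) :
    ∃ s', Exec ω (costInput n m C) preproc (startState n m C) s' ∧ Loaded n m C s' ∧
      s'.time ≤ 1000 * ((n + 1) * (m + 1)) := by
  obtain ⟨s₁, hs₁⟩ : ∃ s₁, s₁ = ((startState n m C).storeR (costInput n m C) .u
    ⟨n + 1, fun _ => 0⟩).tick (3 + 1 + (n + 1) + 1) := ⟨_, rfl⟩
  have L₁ : Small n m s₁ :=
    hs₁ ▸ small_startState.storeR .u (show n + 1 ≤ n + m + 1 by omega) _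
  have E₁ : Exec ω (costInput n m C) (.allocR .u (N .n + 1) .zero) (startState n m C) s₁ := by
    rw [hs₁]; exact .allocR rfl rfl
  obtain ⟨s₂, hs₂⟩ : ∃ s₂, s₂ = (s₁.storeR (costInput n m C) .v
    ⟨m + 1, fun _ => 0⟩).tick (3 + 1 + (m + 1) + 1) := ⟨_, rfl⟩
  have L₂ : Small n m s₂ := hs₂ ▸ L₁.storeR .v (show m + 1 ≤ n + m + 1 by omega) _
  have E₂ : Exec ω (costInput n m C) (.allocR .v (N .m + 1) .zero) s₁ s₂ := by
    rw [hs₂]; exact .allocR (show some (s₁.nv .m + 1) = _ by rw [L₁.hm]) rfl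
  obtain ⟨s₃, hs₃⟩ : ∃ s₃, s₃ = (s₂.storeN (costInput n m C) .ρ
    ⟨n, fun _ => 0⟩).tick (1 + 1 + n + 1) := ⟨_, rfl⟩
  have L₃ : Small n m s₃ := hs₃ ▸ L₂.storeN .ρ (show n ≤ n + m + 1 by omega) _
  have E₃ : Exec ω (costInput n m C) (.allocN .ρ (N .n) 0) s₂ s₃ := by
    rw [hs₃]; exact .allocN (congrArg some L₂.hn) rfl
  obtain ⟨s₄, hs₄⟩ : ∃ s₄, s₄ = (s₃.storeN (costInput n m C) .ϱ
    ⟨m, fun _ => 0⟩).tick (1 + 1 + m + 1) := ⟨_, rfl⟩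
  have L₄ : Small n m s₄ := hs₄ ▸ L₃.storeN .ϱ (show m ≤ n + m + 1 by omega) _
  have E₄ : Exec ω (costInput n m C) (.allocN .ϱ (N .m) 0) s₃ s₄ := by
    rw [hs₄]; exact .allocN (congrArg some L₃.hm) rfl
  have hlenN : ∀ a, (s₄.na a).len = (preCtx n m C s₄.peak).lenN a := by
    intro a
    cases a <;> simp [hs₄, hs₃, hs₂, hs₁, State.tick, State.storeN, State.storeR, startState,
      preCtx]
  have hlenR : ∀ a, (s₄.ra a).len = (preCtx n m C s₄.peak).lenR a := by
    intro a
    cases a <;> simp [hs₄, hs₃, hs₂, hs₁, State.tick, State.storeN, State.storeR, startState,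
      preCtx]
  have hΓ : (preCtx n m C s₄.peak).space ≤ s₄.peak := by
    have e : (preCtx n m C s₄.peak).space = space (costInput n m C) s₄.na s₄.ra := by
      simp only [Ctx.space, space, hlenN, hlenR]
      rfl
    rw [e, hs₄]
    exact le_max_right _ _
  have hst : toState (preCtx n m C s₄.peak) s₄.store = s₄ :=
    toState_store L₄.hn L₄.hm hlenN hlenR rfl
  have hu₀ : s₄.store.u = fun _ => 0 := by
    simp [State.store, hs₄, hs₃, hs₂, hs₁, State.tick, State.storeN, State.storeR]
  have hv₀ : s₄.store.v = fun _ => 0 := by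
    simp [State.store, hs₄, hs₃, hs₂, State.tick, State.storeN, State.storeR]
  have hρ₀ : s₄.store.ρ = fun _ => 0 := by
    simp [State.store, hs₄, hs₃, State.tick, State.storeN]
  have hϱ₀ : s₄.store.ϱ = fun _ => 0 := by
    simp [State.store, hs₄, State.tick, State.storeN]
  have ht₀ : s₄.store.time = 2 * n + 2 * m + 18 := by
    simp only [State.store, hs₄, hs₃, hs₂, hs₁, State.tick, State.storeN, State.storeR, startState]
    omega
  obtain ⟨y, hy, hL, ht⟩ := vc_sound (ω := ω) (x := s₄.store)
    (Q := fun y => (∃ u v : ℕ → ℝ, Slack n m C y.ρ y.ϱ u v ∧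
      (∀ i, 1 ≤ i → i ≤ n + 1 → y.u i = (u i : ℝ)) ∧
      ∀ j, 1 ≤ j → j ≤ m + 1 → y.v j = (v j : ℝ)) ∧ y.time ≤ 1000 * ((n + 1) * (m + 1)))
    hΓ (initU ;; initV ;; greedy ;; nullCols) (by
      rw [vc_seq]
      refine vc_mono (vc_initU (ω := ω) (x := s₄.store) hΓ)
        fun y₁ ⟨_, _, T₁, _, U, e₁, hU, hUn, hT₁⟩ => ?_
      rw [hu₀] at hUn
      have hu : ∀ a, 1 ≤ a → a ≤ n + 1 → U a = (((U a).toReal : ℝ) : EReal) := by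
        intro a ha ha'
        rcases Nat.lt_or_ge n a with h | h
        · obtain rfl : a = n + 1 := by omega
          rw [hUn]; rfl
        · obtain ⟨d, hd, -⟩ := hU a ha h
          rw [hd, EReal.toReal_coe]
      rw [vc_seq]
      refine vc_mono (vc_initV (ω := ω) (x := y₁) (u := fun a => (U a).toReal) hΓ (by rw [e₁]; exact hu))
        fun y₂ ⟨_, _, T₂, _, V, e₂, hV, hVm, hT₂⟩ => ?_
      rw [e₁] at e₂ hVm hT₂
      simp only [hv₀] at hVm
      have hv : ∀ b, 1 ≤ b → b ≤ m + 1 → V b = (((V b).toReal : ℝ) : EReal) := by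
        intro b hb hb'
        rcases Nat.lt_or_ge m b with h | h
        · obtain rfl : b = m + 1 := by omega
          rw [hVm]; rfl
        · obtain ⟨d, hd, -⟩ := hV b hb h
          rw [hd, EReal.toReal_coe]
      have hS : Slack n m C (fun _ => 0) (fun _ => 0) (fun a => (U a).toReal)
          (fun b => (V b).toReal) := by
        refine slack_zero (isDualFeasible_of_le hC.2 ?_ ?_ (fun a ha ha' => ?_)
          fun b hb hb' a ha ha' => ?_)
        · rw [hUn]; rfl
        · rw [hVm]; rfl
        · obtain ⟨d, hd, h⟩ := hU a ha ha'
          rw [hd, EReal.toReal_coe]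
          exact h _ (by omega) le_rfl
        · obtain ⟨d, hd, h⟩ := hV b hb hb'
          simp only [hd, EReal.toReal_coe]
          exact h a ha ha'
      rw [vc_seq]
      refine vc_mono (vc_greedy (ω := ω) (x := y₂) (u := fun a => (U a).toReal)
        (v := fun b => (V b).toReal) hΓ
        (by rw [e₂]; simp only [hρ₀, hϱ₀]; exact hS) (by rw [e₂]; exact hu)
        (by rw [e₂]; exact hv) (by rw [e₂]; simp [hρ₀]))
        fun y₃ ⟨_, _, _, T₃, _, _, e₃, hS₃, hT₃⟩ => ?_
      rw [e₂] at e₃ hT₃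
      refine vc_mono (vc_nullCols (ω := ω) (x := y₃) (u := fun a => (U a).toReal)
        (v := fun b => (V b).toReal) hΓ
        (by rw [e₃]; exact hS₃) (by rw [e₃]; exact hv)) fun y₄ ⟨_, T₄, _, e₄, hS₄, hT₄⟩ => ?_
      rw [e₃] at e₄ hS₄ hT₄
      subst e₄
      refine ⟨⟨_, _, hS₄, hu, hv⟩, ?_⟩
      refine le_trans ?_ (preTime_bound n m)
      simp only at hT₂ hT₃ hT₄ ⊢
      rw [ht₀] at hT₁
      omega)
  rw [hst] at hy
  refine ⟨toState (preCtx n m C s₄.peak) y, ?_, ?_, ht⟩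
  · rw [preproc_eq]
    exact .seq E₁ (.seq E₂ (.seq E₃ (.seq E₄ hy)))
  · exact ⟨rfl, rfl, rfl, rfl, rfl, rfl, fun a => (hlenN a).symm.le.trans (L₄.lenN a),
      fun a => (hlenR a).symm.le.trans (L₄.lenR a), L₄.peak_le, hL⟩

/-! ### The bounds for time and space -/

theorem cells_le (hn : 1 ≤ n) (hm : 1 ≤ m) : cells n m ≤ 100 * (n * m) := by
  have h1 : n ≤ n * m := Nat.le_mul_of_pos_right n hm
  have h2 : m ≤ n * m := Nat.le_mul_of_pos_left m hn
  have h3 : (n + 1) * (m + 1) = n * m + n + m + 1 := by ring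
  rw [cells, h3]
  omega

theorem mul_min_mul_eq (n m : ℕ) : n * min n m * m = min n m ^ 2 * max n m := by
  rcases le_total n m with h | h
  · rw [min_eq_left h, max_eq_right h]; ring
  · rw [min_eq_right h, max_eq_left h]; ring

theorem phaseTime_le (hn : 1 ≤ n) (hm : 1 ≤ m) :
    phaseTime n m ≤ 60000 * (min n m ^ 2 * max n m) := by
  have hd : 1 ≤ min n m := le_min hn hm
  have h1 : colTime n m * (m + 1) ≤ 8000 * n * (3 * min n m) * (2 * m) := by
    unfold colTime
    exact Nat.mul_le_mul (Nat.mul_le_mul (by omega) (by omega)) (by omega)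
  have h2 : n * 1 * 1 ≤ n * min n m * m := Nat.mul_le_mul (Nat.mul_le_mul_left n hd) hm
  have h3 : 1 * 1 * m ≤ n * min n m * m := Nat.mul_le_mul_right m (Nat.mul_le_mul hn hd)
  have h4 : 8000 * n * (3 * min n m) * (2 * m) = 48000 * (n * min n m * m) := by ring
  rw [← mul_min_mul_eq, phaseTime]
  rw [h4] at h1
  generalize n * min n m * m = A at *
  omega

/-- For positive `n` and `m` the time of the pre-processing does not exceed that of the search. -/
theorem preTime_le (hn : 1 ≤ n) (hm : 1 ≤ m) :
    1000 * ((n + 1) * (m + 1)) ≤ 4000 * (min n m ^ 2 * max n m) := by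
  have hd : 1 ≤ min n m := le_min hn hm
  have h1 : (n + 1) * (m + 1) ≤ (2 * n) * (2 * m) := Nat.mul_le_mul (by omega) (by omega)
  have h2 : n * 1 * m ≤ n * min n m * m := Nat.mul_le_mul_right m (Nat.mul_le_mul_left n hd)
  rw [← mul_min_mul_eq]
  nlinarith

end
end LSAPE

theorem mainTheorem1 :
    ∃ K : ℕ, ∀ (n m : ℕ) (C : ℕ → ℕ → ℝ), LSAPE.IsEditCost n m C → ∀ ω : ℕ → ℕ,
      -- the algorithm started from any partial assignment and dual variables that satisfy
      -- complementary slackness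
      (∀ (φ₀ : ℕ → Finset ℕ) (ρ ϱ : ℕ → ℕ) (u v : ℕ → ℝ),
        LSAPE.IsPartialEpsAssignment n m φ₀ → LSAPE.Encodes n m ρ ϱ φ₀ →
        LSAPE.CompSlack n m C φ₀ u v →
        ∃ s : LSAPE.State,
          LSAPE.Exec ω (LSAPE.costInput n m C) LSAPE.hungarian
            (LSAPE.loadState n m C ρ ϱ u v) s ∧
          LSAPE.ReturnsAssignment n m C s ∧
          LSAPE.ReturnsDual n m C s ∧
          (1 ≤ n → 1 ≤ m →
            s.time ≤ K * ((min n m) ^ 2 * max n m) ∧ s.peak ≤ K * (n * m))) ∧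
      -- the algorithm started after the pre-processing
      ∃ s : LSAPE.State,
        LSAPE.Exec ω (LSAPE.costInput n m C) (LSAPE.preproc ;; LSAPE.hungarian)
          (LSAPE.startState n m C) s ∧
        LSAPE.ReturnsAssignment n m C s ∧
        LSAPE.ReturnsDual n m C s ∧
        (1 ≤ n → 1 ≤ m →
          s.time ≤ K * ((min n m) ^ 2 * max n m) ∧ s.peak ≤ K * (n * m)) := by
  -- `200000` exceeds twice the constant of `phaseTime_le` plus that of `preTime_le`.
  refine ⟨200000, fun n m C hC ω => ?_⟩
  have hphase : 1 ≤ n → 1 ≤ m → LSAPE.phaseTime n m + LSAPE.phaseTime m n ≤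
      120000 * (min n m ^ 2 * max n m) := by
    intro hn hm
    have h1 := LSAPE.phaseTime_le hn hm
    have h2 := LSAPE.phaseTime_le hm hn
    rw [min_comm m n, max_comm m n] at h2
    omega
  constructor
  · intro φ₀ ρ ϱ u v hφ he hc
    obtain ⟨s, hE, hA, hD, ht, hp⟩ :=
      (LSAPE.loaded_loadState hφ he hc).exec_hungarian hC ω
    refine ⟨s, hE, hA, hD, fun hn hm => ?_⟩
    have h0 : (LSAPE.loadState n m C ρ ϱ u v).time = 0 := rfl
    have h1 := hphase hn hm
    have h2 := LSAPE.cells_le hn hm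
    omega
  · obtain ⟨s₁, hE₁, hL, ht₁⟩ := LSAPE.exec_preproc hC ω
    obtain ⟨s, hE, hA, hD, ht, hp⟩ := hL.exec_hungarian hC ω
    refine ⟨s, .seq hE₁ hE, hA, hD, fun hn hm => ?_⟩
    have h1 := hphase hn hm
    have h2 := LSAPE.cells_le hn hm
    have h3 := LSAPE.preTime_le hn hm
    omega
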